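/- Let $Q=\mathbb R/\mathbb Z$ with $\|x\|=\min_{k\in\mathbb Z}|x-k|$, and for probability measures $\nu_1,\nu_2$ on $Q$ let $W_{\rm per}^2(\nu_1,\nu_2)=\inf_\pi\int_{Q\times Q}\|x-y\|^2\,d\pi$, where $\pi$ ranges over the couplings of $\nu_1$ and $\nu_2$; we write $1$ for the Lebesgue measure on $Q$. For $T>0$ let $\mathcal A_T^*$ be the set of measures $\mu=dt\otimes\mu_t$ on $(-T,T)\times Q$ such that for a.e. $t$ the slice $\mu_t=\sum_i\phi_i\delta_{X_i}$ is a purely atomic probability measure, and such that there is a finite signed measure $m\ll\mu$ with $\partial_t\mu+\partial_x m=0$ in the sense of distributions on $(-T,T)\times Q$. For $\mu\in\mathcal A_T^*$ set $$I(\mu)=\int_{-T}^{T}\#\{x\in Q:\mu_t(\{x\})>0\}\,dt+\inf_m\int_{(-T,T)\times Q}\Big|\frac{dm}{d\mu}\Big|^2d\mu,$$ the infimum being over all such $m$. If $I(\mu)<\infty$, then $t\mapsto\mu_t$ has (off a null set of times) weak limits $\mu_{\pm T}$ as $t\to\pm T$. For $\lambda,T>0$ define $$E^{1d}_{\lambda,T}(\mu)=I(\mu)+\lambda\big(W_{\rm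 per}^2(\mu_T,1)+W_{\rm per}^2(\mu_{-T},1)\big),$$ with $E^{1d}_{\lambda,T}(\mu)=\infty$ if $I(\mu)=\infty$. **Theorem 1.6.** There are universal constants $\varepsilon,c,C>0$ such that, for all $\lambda,T>0$ with $\lambda\min(1,T)\le\varepsilon$ and every minimizer $\mu$ of $E^{1d}_{\lambda,T}$ over $\mathcal A_T^*$, there exist an integer $N\ge1$ and a point $x_0\in Q$ with $$\mu_t=\frac1N\sum_{i=0}^{N-1}\delta_{x_0+i/N}\quad\text{for a.e. }t\in(-T,T)$$ (so $\mu$ consists of $N$ equidistant straight vertical segments, each carrying mass $1/N$), and $$c\,\max\Big(1,\frac{\lambda}{T}\Big)^{1/3}\le N\le C\,\max\Big(1,\frac{\lambda}{T}\Big)^{1/3}.$$ -/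

import Mathlib

open MeasureTheory ProbabilityTheory Filter Topology Set
open scoped ENNReal ContDiff

noncomputable section

/-- The torus `Q = ℝ / ℤ`. Its norm is the distance to the nearest integer and its `volume` is the
uniform probability measure. -/
abbrev Q : Type := UnitAddCircle

/-- The squared periodic Wasserstein distance: infimum, over all measures `π` on `Q × Q` with
marginals `ν₁` and `ν₂`, of the transport cost `∫ ‖x - y‖² dπ`. -/
def WperSq (ν₁ ν₂ : Measure Q) : ℝ≥0∞ :=
  ⨅ (π : Measure (Q × Q)) (_ : π.map Prod.fst = ν₁) (_ : π.map Prod.snd = ν₂),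
    ∫⁻ p, ‖p.1 - p.2‖ₑ ^ 2 ∂π

/-- The measure `ν` is purely atomic: `ν = ∑ i, φ i • δ_{X i}`. Zero weights are allowed, so that
finite sums are included. -/
def IsPurelyAtomic (ν : Measure Q) : Prop :=
  ∃ (φ : ℕ → ℝ≥0∞) (X : ℕ → Q), ν = Measure.sum fun i => φ i • Measure.dirac (X i)

/-- The measure `dt ⊗ μ_t` on `(-T, T) × Q`. -/
def spaceTime (T : ℝ) (μ : Kernel ℝ Q) : Measure (ℝ × Q) :=
  (volume.restrict (Ioo (-T) T)) ⊗ₘ μ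

/-- `∂_t φ`. -/
def timeDeriv (φ : ℝ × Q → ℝ) (z : ℝ × Q) : ℝ := deriv (fun s : ℝ => φ (s, z.2)) z.1

/-- `∂_x φ`. -/
def spaceDeriv (φ : ℝ × Q → ℝ) (z : ℝ × Q) : ℝ :=
  deriv (fun h : ℝ => φ (z.1, z.2 + (h : Q))) 0

/-- Test functions `φ ∈ C_c^∞((-T, T) × Q)`. A function on `ℝ × Q` is smooth when its lift to
`ℝ × ℝ` is; a closed subset of `ℝ × Q` contained in `(-T, T) × Q` is compact. -/
structure IsTestFunction (T : ℝ) (φ : ℝ × Q → ℝ) : Prop where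
  smooth : ContDiff ℝ ∞ fun p : ℝ × ℝ => φ (p.1, (p.2 : Q))
  support_subset : tsupport φ ⊆ Ioo (-T) T ×ˢ univ

/-- The finite signed measure `m = v μ` (that is `m ≪ μ` with density `dm/dμ = v`) solves
`∂_t μ + ∂_x m = 0` on `(-T, T) × Q` in the sense of distributions. -/
structure IsVelocity (T : ℝ) (μ : Kernel ℝ Q) (v : ℝ × Q → ℝ) : Prop where
  integrable : Integrable v (spaceTime T μ)
  continuity_eq : ∀ φ : ℝ × Q → ℝ, IsTestFunction T φ →
    ∫ z, (timeDeriv φ z + v z * spaceDeriv φ z) ∂(spaceTime T μ) = 0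

/-- The admissible measures `μ = dt ⊗ μ_t` on `(-T, T) × Q`, given by their time slices `μ_t`:
probability measures that are purely atomic for a.e. `t`, such that some flux `m ≪ μ` solves the
continuity equation. Only the slices with `t ∈ (-T, T)`, up to a null set of times, matter. -/
structure Admissible (T : ℝ) (μ : Kernel ℝ Q) : Prop where
  markov : IsMarkovKernel μ
  atomic : ∀ᵐ t ∂(volume.restrict (Ioo (-T) T)), IsPurelyAtomic (μ t)
  velocity : ∃ v : ℝ × Q → ℝ, IsVelocity T μ v

/-- The perimeter `∫_{-T}^T #{atoms of μ_t} dt`. -/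
def perimeter (T : ℝ) (μ : Kernel ℝ Q) : ℝ≥0∞ :=
  ∫⁻ t in Ioo (-T) T, (({x : Q | μ t {x} ≠ 0}.encard : ℕ∞) : ℝ≥0∞)

/-- The kinetic energy `∫ |dm/dμ|² dμ` of `m = v μ`. -/
def kinetic (T : ℝ) (μ : Kernel ℝ Q) (v : ℝ × Q → ℝ) : ℝ≥0∞ :=
  ∫⁻ z, ‖v z‖ₑ ^ 2 ∂(spaceTime T μ)

/-- The internal energy `I(μ) = min_m I(μ, m)` over the solutions `m = v μ` of the continuity
equation. -/
def internalEnergy (T : ℝ) (μ : Kernel ℝ Q) : ℝ≥0∞ :=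
  ⨅ (v : ℝ × Q → ℝ) (_ : IsVelocity T μ v), (perimeter T μ + kinetic T μ v)

/-- `ν` is the trace of `t ↦ μ_t` along the filter `l`: outside a null set of times, `μ_t`
converges weakly to `ν` along `l`. -/
def IsTrace (l : Filter ℝ) (μ : Kernel ℝ Q) (ν : ProbabilityMeasure Q) : Prop :=
  ∀ f : C(Q, ℝ), Tendsto (fun t => ∫ x, f x ∂(μ t)) (l ⊓ ae volume)
    (𝓝 (∫ x, f x ∂(ν : Measure Q)))

/-- `W_per²(ν, 1)` for the trace `ν` of `μ` along `l` (the trace is unique; the value is `∞` if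
there is none, which does not happen for measures of finite internal energy). -/
def traceCost (l : Filter ℝ) (μ : Kernel ℝ Q) : ℝ≥0∞ :=
  ⨅ (ν : ProbabilityMeasure Q) (_ : IsTrace l μ ν), WperSq (ν : Measure Q) volume

/-- The energy `I(μ) + λ (W_per²(μ_T, 1) + W_per²(μ_{-T}, 1))`. -/
def energy (lam T : ℝ) (μ : Kernel ℝ Q) : ℝ≥0∞ :=
  internalEnergy T μ +
    ENNReal.ofReal lam * (traceCost (𝓝[<] T) μ + traceCost (𝓝[>] (-T)) μ)

/-- `μ` minimizes the energy among all admissible measures. -/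
def IsMinimizer (lam T : ℝ) (μ : Kernel ℝ Q) : Prop :=
  Admissible T μ ∧ ∀ ν : Kernel ℝ Q, Admissible T ν → energy lam T μ ≤ energy lam T ν

/-- The measure `∑_{i < N} (1/N) δ_{x₀ + i/N}`: `N` equidistant atoms, each of mass `1/N`. -/
def equidistant (N : ℕ) (x₀ : Q) : Measure Q :=
  ∑ i ∈ Finset.range N, (N : ℝ≥0∞)⁻¹ • Measure.dirac (x₀ + (((i : ℝ) / N : ℝ) : Q))

end

/-! The core is an inequality for a curve with `N` atoms at almost every time: for every weight `L >
0`, the kinetic energy plus `L` times the two transport costs is at least `L / (6 N ^ 2)`, which is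
`L` times the boundary cost of `N` equidistant straight segments.

It is proved by duality on each side of a time `s`. Put `σ t = T - t + 1 / L` and `ζ (t, x) = inf_y
(‖x - y‖ ^ 2 / σ t - r t y)`. Along speed `v` the quotient `‖x - y‖ ^ 2 / σ` has derivative `-v ^ 2
+ ‖x + σ v - y‖ ^ 2 / σ ^ 2`. So `ζ` loses at most `v ^ 2` per unit time if `r` grows at rate `dist²
(y, {x + σ v}) / σ ^ 2`, the distance being taken to all the points where the atoms would land at
constant speed (`isSubsolution_hopfLax`). If `r s` is the squared distance to the atoms of `μ s`,
divided by `σ s`, then `ζ ≥ 0` on these atoms; at time `T`, `σ = 1 / L` and `ζ` is at most `L ‖x -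
y‖ ^ 2 - r T y`. Hence kinetic energy plus `L` times the cost bounds the mean of `r T`. A squared
distance to `n` points of the circle has mean at least `1 / (12 n ^ 2)` (`quantization_le`), and
since `∫ 1 / σ ^ 2 = L - 1 / σ s` the contributions add up to `L / (12 N ^ 2)` per side
(`IsVelocity.energy_lower_bound`).

For a minimizer, let `N` be the essential minimum of the number of atoms, attained at a generic time
`s`. Having `n > N` atoms weakens the bound by at most the rate `L ^ 2 (n - N) / (6 N ^ 3)`
(`IsFiniteCurve.lower_bound`). If `λ ^ 2 ≤ 3 N ^ 3`, half of the excess perimeter pays for this when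
`L = λ`. Comparison with `N` straight segments shows that there is no excess, and that the minimal
energy is `2 T N + λ / (6 N ^ 2)`. The same bound with `L = 2 λ` leaves no room for kinetic energy,
so the curve is constant (`ae_slice_eq_of_small_velocity`), and equality in the quantization bound
makes it equidistant (`eq_equidistant_of_transportCost_le`).

The other case, `λ ^ 2 > 3 N ^ 3`, is where smallness enters: time `s` alone already forces so much
energy that `2 N` segments would be cheaper (`IsFiniteCurve.coarse_lower_bound`,
`coarse_count_contradiction`). The size of `N` follows from its minimizing `2 T n + λ / (6 n ^ 2)`.
-/

/-! ### The norm of the circle and the quantization bound. -/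

lemma circle_norm_le_half (x : Q) : ‖x‖ ≤ 1 / 2 := by
  simpa using AddCircle.norm_le_half_period (1 : ℝ) (x := x) one_ne_zero

lemma circle_norm_coe_le (r : ℝ) : ‖(r : Q)‖ ≤ |r| := by
  rw [UnitAddCircle.norm_eq]
  simpa using round_le r 0

lemma circle_norm_coe_eq {r : ℝ} (h : |r| ≤ 1 / 2) : ‖(r : Q)‖ = |r| := by
  rw [AddCircle.norm_coe_eq_abs_iff (1 : ℝ) one_ne_zero]
  simpa using h

lemma circle_exists_rep (x : Q) : ∃ r : ℝ, (r : Q) = x ∧ |r| = ‖x‖ := by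
  induction x using QuotientAddGroup.induction_on with
  | H r =>
    refine ⟨r - round r, ?_, (UnitAddCircle.norm_eq).symm⟩
    have : ((round r : ℝ) : Q) = 0 := by
      have := AddCircle.coe_eq_zero_iff (1 : ℝ) (x := (round r : ℝ))
      exact this.2 ⟨round r, by simp⟩
    rw [AddCircle.coe_sub, this, sub_zero]

lemma circle_abs_sq_sub_sq_le (x y : Q) : |‖x‖ ^ 2 - ‖y‖ ^ 2| ≤ ‖x - y‖ := by
  have h1 := circle_norm_le_half x
  have h2 := circle_norm_le_half y
  have h3 := abs_norm_sub_norm_le x y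
  have h4 := norm_nonneg x
  have h5 := norm_nonneg y
  rw [sq_sub_sq, abs_mul]
  have : |‖x‖ + ‖y‖| ≤ 1 := by rw [abs_le]; constructor <;> linarith
  nlinarith [abs_nonneg (‖x‖ - ‖y‖), abs_nonneg (‖x‖ + ‖y‖)]

lemma integral_circle_norm (f : ℝ → ℝ) :
    ∫ y : Q, f ‖y‖ = ∫ u in (-(1 / 2) : ℝ)..(1 / 2), f |u| := by
  have h := UnitAddCircle.intervalIntegral_preimage (-(1 / 2) : ℝ) (fun y : Q => f ‖y‖)
  rw [← h, show (-(1 / 2) + 1 : ℝ) = 1 / 2 by norm_num]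
  refine intervalIntegral.integral_congr fun u hu => ?_
  rw [uIcc_of_le (by norm_num)] at hu
  rw [circle_norm_coe_eq (abs_le.2 ⟨hu.1, hu.2⟩)]

/-- For `a ≤ 1 / 2` the truncated paraboloid does not wrap around the circle, so its mass is that of
a paraboloid on the line. -/
lemma integral_circle_hat {a : ℝ} (ha0 : 0 ≤ a) (ha : a ≤ 1 / 2) (p : Q) :
    ∫ y : Q, max (a ^ 2 - ‖y - p‖ ^ 2) 0 = 4 * a ^ 3 / 3 := by
  rw [integral_sub_right_eq_self (fun y : Q => max (a ^ 2 - ‖y‖ ^ 2) 0) p,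
    integral_circle_norm (fun r => max (a ^ 2 - r ^ 2) 0)]
  simp only [sq_abs]
  have hc : Continuous fun u : ℝ => max (a ^ 2 - u ^ 2) 0 := by fun_prop
  rw [← intervalIntegral.integral_add_adjacent_intervals (b := -a)
      (hc.intervalIntegrable _ _) (hc.intervalIntegrable _ _),
    ← intervalIntegral.integral_add_adjacent_intervals (a := -a) (b := a)
      (hc.intervalIntegrable _ _) (hc.intervalIntegrable _ _)]
  have h1 : ∫ u in (-(1 / 2) : ℝ)..(-a), max (a ^ 2 - u ^ 2) 0 = 0 := by
    rw [intervalIntegral.integral_congr (g := fun _ => (0 : ℝ))]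
    · simp
    · intro u hu
      rw [uIcc_of_le (by linarith)] at hu
      simp only
      exact max_eq_right (by nlinarith [hu.2])
  have h2 : ∫ u in a..(1 / 2), max (a ^ 2 - u ^ 2) 0 = 0 := by
    rw [intervalIntegral.integral_congr (g := fun _ => (0 : ℝ))]
    · simp
    · intro u hu
      rw [uIcc_of_le (by linarith)] at hu
      simp only
      exact max_eq_right (by nlinarith [hu.1])
  have h3 : ∫ u in (-a)..a, max (a ^ 2 - u ^ 2) 0 = 4 * a ^ 3 / 3 := by
    rw [intervalIntegral.integral_congr (g := fun u => a ^ 2 - u ^ 2)]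
    · rw [intervalIntegral.integral_sub (by simp) (by simp)]
      simp
      ring
    · intro u hu
      rw [uIcc_of_le (by linarith)] at hu
      simp only
      exact max_eq_left (by nlinarith [hu.1, hu.2])
  rw [h1, h2, h3]
  ring

/-- The Voronoi bound: a function above the squared distance to a finite set is above a truncated
sum of paraboloids centred at the points of the set. -/
lemma sub_sum_hat_le (P : Finset Q) (a : ℝ) {p : Q} (hp : p ∈ P) (y : Q) :
    a ^ 2 - ∑ q ∈ P, max (a ^ 2 - ‖y - q‖ ^ 2) 0 ≤ ‖y - p‖ ^ 2 := by
  have := Finset.single_le_sum (f := fun q => max (a ^ 2 - ‖y - q‖ ^ 2) 0)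
    (fun q _ => le_max_right _ _) hp
  have h2 : a ^ 2 - ‖y - p‖ ^ 2 ≤ max (a ^ 2 - ‖y - p‖ ^ 2) 0 := le_max_left _ _
  linarith

lemma circle_continuous_integrable {f : Q → ℝ} (hf : Continuous f) : Integrable f volume :=
  hf.integrable_of_hasCompactSupport (HasCompactSupport.of_compactSpace f)

lemma integral_sub_sum_hat (P : Finset Q) {a : ℝ} (ha0 : 0 ≤ a) (ha : a ≤ 1 / 2) :
    ∫ y : Q, (a ^ 2 - ∑ q ∈ P, max (a ^ 2 - ‖y - q‖ ^ 2) 0) = a ^ 2 - P.card * (4 * a ^ 3 / 3) := by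
  rw [integral_sub, integral_finsetSum]
  · simp [integral_circle_hat ha0 ha, measureReal_def]
  · intro q _
    exact circle_continuous_integrable (by fun_prop)
  · exact integrable_const _
  · exact circle_continuous_integrable (by fun_prop)

/-- Each paraboloid of the Voronoi bound has a mass independent of its centre, so integration leaves
`a ^ 2 - n * (4 * a ^ 3 / 3)` with a free radius. The sharp choice `a = 1 / (2 n)` is half the
spacing of `n` equidistant points. -/
lemma quantization_le (P : Finset Q) {n : ℕ} (hn : 0 < n) (hP : P.card ≤ n) {d : Q → ℝ}
    (hd : Integrable d) (h : ∀ y, ∃ p ∈ P, ‖y - p‖ ^ 2 ≤ d y) :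
    1 / (12 * (n : ℝ) ^ 2) ≤ ∫ y, d y := by
  have hn' : (0 : ℝ) < n := by exact_mod_cast hn
  have hn1 : (1 : ℝ) ≤ n := by exact_mod_cast hn
  set a : ℝ := 1 / (2 * n) with ha
  have ha0 : 0 < a := by positivity
  have ha1 : a ≤ 1 / 2 := by
    rw [ha, div_le_div_iff₀ (by positivity) (by norm_num)]; linarith
  have h1 : ∫ y : Q, (a ^ 2 - ∑ q ∈ P, max (a ^ 2 - ‖y - q‖ ^ 2) 0) ≤ ∫ y, d y := by
    refine integral_mono (circle_continuous_integrable (by fun_prop)) hd fun y => ?_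
    obtain ⟨p, hp, hpd⟩ := h y
    exact (sub_sum_hat_le P a hp y).trans hpd
  rw [integral_sub_sum_hat P ha0.le ha1] at h1
  have hP' : (P.card : ℝ) ≤ n := by exact_mod_cast hP
  have h2 : 1 / (12 * (n : ℝ) ^ 2) = a ^ 2 - n * (4 * a ^ 3 / 3) := by
    rw [ha]; field_simp; norm_num
  rw [h2]
  have : (0 : ℝ) ≤ 4 * a ^ 3 / 3 := by positivity
  nlinarith

/-! ### Calculus and mollification on `ℝ × Q`, through lifts to the plane. -/

lemma isOpenQuotientMap_circle_lift : IsOpenQuotientMap (fun p : ℝ × ℝ => (p.1, (p.2 : Q))) :=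
  IsOpenQuotientMap.prodMap IsOpenQuotientMap.id QuotientAddGroup.isOpenQuotientMap_mk

lemma continuous_of_lift {φ : ℝ × Q → ℝ} (h : Continuous fun p : ℝ × ℝ => φ (p.1, (p.2 : Q))) :
    Continuous φ :=
  isOpenQuotientMap_circle_lift.isQuotientMap.continuous_iff.2 h

lemma timeDeriv_eq {φ : ℝ × Q → ℝ} (h : ContDiff ℝ ∞ fun p : ℝ × ℝ => φ (p.1, (p.2 : Q)))
    (t x : ℝ) :
    timeDeriv φ (t, (x : Q)) = fderiv ℝ (fun p : ℝ × ℝ => φ (p.1, (p.2 : Q))) (t, x) (1, 0) := by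
  have hd := (h.differentiable (by simp) (t, x)).hasFDerivAt
  have hl : HasDerivAt (fun s : ℝ => (s, x)) ((1 : ℝ), (0 : ℝ)) t :=
    (hasDerivAt_id t).prodMk (hasDerivAt_const t x)
  exact (hd.comp_hasDerivAt t hl).deriv

lemma spaceDeriv_eq {φ : ℝ × Q → ℝ} (h : ContDiff ℝ ∞ fun p : ℝ × ℝ => φ (p.1, (p.2 : Q)))
    (t x : ℝ) :
    spaceDeriv φ (t, (x : Q)) = fderiv ℝ (fun p : ℝ × ℝ => φ (p.1, (p.2 : Q))) (t, x) (0, 1) := by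
  have hd := (h.differentiable (by simp) (t, x)).hasFDerivAt
  have hl : HasDerivAt (fun s : ℝ => (t, x + s)) ((0 : ℝ), (1 : ℝ)) 0 :=
    (hasDerivAt_const 0 t).prodMk ((hasDerivAt_id (0 : ℝ)).const_add x)
  have hd' : HasFDerivAt (fun p : ℝ × ℝ => φ (p.1, (p.2 : Q)))
      (fderiv ℝ (fun p : ℝ × ℝ => φ (p.1, (p.2 : Q))) (t, x)) (t, x + 0) := by simpa using hd
  have := (hd'.comp_hasDerivAt (0 : ℝ) hl).deriv
  rw [← this, spaceDeriv]
  rfl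

lemma continuous_timeDeriv {φ : ℝ × Q → ℝ}
    (h : ContDiff ℝ ∞ fun p : ℝ × ℝ => φ (p.1, (p.2 : Q))) : Continuous (timeDeriv φ) := by
  refine continuous_of_lift ?_
  simp_rw [fun p : ℝ × ℝ => timeDeriv_eq h p.1 p.2]
  exact (h.continuous_fderiv (by simp)).clm_apply continuous_const

lemma continuous_spaceDeriv {φ : ℝ × Q → ℝ}
    (h : ContDiff ℝ ∞ fun p : ℝ × ℝ => φ (p.1, (p.2 : Q))) : Continuous (spaceDeriv φ) := by
  refine continuous_of_lift ?_
  simp_rw [fun p : ℝ × ℝ => spaceDeriv_eq h p.1 p.2]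
  exact (h.continuous_fderiv (by simp)).clm_apply continuous_const

/-- A lower bound on difference quotients in the direction `(1, w)` bounds the convective
derivative from below. -/
lemma le_convective_deriv {φ : ℝ × Q → ℝ}
    (h : ContDiff ℝ ∞ fun p : ℝ × ℝ => φ (p.1, (p.2 : Q))) (z : ℝ × Q) (w c : ℝ)
    (hc : ∀ᶠ s in 𝓝[>] (0 : ℝ), s * c ≤ φ (z.1 + s, z.2 + (s * w : ℝ)) - φ z) :
    c ≤ timeDeriv φ z + w * spaceDeriv φ z := by
  obtain ⟨t, x⟩ := z
  induction x using QuotientAddGroup.induction_on with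
  | H x =>
  rw [timeDeriv_eq h, spaceDeriv_eq h, ← smul_eq_mul w, ← map_smul, ← map_add]
  set F := fun p : ℝ × ℝ => φ (p.1, (p.2 : Q)) with hF
  have hd := (h.differentiable (by simp) (t, x)).hasFDerivAt
  have hl : HasDerivAt (fun s : ℝ => (t + s, x + s * w)) ((1 : ℝ), (w : ℝ)) 0 := by
    refine ((hasDerivAt_id (0 : ℝ)).const_add t).prodMk ?_
    simpa using ((hasDerivAt_id (0 : ℝ)).mul_const w).const_add x
  have hd' : HasFDerivAt F (fderiv ℝ F (t, x)) (t + 0, x + 0 * w) := by simpa using hd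
  have hD := hd'.comp_hasDerivAt (0 : ℝ) hl
  -- Only forward difference quotients are controlled, but differentiability makes their limit the
  -- full directional derivative.
  have hD' := (hasDerivAt_iff_tendsto_slope_zero.1 hD).mono_left
    (nhdsWithin_mono 0 (show Ioi (0 : ℝ) ⊆ {0}ᶜ from fun s hs => ne_of_gt hs))
  have he : ((1 : ℝ), (0 : ℝ)) + w • ((0 : ℝ), (1 : ℝ)) = (1, w) := by simp
  rw [he]
  refine ge_of_tendsto hD' ?_
  filter_upwards [hc, self_mem_nhdsWithin] with s hs hs0
  have hs0 : 0 < s := hs0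
  rw [smul_eq_mul, le_inv_mul_iff₀ hs0]
  simpa [F, Function.comp] using hs

/-- Space-time mollification of a function on `ℝ × Q`. -/
noncomputable def mollify (ρ : ℝ × ℝ → ℝ) (ζ : ℝ × Q → ℝ) (z : ℝ × Q) : ℝ :=
  ∫ p : ℝ × ℝ, ρ p * ζ (z.1 - p.1, z.2 - (p.2 : Q))

lemma mollify_lift (ρ : ℝ × ℝ → ℝ) (ζ : ℝ × Q → ℝ) :
    (fun p : ℝ × ℝ => mollify ρ ζ (p.1, (p.2 : Q))) =
      convolution ρ (fun p : ℝ × ℝ => ζ (p.1, (p.2 : Q))) (ContinuousLinearMap.lsmul ℝ ℝ)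
        volume := by
  ext p
  rfl

lemma continuous_lift {ζ : ℝ × Q → ℝ} (hζ : Continuous ζ) :
    Continuous fun p : ℝ × ℝ => ζ (p.1, (p.2 : Q)) :=
  hζ.comp isOpenQuotientMap_circle_lift.continuous

lemma mollify_smooth (ρ : ContDiffBump (0 : ℝ × ℝ)) {ζ : ℝ × Q → ℝ} (hζ : Continuous ζ) :
    ContDiff ℝ ∞ fun p : ℝ × ℝ => mollify (ρ.normed volume) ζ (p.1, (p.2 : Q)) := by
  rw [mollify_lift]
  exact ρ.hasCompactSupport_normed.contDiff_convolution_left _ ρ.contDiff_normed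
    (continuous_lift hζ).locallyIntegrable

lemma mollify_integrable (ρ : ContDiffBump (0 : ℝ × ℝ)) {ζ : ℝ × Q → ℝ} (hζ : Continuous ζ)
    (z : ℝ × Q) :
    Integrable fun p : ℝ × ℝ => ρ.normed volume p * ζ (z.1 - p.1, z.2 - (p.2 : Q)) := by
  refine Continuous.integrable_of_hasCompactSupport ?_ ρ.hasCompactSupport_normed.mul_right
  have h1 : Continuous fun p : ℝ × ℝ => (z.1 - p.1, z.2 - (p.2 : Q)) := by
    have := isOpenQuotientMap_circle_lift.continuous
    fun_prop
  exact ρ.continuous_normed.mul (hζ.comp h1)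

lemma mollify_tendsto {ρ : ℕ → ContDiffBump (0 : ℝ × ℝ)}
    (hρ : Tendsto (fun n => (ρ n).rOut) atTop (𝓝 0)) {ζ : ℝ × Q → ℝ} (hζ : Continuous ζ)
    (z : ℝ × Q) :
    Tendsto (fun n => mollify ((ρ n).normed volume) ζ z) atTop (𝓝 (ζ z)) := by
  obtain ⟨t, x⟩ := z
  induction x using QuotientAddGroup.induction_on with
  | H x =>
  have := ContDiffBump.convolution_tendsto_right_of_continuous (μ := volume) hρ
    (continuous_lift hζ) (t, x)
  simp_rw [← mollify_lift] at this
  exact this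

lemma bump_normed_eq_zero (ρ : ContDiffBump (0 : ℝ × ℝ)) {p : ℝ × ℝ}
    (hp : ρ.rOut ≤ ‖p‖) : ρ.normed volume p = 0 := by
  by_contra hne
  have : p ∈ Function.support (ρ.normed volume) := hne
  rw [ρ.support_normed_eq] at this
  simp at this
  linarith

/-- Two integrands that compare on the support of the bump compare after mollification. -/
lemma le_mollify_sub (ρ : ContDiffBump (0 : ℝ × ℝ)) {ζ : ℝ × Q → ℝ} (hζ : Continuous ζ)
    (z z' : ℝ × Q) (c : ℝ)
    (h : ∀ p : ℝ × ℝ, |p.1| ≤ ρ.rOut → |p.2| ≤ ρ.rOut →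
      c ≤ ζ (z'.1 - p.1, z'.2 - (p.2 : Q)) - ζ (z.1 - p.1, z.2 - (p.2 : Q))) :
    c ≤ mollify (ρ.normed volume) ζ z' - mollify (ρ.normed volume) ζ z := by
  unfold mollify
  rw [← integral_sub (mollify_integrable ρ hζ z') (mollify_integrable ρ hζ z)]
  have h1 : c = ∫ p : ℝ × ℝ, ρ.normed volume p * c := by
    rw [integral_mul_const, ρ.integral_normed, one_mul]
  rw [h1]
  refine integral_mono (ρ.integrable_normed.mul_const c)
    ((mollify_integrable ρ hζ z').sub (mollify_integrable ρ hζ z)) fun p => ?_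
  simp only
  rcases le_or_gt ρ.rOut ‖p‖ with hp | hp
  · simp [bump_normed_eq_zero ρ hp]
  · rw [← mul_sub]
    refine mul_le_mul_of_nonneg_left (h p ?_ ?_) (ρ.nonneg_normed p)
    · exact (norm_fst_le p).trans hp.le
    · exact (norm_snd_le p).trans hp.le

lemma abs_mollify_le (ρ : ContDiffBump (0 : ℝ × ℝ)) {ζ : ℝ × Q → ℝ} (z : ℝ × Q) (B : ℝ)
    (h : ∀ p : ℝ × ℝ, |p.1| ≤ ρ.rOut → |ζ (z.1 - p.1, z.2 - (p.2 : Q))| ≤ B) :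
    |mollify (ρ.normed volume) ζ z| ≤ B := by
  unfold mollify
  have h1 : B = ∫ p : ℝ × ℝ, ρ.normed volume p * B := by
    rw [integral_mul_const, ρ.integral_normed, one_mul]
  rw [h1, ← Real.norm_eq_abs]
  refine norm_integral_le_of_norm_le (ρ.integrable_normed.mul_const B) (ae_of_all _ fun p => ?_)
  rcases le_or_gt ρ.rOut ‖p‖ with hp | hp
  · simp [bump_normed_eq_zero ρ hp]
  · rw [norm_mul, Real.norm_of_nonneg (ρ.nonneg_normed p), Real.norm_eq_abs]
    exact mul_le_mul_of_nonneg_left (h p ((norm_fst_le p).trans hp.le)) (ρ.nonneg_normed p)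

/-! ### Testing the continuity equation with continuous subsolutions. -/

instance spaceTime_isFiniteMeasure (T : ℝ) (μ : Kernel ℝ Q) [IsMarkovKernel μ] :
    IsFiniteMeasure (spaceTime T μ) := by
  unfold spaceTime; infer_instance

lemma spaceTime_map_fst (T : ℝ) (μ : Kernel ℝ Q) [IsMarkovKernel μ] :
    (spaceTime T μ).map Prod.fst = volume.restrict (Ioo (-T) T) :=
  Measure.fst_compProd _ _

lemma integrable_comp_fst {T : ℝ} {μ : Kernel ℝ Q} [IsMarkovKernel μ] {e : ℝ → ℝ}
    (he : IntegrableOn e (Ioo (-T) T)) : Integrable (fun z : ℝ × Q => e z.1) (spaceTime T μ) := by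
  have : Integrable e ((spaceTime T μ).map Prod.fst) := by rwa [spaceTime_map_fst]
  exact this.comp_measurable measurable_fst

lemma ae_spaceTime_mem (T : ℝ) (μ : Kernel ℝ Q) : ∀ᵐ z ∂(spaceTime T μ), z.1 ∈ Ioo (-T) T :=
  Measure.ae_compProd_of_ae_fst μ measurableSet_Ioo (ae_restrict_mem measurableSet_Ioo)

lemma integrable_spaceTime_of_continuous {T : ℝ} {μ : Kernel ℝ Q} [IsMarkovKernel μ]
    {f : ℝ × Q → ℝ} (hf : Continuous f) : Integrable f (spaceTime T μ) := by
  obtain ⟨B, hB⟩ := ((isCompact_Icc (a := -T) (b := T)).prod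
    (isCompact_univ (X := Q))).exists_bound_of_continuousOn hf.continuousOn
  refine (integrable_const B).mono' hf.aestronglyMeasurable ?_
  filter_upwards [ae_spaceTime_mem T μ] with z hz
  exact hB z ⟨Ioo_subset_Icc_self hz, mem_univ _⟩

lemma integrable_mul_spaceTime {T : ℝ} {μ : Kernel ℝ Q} [IsMarkovKernel μ]
    {f v : ℝ × Q → ℝ} (hf : Continuous f) (hv : Integrable v (spaceTime T μ)) :
    Integrable (fun z => v z * f z) (spaceTime T μ) := by
  obtain ⟨B, hB⟩ := ((isCompact_Icc (a := -T) (b := T)).prod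
    (isCompact_univ (X := Q))).exists_bound_of_continuousOn hf.continuousOn
  refine hv.mul_bdd (c := B) hf.aestronglyMeasurable ?_
  filter_upwards [ae_spaceTime_mem T μ] with z hz
  exact hB z ⟨Ioo_subset_Icc_self hz, mem_univ _⟩

/-- `ζ` is, up to the error `e`, a subsolution of the Hamilton-Jacobi equation along the
velocity `v`: to first order in `h`, `ζ` decreases at most by `h (v ^ 2 + e)` in the direction
`(1, v)`, uniformly near the support of `μ`. -/
def IsSubsolution (T : ℝ) (μ : Kernel ℝ Q) (v : ℝ × Q → ℝ) (e : ℝ → ℝ) (ζ : ℝ × Q → ℝ) : Prop :=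
  ∀ η > 0, ∃ δ > 0, ∀ᵐ z ∂(spaceTime T μ), ∀ t u h : ℝ, |t - z.1| ≤ δ → |u| ≤ δ → 0 < h → h ≤ δ →
    t + h < T → ζ (t, z.2 + (u : Q)) - h * (v z ^ 2 + e z.1 + η * (1 + v z ^ 2)) ≤
      ζ (t + h, z.2 + (u : Q) + (h * v z : ℝ))

/-- The subsolution inequality holds at every point within `δ` of `z` with the one velocity `v z`,
so it survives averaging over shifts; this is the reason for the uniformity in `IsSubsolution`. The
margin below `T` keeps the shifted times before `T`. -/
lemma mollify_subsolution {T : ℝ} {μ : Kernel ℝ Q} {v : ℝ × Q → ℝ} {e : ℝ → ℝ} {ζ : ℝ × Q → ℝ}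
    (hζ : Continuous ζ) {T₁ : ℝ} {η δ : ℝ} (hδ : 0 < δ)
    (hs : ∀ᵐ z ∂(spaceTime T μ), ∀ t u h : ℝ, |t - z.1| ≤ δ → |u| ≤ δ → 0 < h → h ≤ δ →
      t + h < T → ζ (t, z.2 + (u : Q)) - h * (v z ^ 2 + e z.1 + η * (1 + v z ^ 2)) ≤
        ζ (t + h, z.2 + (u : Q) + (h * v z : ℝ)))
    (ρ : ContDiffBump (0 : ℝ × ℝ)) (hρ : ρ.rOut ≤ δ) (hρT : T₁ + ρ.rOut < T) :
    ∀ᵐ z ∂(spaceTime T μ), z.1 ≤ T₁ → -(v z ^ 2 + e z.1 + η * (1 + v z ^ 2)) ≤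
      timeDeriv (mollify (ρ.normed volume) ζ) z +
        v z * spaceDeriv (mollify (ρ.normed volume) ζ) z := by
  filter_upwards [hs] with z hz hzT
  refine le_convective_deriv (mollify_smooth ρ hζ) z (v z) _ ?_
  have h1 : ∀ᶠ s in 𝓝[>] (0 : ℝ), s < min δ (T - T₁ - ρ.rOut) :=
    nhdsWithin_le_nhds (Iio_mem_nhds (lt_min hδ (by linarith)))
  filter_upwards [h1, self_mem_nhdsWithin] with s hs1 hs0
  have hs0 : 0 < s := hs0
  have hs2 := hs1.trans_le (min_le_left _ _)
  have hs3 := hs1.trans_le (min_le_right _ _)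
  refine le_mollify_sub ρ hζ _ _ _ fun p hp1 hp2 => ?_
  have hp1' := abs_le.1 hp1
  have := hz (z.1 - p.1) (-p.2) s (by rw [sub_sub_cancel_left, abs_neg]; linarith)
    (by rw [abs_neg]; linarith) hs0 hs2.le (by linarith [hp1'.1])
  have e1 : z.2 + ((-p.2 : ℝ) : Q) = z.2 - (p.2 : Q) := by
    rw [AddCircle.coe_neg, sub_eq_add_neg]
  rw [e1] at this
  have e2 : z.2 - (p.2 : Q) + ((s * v z : ℝ) : Q) = z.2 + ((s * v z : ℝ) : Q) - (p.2 : Q) := by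
    abel
  rw [e2, show z.1 - p.1 + s = z.1 + s - p.1 by ring] at this
  simp only
  linarith

lemma isTestFunction_mul {T : ℝ} {χ : ℝ → ℝ} (hχ : ContDiff ℝ ∞ χ) {a b : ℝ} (ha : -T < a)
    (hb : b < T) (hsupp : Function.support χ ⊆ Icc a b) {ζ : ℝ × Q → ℝ}
    (hζ : ContDiff ℝ ∞ fun p : ℝ × ℝ => ζ (p.1, (p.2 : Q))) :
    IsTestFunction T fun z => χ z.1 * ζ z where
  smooth := (hχ.comp contDiff_fst).mul hζ
  support_subset := by
    have h1 : tsupport (fun z : ℝ × Q => χ z.1 * ζ z) ⊆ Icc a b ×ˢ univ := by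
      refine closure_minimal ?_ (isClosed_Icc.prod isClosed_univ)
      intro z hz
      have : χ z.1 ≠ 0 := fun h0 => hz (by simp [h0])
      exact ⟨hsupp this, mem_univ _⟩
    exact h1.trans (prod_mono (fun t ht => ⟨by linarith [ht.1], by linarith [ht.2]⟩) le_rfl)

lemma timeDeriv_mul {χ : ℝ → ℝ} (hχ : ContDiff ℝ ∞ χ) {ζ : ℝ × Q → ℝ}
    (hζ : ContDiff ℝ ∞ fun p : ℝ × ℝ => ζ (p.1, (p.2 : Q))) (z : ℝ × Q) :
    timeDeriv (fun z => χ z.1 * ζ z) z = deriv χ z.1 * ζ z + χ z.1 * timeDeriv ζ z := by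
  obtain ⟨t, x⟩ := z
  induction x using QuotientAddGroup.induction_on with
  | H x =>
  have h1 : DifferentiableAt ℝ χ t := hχ.differentiable (by simp) t
  have h2 : DifferentiableAt ℝ (fun s : ℝ => ζ (s, (x : Q))) t := by
    have : Differentiable ℝ fun s : ℝ => (s, x) := by fun_prop
    exact ((hζ.differentiable (by simp)).comp this) t
  exact deriv_mul h1 h2

lemma spaceDeriv_mul {χ : ℝ → ℝ} {ζ : ℝ × Q → ℝ} (z : ℝ × Q) :
    spaceDeriv (fun z => χ z.1 * ζ z) z = χ z.1 * spaceDeriv ζ z := by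
  simp [spaceDeriv]

/-- Testing the continuity equation with a continuous subsolution. -/
lemma IsVelocity.integral_subsolution_le {T : ℝ} {μ : Kernel ℝ Q} [IsMarkovKernel μ]
    {v : ℝ × Q → ℝ} (hv : IsVelocity T μ v) (hv2 : Integrable (fun z => v z ^ 2) (spaceTime T μ))
    {e : ℝ → ℝ} (he : IntegrableOn e (Ioo (-T) T)) {ζ : ℝ × Q → ℝ} (hζ : Continuous ζ)
    (hs : IsSubsolution T μ v e ζ) {χ : ℝ → ℝ} (hχ : ContDiff ℝ ∞ χ) (hχ0 : ∀ t, 0 ≤ χ t)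
    {a b : ℝ} (ha : -T < a) (hb : b < T) (hsupp : Function.support χ ⊆ Icc a b) :
    ∫ z, deriv χ z.1 * ζ z ∂(spaceTime T μ) ≤ ∫ z, χ z.1 * (v z ^ 2 + e z.1) ∂(spaceTime T μ) := by
  have hE : Integrable (fun z : ℝ × Q => v z ^ 2 + e z.1) (spaceTime T μ) :=
    hv2.add (integrable_comp_fst he)
  have h1v : Integrable (fun z : ℝ × Q => 1 + v z ^ 2) (spaceTime T μ) :=
    (integrable_const 1).add hv2
  have hχc : Continuous fun z : ℝ × Q => χ z.1 := hχ.continuous.comp continuous_fst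
  have hχd : Continuous (deriv χ) := hχ.continuous_deriv (by simp)
  have hχdc : Continuous fun z : ℝ × Q => deriv χ z.1 := hχd.comp continuous_fst
  have hiE : Integrable (fun z : ℝ × Q => χ z.1 * (v z ^ 2 + e z.1)) (spaceTime T μ) := by
    simpa [mul_comm] using integrable_mul_spaceTime hχc hE
  have hi1 : Integrable (fun z : ℝ × Q => χ z.1 * (1 + v z ^ 2)) (spaceTime T μ) := by
    simpa [mul_comm] using integrable_mul_spaceTime hχc h1v
  -- The mollification radius tends to zero for fixed `η`; only afterwards does `η` tend to zero.
  suffices H : ∀ η > 0, ∫ z, deriv χ z.1 * ζ z ∂(spaceTime T μ) ≤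
      ∫ z, χ z.1 * (v z ^ 2 + e z.1) ∂(spaceTime T μ) +
        η * ∫ z, χ z.1 * (1 + v z ^ 2) ∂(spaceTime T μ) by
    have ht : Tendsto (fun η : ℝ => ∫ z, χ z.1 * (v z ^ 2 + e z.1) ∂(spaceTime T μ) +
        η * ∫ z, χ z.1 * (1 + v z ^ 2) ∂(spaceTime T μ)) (𝓝[>] 0)
        (𝓝 (∫ z, χ z.1 * (v z ^ 2 + e z.1) ∂(spaceTime T μ))) := by
      have hc : Continuous (fun η : ℝ => ∫ z, χ z.1 * (v z ^ 2 + e z.1) ∂(spaceTime T μ) +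
        η * ∫ z, χ z.1 * (1 + v z ^ 2) ∂(spaceTime T μ)) := by fun_prop
      have := (hc.tendsto 0).mono_left (nhdsWithin_le_nhds (s := Ioi 0))
      simpa using this
    refine ge_of_tendsto ht ?_
    filter_upwards [self_mem_nhdsWithin] with η hη using H η hη
  intro η hη
  obtain ⟨δ, hδ, hsδ⟩ := hs η hη
  -- The bound by `1` gives one compact set, hence one dominating constant, for all mollifications;
  -- the other two are those `mollify_subsolution` asks for.
  set R : ℕ → ℝ := fun n => min 1 (min δ ((T - b) / 2)) / (n + 1) with hR
  have hm0 : 0 < min 1 (min δ ((T - b) / 2)) := lt_min one_pos (lt_min hδ (by linarith))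
  have hR0 : ∀ n, 0 < R n := fun n => div_pos hm0 (by positivity)
  have hRle : ∀ n, R n ≤ min 1 (min δ ((T - b) / 2)) := fun n =>
    div_le_self hm0.le (by linarith [(Nat.cast_nonneg n : (0 : ℝ) ≤ n)])
  let ρ : ℕ → ContDiffBump (0 : ℝ × ℝ) := fun n => ⟨R n / 2, R n, half_pos (hR0 n),
    half_lt_self (hR0 n)⟩
  have hρ : Tendsto (fun n => (ρ n).rOut) atTop (𝓝 0) := by
    have := (tendsto_one_div_add_atTop_nhds_zero_nat (𝕜 := ℝ)).const_mul
      (min 1 (min δ ((T - b) / 2)))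
    rw [mul_zero] at this
    refine this.congr fun n => ?_
    simp only [ρ, hR]
    ring
  have key : ∀ n, ∫ z, deriv χ z.1 * mollify ((ρ n).normed volume) ζ z ∂(spaceTime T μ) ≤
      ∫ z, χ z.1 * (v z ^ 2 + e z.1) ∂(spaceTime T μ) +
        η * ∫ z, χ z.1 * (1 + v z ^ 2) ∂(spaceTime T μ) := by
    intro n
    have hρn : (ρ n).rOut ≤ min 1 (min δ ((T - b) / 2)) := hRle n
    have hρ1 : (ρ n).rOut ≤ δ := hρn.trans ((min_le_right _ _).trans (min_le_left _ _))
    have hρ2 : (ρ n).rOut ≤ (T - b) / 2 := hρn.trans ((min_le_right _ _).trans (min_le_right _ _))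
    set g := mollify ((ρ n).normed volume) ζ with hg
    have hgs := mollify_smooth (ρ n) hζ
    have hgc : Continuous g := continuous_of_lift hgs.continuous
    have hz := hv.continuity_eq _ (isTestFunction_mul hχ ha hb hsupp hgs)
    simp_rw [timeDeriv_mul hχ hgs, spaceDeriv_mul] at hz
    have hi2 : Integrable (fun z => deriv χ z.1 * g z) (spaceTime T μ) :=
      integrable_spaceTime_of_continuous (hχdc.mul hgc)
    have hi3 : Integrable (fun z => χ z.1 * (timeDeriv g z + v z * spaceDeriv g z))
        (spaceTime T μ) := by
      have h1 := (integrable_spaceTime_of_continuous (T := T) (μ := μ)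
        (hχc.mul (continuous_timeDeriv hgs))).add
        (integrable_mul_spaceTime (hχc.mul (continuous_spaceDeriv hgs)) hv.integrable)
      refine h1.congr (ae_of_all _ fun z => ?_)
      simp only [Pi.add_apply, Pi.mul_apply]
      ring
    have hz' : ∫ z, deriv χ z.1 * g z ∂(spaceTime T μ) +
        ∫ z, χ z.1 * (timeDeriv g z + v z * spaceDeriv g z) ∂(spaceTime T μ) = 0 := by
      rw [← integral_add hi2 hi3, ← hz]
      congr 1
      ext z
      ring
    have hmono : ∫ z, -(χ z.1 * (v z ^ 2 + e z.1) + η * (χ z.1 * (1 + v z ^ 2))) ∂(spaceTime T μ) ≤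
        ∫ z, χ z.1 * (timeDeriv g z + v z * spaceDeriv g z) ∂(spaceTime T μ) := by
      refine integral_mono_ae (hiE.add (hi1.const_mul η)).neg hi3 ?_
      filter_upwards [mollify_subsolution (T₁ := b) hζ hδ hsδ (ρ n) hρ1 (by linarith)] with z hz
      -- The pointwise bound is available only up to time `b`; off the support of `χ` both sides
      -- vanish.
      by_cases hχz : χ z.1 = 0
      · simp [hχz]
      · have := mul_le_mul_of_nonneg_left (hz (hsupp hχz).2) (hχ0 z.1)
        linarith
    rw [integral_neg, integral_add hiE (hi1.const_mul η), integral_const_mul] at hmono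
    linarith
  have hlim : Tendsto (fun n => ∫ z, deriv χ z.1 * mollify ((ρ n).normed volume) ζ z
      ∂(spaceTime T μ)) atTop (𝓝 (∫ z, deriv χ z.1 * ζ z ∂(spaceTime T μ))) := by
    obtain ⟨B, hB⟩ := ((isCompact_Icc (a := -T - 1) (b := T + 1)).prod
      (isCompact_univ (X := Q))).exists_bound_of_continuousOn hζ.continuousOn
    refine tendsto_integral_of_dominated_convergence (fun z => |deriv χ z.1| * B) ?_ ?_ ?_ ?_
    · intro n
      exact (hχdc.mul (continuous_of_lift (mollify_smooth (ρ n) hζ).continuous)).aestronglyMeasurable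
    · exact integrable_spaceTime_of_continuous (by fun_prop)
    · intro n
      filter_upwards [ae_spaceTime_mem T μ] with z hz
      rw [norm_mul, Real.norm_eq_abs, Real.norm_eq_abs]
      refine mul_le_mul_of_nonneg_left (abs_mollify_le (ρ n) z B fun p hp => ?_) (abs_nonneg _)
      have hρn : (ρ n).rOut ≤ 1 := (hRle n).trans (min_le_left _ _)
      have hp' := abs_le.1 (hp.trans hρn)
      exact hB _ ⟨⟨by linarith [hz.1, hp'.2], by linarith [hz.2, hp'.1]⟩, mem_univ _⟩
    · exact ae_of_all _ fun z => (mollify_tendsto hρ hζ z).const_mul _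
  exact le_of_tendsto' hlim key

/-! ### From distributional inequalities to inequalities between almost all pairs of times. -/

lemma bump_intervalIntegral_eq_one (φ : ContDiffBump (0 : ℝ)) {c d : ℝ} (hc : c ≤ -φ.rOut)
    (hd : φ.rOut ≤ d) : ∫ t in c..d, φ.normed volume t = 1 := by
  rw [intervalIntegral.integral_eq_integral_of_support_subset, φ.integral_normed]
  rw [φ.support_normed_eq, Real.ball_eq_Ioo]
  intro t ht
  exact ⟨by linarith [ht.1], by linarith [ht.2]⟩

lemma bump_intervalIntegral_eq_zero (φ : ContDiffBump (0 : ℝ)) {c d : ℝ} (hcd : c ≤ d)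
    (h : d ≤ -φ.rOut ∨ φ.rOut ≤ c) : ∫ t in c..d, φ.normed volume t = 0 := by
  refine intervalIntegral.integral_zero_ae (ae_of_all _ fun t ht => ?_)
  rw [uIoc_of_le hcd] at ht
  by_contra hne
  have : t ∈ Function.support (φ.normed volume) := hne
  rw [φ.support_normed_eq, Real.ball_eq_Ioo] at this
  rcases h with h | h
  · linarith [ht.2, this.1]
  · linarith [ht.1, this.2]

/-- The smooth approximation of the indicator of `(a, b)` obtained by integrating a bump. -/
noncomputable def smoothStep (φ : ContDiffBump (0 : ℝ)) (a b t : ℝ) : ℝ :=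
  ∫ s in (t - b)..(t - a), φ.normed volume s

lemma smoothStep_hasDerivAt (φ : ContDiffBump (0 : ℝ)) (a b t : ℝ) :
    HasDerivAt (smoothStep φ a b) (φ.normed volume (t - a) - φ.normed volume (t - b)) t := by
  have hc := φ.continuous_normed (μ := volume)
  have h1 : ∀ c, HasDerivAt (fun t : ℝ => ∫ s in (0 : ℝ)..(t - c), φ.normed volume s)
      (φ.normed volume (t - c)) t := by
    intro c
    have := intervalIntegral.integral_hasDerivAt_right (hc.intervalIntegrable 0 (t - c))
      (hc.stronglyMeasurableAtFilter _ _) hc.continuousAt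
    have h2 := this.scomp t ((hasDerivAt_id t).sub_const c)
    rw [one_smul] at h2
    exact h2
  refine ((h1 a).sub (h1 b)).congr_of_eventuallyEq (Eventually.of_forall fun s => ?_)
  simp only [smoothStep, Pi.sub_apply]
  rw [intervalIntegral.integral_interval_sub_left (hc.intervalIntegrable _ _)
    (hc.intervalIntegrable _ _)]

lemma smoothStep_contDiff (φ : ContDiffBump (0 : ℝ)) (a b : ℝ) :
    ContDiff ℝ ∞ (smoothStep φ a b) := by
  rw [contDiff_infty_iff_deriv]
  refine ⟨fun t => (smoothStep_hasDerivAt φ a b t).differentiableAt, ?_⟩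
  have : deriv (smoothStep φ a b) = fun t => φ.normed volume (t - a) - φ.normed volume (t - b) :=
    funext fun t => (smoothStep_hasDerivAt φ a b t).deriv
  rw [this]
  exact (φ.contDiff_normed.comp (contDiff_id.sub contDiff_const)).sub
    (φ.contDiff_normed.comp (contDiff_id.sub contDiff_const))

lemma smoothStep_nonneg (φ : ContDiffBump (0 : ℝ)) {a b : ℝ} (hab : a ≤ b) (t : ℝ) :
    0 ≤ smoothStep φ a b t :=
  intervalIntegral.integral_nonneg (by linarith) fun s _ => φ.nonneg_normed s

lemma smoothStep_le_one (φ : ContDiffBump (0 : ℝ)) {a b : ℝ} (hab : a ≤ b) (t : ℝ) :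
    smoothStep φ a b t ≤ 1 := by
  rw [smoothStep, intervalIntegral.integral_of_le (by linarith), ← φ.integral_normed (μ := volume)]
  exact setIntegral_le_integral φ.integrable_normed (ae_of_all _ fun s => φ.nonneg_normed s)

lemma smoothStep_support (φ : ContDiffBump (0 : ℝ)) {a b : ℝ} (hab : a ≤ b) :
    Function.support (smoothStep φ a b) ⊆ Icc (a - φ.rOut) (b + φ.rOut) := by
  intro t ht
  by_contra hn
  refine ht (bump_intervalIntegral_eq_zero φ (by linarith) ?_)
  rw [mem_Icc, not_and_or] at hn
  rcases hn with hn | hn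
  · left; linarith
  · right; linarith

/-- A one-sided du Bois-Reymond lemma: a distributional lower bound on the derivative integrates. -/
lemma exists_ae_sub_le_integral {T : ℝ} {G κ : ℝ → ℝ} (hG : IntegrableOn G (Ioo (-T) T))
    (hκ : IntegrableOn κ (Ioo (-T) T))
    (h : ∀ χ : ℝ → ℝ, ContDiff ℝ ∞ χ → (∀ t, 0 ≤ χ t) → ∀ a b, -T < a → b < T →
      Function.support χ ⊆ Icc a b →
      ∫ t in Ioo (-T) T, deriv χ t * G t ≤ ∫ t in Ioo (-T) T, χ t * κ t) :
    ∃ S ⊆ Ioo (-T) T, (∀ᵐ t ∂(volume.restrict (Ioo (-T) T)), t ∈ S) ∧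
      ∀ a ∈ S, ∀ b ∈ S, a < b → G a - G b ≤ ∫ t in a..b, κ t := by
  set G' : ℝ → ℝ := (Ioo (-T) T).indicator G with hG'
  have hGi : Integrable G' := (integrable_indicator_iff measurableSet_Ioo).2 hG
  let φ : ℕ → ContDiffBump (0 : ℝ) := fun n =>
    ⟨1 / (n + 1) / 2, 1 / (n + 1), by positivity, half_lt_self (by positivity)⟩
  have hφ : Tendsto (fun n => (φ n).rOut) atTop (𝓝 0) :=
    tendsto_one_div_add_atTop_nhds_zero_nat (𝕜 := ℝ)
  have hφK : ∀ᶠ n in atTop, (φ n).rOut ≤ 2 * (φ n).rIn := Eventually.of_forall fun n => by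
    simp only [φ]; linarith
  have hae := ContDiffBump.ae_convolution_tendsto_right_of_locallyIntegrable hφ hφK
    hGi.locallyIntegrable
  -- The derivative of `smoothStep` is a bump at `a` minus a bump at `b`, so testing with it
  -- produces averages of `G` near `a` and `b`. `S` consists of the times at which these averages
  -- converge to `G`.
  set S : Set ℝ := {t ∈ Ioo (-T) T | Tendsto (fun n => convolution ((φ n).normed volume) G'
    (ContinuousLinearMap.lsmul ℝ ℝ) volume t) atTop (𝓝 (G' t))} with hS
  refine ⟨S, fun t ht => ht.1, ?_, ?_⟩
  · filter_upwards [ae_restrict_mem measurableSet_Ioo, ae_restrict_of_ae hae] with t h1 h2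
    exact ⟨h1, h2⟩
  · intro a ha b hb hab
    have hconv : ∀ n c, convolution ((φ n).normed volume) G' (ContinuousLinearMap.lsmul ℝ ℝ)
        volume c = ∫ t, (φ n).normed volume (t - c) * G' t := by
      intro n c
      rw [convolution_eq_swap]
      refine integral_congr_ae (ae_of_all _ fun t => ?_)
      simp only [ContinuousLinearMap.lsmul_apply, smul_eq_mul]
      rw [← (φ n).normed_neg, neg_sub]
    have hint : ∀ n c, Integrable fun t => (φ n).normed volume (t - c) * G' t := by
      intro n c
      have hc : Continuous fun t => (φ n).normed volume (t - c) :=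
        (φ n).continuous_normed.comp (continuous_id.sub continuous_const)
      obtain ⟨B, hB⟩ := (φ n).continuous_normed (μ := volume).bounded_above_of_compact_support
        (φ n).hasCompactSupport_normed
      exact hGi.bdd_mul (c := B) hc.aestronglyMeasurable (ae_of_all _ fun t => hB _)
    have hlim1 : Tendsto (fun n => ∫ t in Ioo (-T) T, deriv (smoothStep (φ n) a b) t * G t) atTop
        (𝓝 (G a - G b)) := by
      have h1 := ha.2.sub hb.2
      have e1 : G' a - G' b = G a - G b := by
        rw [hG', indicator_of_mem ha.1, indicator_of_mem hb.1]
      rw [e1] at h1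
      refine h1.congr fun n => ?_
      rw [hconv, hconv, ← integral_sub (hint n a) (hint n b), ← integral_indicator measurableSet_Ioo]
      refine integral_congr_ae (ae_of_all _ fun t => ?_)
      simp only [(smoothStep_hasDerivAt (φ n) a b _).deriv]
      by_cases ht : t ∈ Ioo (-T) T
      · simp only [hG', indicator_of_mem ht]; ring
      · simp [hG', indicator_of_notMem ht]
    have hlim2 : Tendsto (fun n => ∫ t in Ioo (-T) T, smoothStep (φ n) a b t * κ t) atTop
        (𝓝 (∫ t in a..b, κ t)) := by
      have e2 : ∫ t in a..b, κ t = ∫ t in Ioo (-T) T, (Ioo a b).indicator κ t := by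
        rw [intervalIntegral.integral_of_le hab.le, setIntegral_indicator measurableSet_Ioo,
          integral_Ioc_eq_integral_Ioo]
        congr 2
        refine (inter_eq_right.2 fun t ht => ?_).symm
        exact ⟨ha.1.1.trans ht.1, ht.2.trans hb.1.2⟩
      rw [e2]
      refine tendsto_integral_of_dominated_convergence (fun t => |κ t|) ?_ hκ.abs ?_ ?_
      · intro n
        exact (smoothStep_contDiff (φ n) a b).continuous.aestronglyMeasurable.mul
          hκ.aestronglyMeasurable
      · intro n
        refine ae_of_all _ fun t => ?_
        rw [norm_mul, Real.norm_of_nonneg (smoothStep_nonneg _ hab.le t), Real.norm_eq_abs]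
        exact mul_le_of_le_one_left (abs_nonneg _) (smoothStep_le_one _ hab.le t)
      · have hne : ∀ᵐ t ∂(volume.restrict (Ioo (-T) T)), t ∉ ({a, b} : Set ℝ) :=
          ae_restrict_of_ae ((Set.toFinite {a, b}).measure_zero volume |> measure_eq_zero_iff_ae_notMem.1)
        filter_upwards [hne] with t ht
        simp only [mem_insert_iff, mem_singleton_iff, not_or] at ht
        by_cases hab' : t ∈ Ioo a b
        · rw [indicator_of_mem hab']
          have hm : 0 < min (t - a) (b - t) := lt_min (by linarith [hab'.1]) (by linarith [hab'.2])
          refine tendsto_const_nhds.congr' ?_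
          filter_upwards [hφ.eventually_le_const hm] with n hn
          have h1 := hn.trans (min_le_left _ _)
          have h2 := hn.trans (min_le_right _ _)
          rw [smoothStep, bump_intervalIntegral_eq_one (φ n) (by linarith) (by linarith), one_mul]
        · rw [indicator_of_notMem hab']
          have hm : 0 < max (a - t) (t - b) := by
            rw [mem_Ioo, not_and_or, not_lt, not_lt] at hab'
            rcases hab' with h | h
            · exact lt_max_of_lt_left (sub_pos.2 (lt_of_le_of_ne h ht.1))
            · exact lt_max_of_lt_right (sub_pos.2 (lt_of_le_of_ne h (Ne.symm ht.2)))
          refine tendsto_const_nhds.congr' ?_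
          filter_upwards [hφ.eventually_le_const hm] with n hn
          rw [smoothStep, bump_intervalIntegral_eq_zero (φ n) (by linarith), zero_mul]
          rcases le_max_iff.1 hn with h | h
          · left; linarith
          · right; linarith
    have hm : 0 < min (a + T) (T - b) := lt_min (by linarith [ha.1.1]) (by linarith [hb.1.2])
    refine le_of_tendsto_of_tendsto hlim1 hlim2 ?_
    filter_upwards [hφ.eventually_lt_const hm] with n hn
    have h1 := hn.trans_le (min_le_left _ _)
    have h2 := hn.trans_le (min_le_right _ _)
    exact h _ (smoothStep_contDiff _ _ _) (smoothStep_nonneg _ hab.le) _ _ (by linarith)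
      (by linarith) (smoothStep_support _ hab.le)

/-- The kinetic energy at time `t`. -/
noncomputable def speedSq (μ : Kernel ℝ Q) (v : ℝ × Q → ℝ) (t : ℝ) : ℝ := ∫ x, v (t, x) ^ 2 ∂(μ t)

lemma speedSq_nonneg (μ : Kernel ℝ Q) (v : ℝ × Q → ℝ) (t : ℝ) : 0 ≤ speedSq μ v t :=
  integral_nonneg fun _ => sq_nonneg _

lemma integrable_integral_slice {T : ℝ} {μ : Kernel ℝ Q} [IsMarkovKernel μ] {f : ℝ × Q → ℝ}
    (hf : Integrable f (spaceTime T μ)) : IntegrableOn (fun t => ∫ x, f (t, x) ∂(μ t)) (Ioo (-T) T) := by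
  have h := hf.integral_compProd
  exact h

lemma integral_spaceTime {T : ℝ} {μ : Kernel ℝ Q} [IsMarkovKernel μ] {f : ℝ × Q → ℝ}
    (hf : Integrable f (spaceTime T μ)) :
    ∫ z, f z ∂(spaceTime T μ) = ∫ t in Ioo (-T) T, ∫ x, f (t, x) ∂(μ t) :=
  Measure.integral_compProd hf

lemma IsVelocity.exists_ae_sub_le {T : ℝ} {μ : Kernel ℝ Q} [IsMarkovKernel μ]
    {v : ℝ × Q → ℝ} (hv : IsVelocity T μ v) (hv2 : Integrable (fun z => v z ^ 2) (spaceTime T μ))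
    {e : ℝ → ℝ} (he : IntegrableOn e (Ioo (-T) T)) {ζ : ℝ × Q → ℝ} (hζ : Continuous ζ)
    (hs : IsSubsolution T μ v e ζ) :
    ∃ S ⊆ Ioo (-T) T, (∀ᵐ t ∂(volume.restrict (Ioo (-T) T)), t ∈ S) ∧
      ∀ a ∈ S, ∀ b ∈ S, a < b → ∫ x, ζ (a, x) ∂(μ a) - ∫ x, ζ (b, x) ∂(μ b) ≤
        ∫ t in a..b, (speedSq μ v t + e t) := by
  have hζi := integrable_spaceTime_of_continuous (T := T) (μ := μ) hζ
  refine exists_ae_sub_le_integral (integrable_integral_slice hζi)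
    ((integrable_integral_slice hv2).add he) ?_
  intro χ hχ hχ0 a b ha hb hsupp
  have h := hv.integral_subsolution_le hv2 he hζ hs hχ hχ0 ha hb hsupp
  have hχc : Continuous fun z : ℝ × Q => χ z.1 := hχ.continuous.comp continuous_fst
  have hχd : Continuous (deriv χ) := hχ.continuous_deriv (by simp)
  have hχdc : Continuous fun z : ℝ × Q => deriv χ z.1 := hχd.comp continuous_fst
  have hE : Integrable (fun z : ℝ × Q => v z ^ 2 + e z.1) (spaceTime T μ) :=
    hv2.add (integrable_comp_fst he)
  have hiE : Integrable (fun z : ℝ × Q => χ z.1 * (v z ^ 2 + e z.1)) (spaceTime T μ) := by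
    simpa [mul_comm] using integrable_mul_spaceTime hχc hE
  have hiχ : Integrable (fun z : ℝ × Q => deriv χ z.1 * ζ z) (spaceTime T μ) :=
    integrable_spaceTime_of_continuous (hχdc.mul hζ)
  rw [integral_spaceTime hiχ, integral_spaceTime hiE] at h
  have h2 : ∀ᵐ t ∂(volume.restrict (Ioo (-T) T)), Integrable (fun x => v (t, x) ^ 2) (μ t) :=
    ((Measure.integrable_compProd_iff hv2.aestronglyMeasurable).1 hv2).1
  simp_rw [integral_const_mul] at h
  refine h.trans_eq (integral_congr_ae ?_)
  filter_upwards [h2] with t ht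
  rw [integral_add ht (integrable_const _)]
  simp [speedSq]

/-! ### Weak continuity in time, traces, and passage to the endpoints. -/

/-- Stone–Weierstrass for the algebra of Lipschitz functions, whose members `dist · x` separate
points. A countable family is wanted so that the exceptional null sets of times can be united. -/
lemma exists_dense_lipschitz :
    ∃ f : ℕ → C(Q, ℝ), (∀ k, ∃ K, LipschitzWith K (f k)) ∧ DenseRange f := by
  let A : Subalgebra ℝ C(Q, ℝ) :=
    { carrier := {f | ∃ K, LipschitzWith K f}
      mul_mem' := by
        rintro f g ⟨K, hK⟩ ⟨L, hL⟩
        refine ⟨‖f‖₊ * L + ‖g‖₊ * K, LipschitzWith.of_dist_le_mul fun x y => ?_⟩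
        have h1 := hK.dist_le_mul x y
        have h2 := hL.dist_le_mul x y
        have h3 := f.norm_coe_le_norm x
        have h4 := g.norm_coe_le_norm y
        rw [Real.dist_eq] at *
        rw [Real.norm_eq_abs] at h3 h4
        have e : (f * g) x - (f * g) y = f x * (g x - g y) + g y * (f x - f y) := by
          simp only [ContinuousMap.mul_apply]; ring
        rw [e]
        refine (abs_add_le _ _).trans ?_
        rw [abs_mul, abs_mul]
        push_cast
        have h5 := mul_le_mul h3 h2 (abs_nonneg _) (norm_nonneg _)
        have h6 := mul_le_mul h4 h1 (abs_nonneg _) (norm_nonneg _)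
        linarith
      add_mem' := by
        rintro f g ⟨K, hK⟩ ⟨L, hL⟩
        exact ⟨K + L, hK.add hL⟩
      algebraMap_mem' := fun r => ⟨0, LipschitzWith.const r⟩ }
  have hsep : A.SeparatesPoints := by
    intro x y hxy
    refine ⟨fun z => dist z x, ⟨⟨fun z => dist z x, by fun_prop⟩, ⟨1, LipschitzWith.dist_left x⟩, rfl⟩, ?_⟩
    simpa using hxy.symm
  have hd : Dense {f : C(Q, ℝ) | ∃ K, LipschitzWith K f} := by
    have := ContinuousMap.subalgebra_topologicalClosure_eq_top_of_separatesPoints A hsep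
    rw [SetLike.ext'_iff, Subalgebra.topologicalClosure_coe] at this
    exact dense_iff_closure_eq.2 this
  obtain ⟨t, hts, htc, htd⟩ := hd.exists_countable_dense_subset
  obtain ⟨f, rfl⟩ := htc.exists_eq_range htd.nonempty
  exact ⟨f, fun k => hts (mem_range_self k), htd⟩

/-- By Young's inequality `K |v| ≤ v ^ 2 + K ^ 2 / 4`. Applied to `f` and `-f`, this yields the
modulus of continuity of `t ↦ ∫ f dμ_t`. -/
lemma isSubsolution_of_lipschitz (T : ℝ) (μ : Kernel ℝ Q) (v : ℝ × Q → ℝ) {f : Q → ℝ} {K : NNReal}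
    (hf : LipschitzWith K f) : IsSubsolution T μ v (fun _ => (K : ℝ) ^ 2 / 4) (fun z => f z.2) := by
  intro η hη
  refine ⟨1, one_pos, ae_of_all _ fun z t u h _ _ hh _ _ => ?_⟩
  have h1 := hf.dist_le_mul (z.2 + (u : Q)) (z.2 + (u : Q) + (h * v z : ℝ))
  rw [Real.dist_eq, dist_eq_norm, sub_add_cancel_left, norm_neg] at h1
  have h2 := circle_norm_coe_le (h * v z)
  rw [abs_mul, abs_of_pos hh] at h2
  have h3 := (le_abs_self _).trans h1
  have hK : (0 : ℝ) ≤ K := K.2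
  have h4 : (K : ℝ) * ‖((h * v z : ℝ) : Q)‖ ≤ K * (h * |v z|) := mul_le_mul_of_nonneg_left h2 hK
  have h5 : K * |v z| ≤ v z ^ 2 + (K : ℝ) ^ 2 / 4 := by
    nlinarith [sq_nonneg (|v z| - K / 2), sq_abs (v z)]
  have h6 : h * (K * |v z|) ≤ h * (v z ^ 2 + (K : ℝ) ^ 2 / 4 + η * (1 + v z ^ 2)) := by
    refine mul_le_mul_of_nonneg_left ?_ hh.le
    nlinarith [mul_nonneg hη.le (add_nonneg zero_le_one (sq_nonneg (v z)))]
  simp only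
  linarith

lemma IsVelocity.exists_ae_abs_sub_le {T : ℝ} {μ : Kernel ℝ Q} [IsMarkovKernel μ]
    {v : ℝ × Q → ℝ} (hv : IsVelocity T μ v) (hv2 : Integrable (fun z => v z ^ 2) (spaceTime T μ))
    {f : Q → ℝ} {K : NNReal} (hf : LipschitzWith K f) :
    ∃ S ⊆ Ioo (-T) T, (∀ᵐ t ∂(volume.restrict (Ioo (-T) T)), t ∈ S) ∧
      ∀ a ∈ S, ∀ b ∈ S, a < b → |∫ x, f x ∂(μ a) - ∫ x, f x ∂(μ b)| ≤
        ∫ t in a..b, (speedSq μ v t + (K : ℝ) ^ 2 / 4) := by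
  have hc : Continuous fun z : ℝ × Q => f z.2 := hf.continuous.comp continuous_snd
  have hc' : Continuous fun z : ℝ × Q => -f z.2 := hc.neg
  have hi : IntegrableOn (fun _ : ℝ => (K : ℝ) ^ 2 / 4) (Ioo (-T) T) := integrable_const _
  obtain ⟨S, hS, hSae, h⟩ := hv.exists_ae_sub_le hv2 hi hc (isSubsolution_of_lipschitz T μ v hf)
  obtain ⟨S', -, hSae', h'⟩ := hv.exists_ae_sub_le hv2 hi hc'
    (isSubsolution_of_lipschitz T μ v hf.neg)
  refine ⟨S ∩ S', inter_subset_left.trans hS, by filter_upwards [hSae, hSae'] with t h1 h2 using ⟨h1, h2⟩, ?_⟩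
  intro a ha b hb hab
  have h1 := h a ha.1 b hb.1 hab
  have h2 := h' a ha.2 b hb.2 hab
  simp only [integral_neg] at h2
  rw [abs_le]
  constructor <;> linarith

lemma abs_integral_sub_le (ν : Measure Q) [IsProbabilityMeasure ν] (f g : C(Q, ℝ)) :
    |∫ x, f x ∂ν - ∫ x, g x ∂ν| ≤ ‖f - g‖ := by
  have hi : ∀ f : C(Q, ℝ), Integrable f ν := fun f =>
    f.continuous.integrable_of_hasCompactSupport (HasCompactSupport.of_compactSpace f)
  rw [← integral_sub (hi f) (hi g), ← Real.norm_eq_abs]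
  refine (norm_integral_le_of_norm_le_const (ae_of_all _ fun x =>
    (f - g).norm_coe_le_norm x)).trans ?_
  simp

/-- Convergence of slices may be tested on a dense family of functions. -/
lemma isTrace_of_dense {l : Filter ℝ} {μ : Kernel ℝ Q} [IsMarkovKernel μ] {ν : ProbabilityMeasure Q}
    {f : ℕ → C(Q, ℝ)} (hf : DenseRange f)
    (h : ∀ k, Tendsto (fun t => ∫ x, f k x ∂(μ t)) (l ⊓ ae volume) (𝓝 (∫ x, f k x ∂(ν : Measure Q)))) :
    IsTrace l μ ν := by
  intro g
  rw [Metric.tendsto_nhds]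
  intro ε hε
  obtain ⟨k, hk⟩ := hf.exists_dist_lt g (show 0 < ε / 3 by linarith)
  rw [dist_eq_norm] at hk
  filter_upwards [Metric.tendsto_nhds.1 (h k) (ε / 3) (by linarith)] with t ht
  have h1 := abs_integral_sub_le (μ t) g (f k)
  have h2 := abs_integral_sub_le (ν : Measure Q) g (f k)
  rw [Real.dist_eq] at *
  rw [abs_lt] at *
  rw [abs_le] at h1 h2
  constructor <;> linarith [h1.1, h1.2, h2.1, h2.2, ht.1, ht.2]

/-- For almost every time, the curve of slices is weakly continuous at that time. -/
lemma IsVelocity.ae_isTrace {T : ℝ} {μ : Kernel ℝ Q} [IsMarkovKernel μ]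
    {v : ℝ × Q → ℝ} (hv : IsVelocity T μ v) (hv2 : Integrable (fun z => v z ^ 2) (spaceTime T μ)) :
    ∀ᵐ s ∂(volume.restrict (Ioo (-T) T)), IsTrace (𝓝 s) μ ⟨μ s, inferInstance⟩ := by
  obtain ⟨f, hfL, hfd⟩ := exists_dense_lipschitz
  choose K hK using hfL
  choose S hS hSae hSle using fun k => hv.exists_ae_abs_sub_le hv2 (hK k)
  filter_upwards [ae_all_iff.2 hSae, ae_restrict_mem measurableSet_Ioo] with s hs hsI
  refine isTrace_of_dense hfd fun k => ?_
  have hκ : IntegrableOn (fun t => speedSq μ v t + (K k : ℝ) ^ 2 / 4) (Ioo (-T) T) :=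
    (integrable_integral_slice hv2).add (integrable_const _)
  have hT : -T < T := hsI.1.trans hsI.2
  have hκ' : IntegrableOn (fun t => speedSq μ v t + (K k : ℝ) ^ 2 / 4) (uIcc (-T) T) := by
    rw [uIcc_of_le hT.le]; exact (integrableOn_Icc_iff_integrableOn_Ioo (by simp) (by simp)).2 hκ
  have hcont := intervalIntegral.continuousOn_primitive_interval' (a := s)
    (hκ'.mono_set uIoc_subset_uIcc |> intervalIntegrable_iff.2) (by
      rw [uIcc_of_le hT.le]; exact Ioo_subset_Icc_self hsI)
  have hlim : Tendsto (fun t => ∫ r in s..t, (speedSq μ v r + (K k : ℝ) ^ 2 / 4)) (𝓝 s) (𝓝 0) := by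
    have := (hcont.continuousAt (x := s) (by
      rw [uIcc_of_le hT.le]; exact Icc_mem_nhds hsI.1 hsI.2)).tendsto
    rwa [intervalIntegral.integral_same] at this
  have hlim' : Tendsto (fun t => |∫ r in s..t, (speedSq μ v r + (K k : ℝ) ^ 2 / 4)|)
      (𝓝 s ⊓ ae volume) (𝓝 0) := by
    simpa using (hlim.abs).mono_left inf_le_left
  rw [tendsto_iff_dist_tendsto_zero]
  refine squeeze_zero' (Eventually.of_forall fun _ => dist_nonneg) ?_ hlim'
  have h1 : ∀ᶠ t in 𝓝 s ⊓ ae volume, t ∈ Ioo (-T) T :=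
    (Ioo_mem_nhds hsI.1 hsI.2 : _) |> fun h => mem_inf_of_left h
  have h2 : ∀ᶠ t in 𝓝 s ⊓ ae volume, t ∈ Ioo (-T) T → t ∈ S k :=
    mem_inf_of_right ((ae_restrict_iff' measurableSet_Ioo).1 (hSae k))
  filter_upwards [h1, h2] with t ht1 ht2
  have htS := ht2 ht1
  simp only [ProbabilityMeasure.coe_mk, Real.dist_eq]
  rcases lt_trichotomy s t with hst | rfl | hst
  · rw [abs_sub_comm]
    exact (hSle k s (hs k) t htS hst).trans (le_abs_self _)
  · simp
  · rw [intervalIntegral.integral_symm, abs_neg]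
    exact (hSle k t htS s (hs k) hst).trans (le_abs_self _)

lemma tendsto_slice_integral {l : Filter ℝ} {μ : Kernel ℝ Q} [IsMarkovKernel μ]
    {ν : ProbabilityMeasure Q} (h : IsTrace l μ ν) {t₀ : ℝ} (hl : l ≤ 𝓝 t₀) {ζ : ℝ × Q → ℝ}
    (hζ : Continuous ζ) :
    Tendsto (fun t => ∫ x, ζ (t, x) ∂(μ t)) (l ⊓ ae volume)
      (𝓝 (∫ x, ζ (t₀, x) ∂(ν : Measure Q))) := by
  -- Currying turns joint continuity into continuity in `t` uniformly in `x`, so `ζ (t, ·)` may be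
  -- replaced by `ζ (t₀, ·)` under any probability measure.
  let Z : C(ℝ, C(Q, ℝ)) := ContinuousMap.curry ⟨ζ, hζ⟩
  have h1 : Tendsto (fun t => ‖Z t - Z t₀‖) (l ⊓ ae volume) (𝓝 0) := by
    have : Continuous fun t => ‖Z t - Z t₀‖ := by fun_prop
    have := this.tendsto t₀
    simp only [sub_self, norm_zero] at this
    exact this.mono_left (inf_le_left.trans hl)
  have h2 : Tendsto (fun t => ∫ x, Z t x ∂(μ t) - ∫ x, Z t₀ x ∂(μ t)) (l ⊓ ae volume) (𝓝 0) :=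
    squeeze_zero_norm (fun t => abs_integral_sub_le (μ t) (Z t) (Z t₀)) h1
  have h3 := h2.add (h (Z t₀))
  simp only [sub_add_cancel, zero_add] at h3
  exact h3

/-- One-sided neighbourhoods have positive measure. Thus limits off a null set are not vacuous:
inequalities pass to them and they are unique. -/
lemma neBot_nhdsWithin_Ioi_inf_ae (s : ℝ) : (𝓝[>] s ⊓ ae (volume : Measure ℝ)).NeBot := by
  rw [inf_neBot_iff]
  intro A hA B hB
  obtain ⟨u, hu, hA⟩ := mem_nhdsGT_iff_exists_Ioo_subset.1 hA
  by_contra hne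
  rw [not_nonempty_iff_eq_empty] at hne
  have h1 : Ioo s u ⊆ Bᶜ := fun t ht htB => by
    have : t ∈ A ∩ B := ⟨hA ht, htB⟩
    rw [hne] at this; exact this
  have h2 := measure_mono_null h1 (mem_ae_iff.1 hB)
  rw [Real.volume_Ioo, ENNReal.ofReal_eq_zero] at h2
  have : s < u := hu
  linarith

lemma neBot_nhdsWithin_Iio_inf_ae (s : ℝ) : (𝓝[<] s ⊓ ae (volume : Measure ℝ)).NeBot := by
  rw [inf_neBot_iff]
  intro A hA B hB
  obtain ⟨u, hu, hA⟩ := mem_nhdsLT_iff_exists_Ioo_subset.1 hA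
  by_contra hne
  rw [not_nonempty_iff_eq_empty] at hne
  have h1 : Ioo u s ⊆ Bᶜ := fun t ht htB => by
    have : t ∈ A ∩ B := ⟨hA ht, htB⟩
    rw [hne] at this; exact this
  have h2 := measure_mono_null h1 (mem_ae_iff.1 hB)
  rw [Real.volume_Ioo, ENNReal.ofReal_eq_zero] at h2
  have : u < s := hu
  linarith

/-- Along a subsolution, the change of its average between two traces is controlled. -/
lemma IsVelocity.trace_sub_trace_le {T : ℝ} {μ : Kernel ℝ Q} [IsMarkovKernel μ]
    {v : ℝ × Q → ℝ} (hv : IsVelocity T μ v) (hv2 : Integrable (fun z => v z ^ 2) (spaceTime T μ))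
    {e : ℝ → ℝ} (he : IntegrableOn e (Ioo (-T) T)) {ζ : ℝ × Q → ℝ} (hζ : Continuous ζ)
    (hs : IsSubsolution T μ v e ζ) {s : ℝ} (hsI : s ∈ Ioo (-T) T) {νs νT : ProbabilityMeasure Q}
    (hνs : IsTrace (𝓝[>] s) μ νs) (hνT : IsTrace (𝓝[<] T) μ νT) :
    ∫ x, ζ (s, x) ∂(νs : Measure Q) - ∫ x, ζ (T, x) ∂(νT : Measure Q) ≤
      ∫ t in s..T, (speedSq μ v t + e t) := by
  obtain ⟨S, hS, hSae, hle⟩ := hv.exists_ae_sub_le hv2 he hζ hs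
  have hSae' := (ae_restrict_iff' measurableSet_Ioo).1 hSae
  have hκ : IntegrableOn (fun t => speedSq μ v t + e t) (Ioo (-T) T) :=
    (integrable_integral_slice hv2).add he
  have hT : -T < T := hsI.1.trans hsI.2
  have hκ' : IntegrableOn (fun t => speedSq μ v t + e t) (Icc (-T) T) :=
    (integrableOn_Icc_iff_integrableOn_Ioo (by simp) (by simp)).2 hκ
  have hii : ∀ {a b : ℝ}, a ∈ Icc (-T) T → b ∈ Icc (-T) T →
      IntervalIntegrable (fun t => speedSq μ v t + e t) volume a b := fun {a b} ha hb =>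
    (hκ'.mono_set (uIcc_subset_Icc ha hb)).intervalIntegrable
  have hTI : T ∈ Icc (-T) T := ⟨hT.le, le_rfl⟩
  have hsI' := Ioo_subset_Icc_self hsI
  have hcont : ContinuousOn (fun t => ∫ r in s..t, (speedSq μ v r + e r)) (Icc (-T) T) := by
    have h := hii (a := -T) (b := T) ⟨le_rfl, hT.le⟩ hTI
    have := intervalIntegral.continuousOn_primitive_interval' (a := s) h
      (by rw [uIcc_of_le hT.le]; exact hsI')
    rwa [uIcc_of_le hT.le] at this
  -- The right endpoint goes to `T` first, with the left one fixed in `S`; then the left one goes to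
  -- `s`.
  have hleft : ∀ a ∈ S, ∫ x, ζ (a, x) ∂(μ a) - ∫ x, ζ (T, x) ∂(νT : Measure Q) ≤
      ∫ t in a..T, (speedSq μ v t + e t) := by
    intro a ha
    have haI := hS ha
    have := neBot_nhdsWithin_Iio_inf_ae T
    have l1 := (tendsto_slice_integral hνT nhdsWithin_le_nhds hζ).const_sub (∫ x, ζ (a, x) ∂(μ a))
    have l2 : Tendsto (fun b => ∫ t in a..b, (speedSq μ v t + e t)) (𝓝[<] T ⊓ ae volume)
        (𝓝 (∫ t in a..T, (speedSq μ v t + e t))) := by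
      have h := intervalIntegral.continuousOn_primitive_interval' (a := a)
        (hii (a := -T) (b := T) ⟨le_rfl, hT.le⟩ hTI)
        (by rw [uIcc_of_le hT.le]; exact Ioo_subset_Icc_self haI)
      rw [uIcc_of_le hT.le] at h
      refine (h T hTI).mono_left (inf_le_left.trans ?_)
      exact nhdsWithin_le_of_mem (mem_of_superset (Ioo_mem_nhdsLT hT) Ioo_subset_Icc_self)
    refine le_of_tendsto_of_tendsto l1 l2 ?_
    have h1 : ∀ᶠ b in 𝓝[<] T ⊓ ae volume, b ∈ Ioo a T := mem_inf_of_left (Ioo_mem_nhdsLT haI.2)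
    have h2 : ∀ᶠ b in 𝓝[<] T ⊓ ae volume, b ∈ Ioo (-T) T → b ∈ S := mem_inf_of_right hSae'
    filter_upwards [h1, h2] with b hb1 hb2
    exact hle a ha b (hb2 ⟨haI.1.trans hb1.1, hb1.2⟩) hb1.1
  have := neBot_nhdsWithin_Ioi_inf_ae s
  have l1 := (tendsto_slice_integral hνs nhdsWithin_le_nhds hζ).sub_const
    (∫ x, ζ (T, x) ∂(νT : Measure Q))
  have l2 : Tendsto (fun a => ∫ t in a..T, (speedSq μ v t + e t)) (𝓝[>] s ⊓ ae volume)
      (𝓝 (∫ t in s..T, (speedSq μ v t + e t))) := by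
    have h1 : Tendsto (fun a => ∫ t in s..a, (speedSq μ v t + e t)) (𝓝[>] s ⊓ ae volume) (𝓝 0) := by
      have := (hcont.continuousAt (Icc_mem_nhds hsI.1 hsI.2)).tendsto
      rw [intervalIntegral.integral_same] at this
      exact this.mono_left (inf_le_left.trans nhdsWithin_le_nhds)
    have h2 := h1.const_sub (∫ t in s..T, (speedSq μ v t + e t))
    rw [sub_zero] at h2
    refine h2.congr' ?_
    have h3 : ∀ᶠ a in 𝓝[>] s ⊓ ae volume, a ∈ Ioo s T := mem_inf_of_left (Ioo_mem_nhdsGT hsI.2)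
    filter_upwards [h3] with a ha
    rw [sub_eq_iff_eq_add, add_comm, intervalIntegral.integral_add_adjacent_intervals]
    · exact hii hsI' ⟨by linarith [ha.1, hsI.1], ha.2.le⟩
    · exact hii ⟨by linarith [ha.1, hsI.1], ha.2.le⟩ hTI
  refine le_of_tendsto_of_tendsto l1 l2 ?_
  have h1 : ∀ᶠ b in 𝓝[>] s ⊓ ae volume, b ∈ Ioo s T := mem_inf_of_left (Ioo_mem_nhdsGT hsI.2)
  have h2 : ∀ᶠ b in 𝓝[>] s ⊓ ae volume, b ∈ Ioo (-T) T → b ∈ S := mem_inf_of_right hSae'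
  filter_upwards [h1, h2] with a ha1 ha2
  exact hleft a (ha2 ⟨hsI.1.trans ha1.1, ha1.2⟩)

/-! ### Atoms of the slices, distance to their images, and measurability in time. -/

lemma measurable_atomMass (μ : Kernel ℝ Q) [IsMarkovKernel μ] :
    Measurable fun z : ℝ × Q => μ z.1 {z.2} := by
  have hs : MeasurableSet {p : (ℝ × Q) × Q | p.2 = p.1.2} :=
    measurableSet_eq_fun measurable_snd (measurable_snd.comp measurable_fst)
  have h := Kernel.measurable_kernel_prodMk_left (κ := μ.comap (Prod.fst : ℝ × Q → ℝ) measurable_fst) hs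
  exact h

/-- The atoms of a measure on the circle. -/
def atoms (ν : Measure Q) : Set Q := {x | ν {x} ≠ 0}

lemma countable_atoms (ν : Measure Q) [IsFiniteMeasure ν] : (atoms ν).Countable := by
  have := Measure.countable_meas_pos_of_disjoint_iUnion (μ := ν) (As := fun x : Q => ({x} : Set Q))
    (fun x => measurableSet_singleton x) (fun x y hxy => by simpa using hxy)
  simpa [atoms, pos_iff_ne_zero] using this

lemma IsPurelyAtomic.measure_compl_atoms {ν : Measure Q} [IsFiniteMeasure ν]
    (h : IsPurelyAtomic ν) : ν (atoms ν)ᶜ = 0 := by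
  obtain ⟨φ, X, hν⟩ := h
  have hm : MeasurableSet (atoms ν)ᶜ := (countable_atoms ν).measurableSet.compl
  have h1 : ν (atoms ν)ᶜ = ∑' i, φ i * Measure.dirac (X i) (atoms ν)ᶜ := by
    conv_lhs => rw [hν, ← hν]
    rw [show ν (atoms ν)ᶜ = (Measure.sum fun i => φ i • Measure.dirac (X i)) (atoms ν)ᶜ by rw [← hν],
      Measure.sum_apply _ hm]
    simp
  rw [h1, ENNReal.tsum_eq_zero]
  intro i
  by_cases hφ : φ i = 0
  · simp [hφ]
  · have : X i ∈ atoms ν := by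
      intro h0
      rw [hν, Measure.sum_apply _ (measurableSet_singleton _), ENNReal.tsum_eq_zero] at h0
      have := h0 i
      simp [hφ] at this
    rw [Measure.dirac_apply' _ hm]
    simp [this]

/-- Each atom contributes `(ν {x})⁻¹ * ν {x} = 1`. As an integral against `ν` itself, the count of
atoms of `μ t` becomes measurable in `t`. -/
lemma encard_atoms_eq_lintegral (ν : Measure Q) [IsFiniteMeasure ν] :
    (((atoms ν).encard : ℕ∞) : ℝ≥0∞) = ∫⁻ x in atoms ν, (ν {x})⁻¹ ∂ν := by
  rw [lintegral_countable _ (countable_atoms ν), ← ENNReal.tsum_set_one]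
  refine tsum_congr fun x => ?_
  rw [ENNReal.inv_mul_cancel x.2 (measure_ne_top _ _)]

lemma measurable_encard_atoms (μ : Kernel ℝ Q) [IsMarkovKernel μ] :
    Measurable fun t => (((atoms (μ t)).encard : ℕ∞) : ℝ≥0∞) := by
  have hm := measurable_atomMass μ
  have hF : Measurable fun z : ℝ × Q => {z : ℝ × Q | μ z.1 {z.2} ≠ 0}.indicator
      (fun z => (μ z.1 {z.2})⁻¹) z :=
    hm.inv.indicator (hm (measurableSet_singleton 0).compl)
  have h := Measurable.lintegral_kernel_prod_right' (κ := μ) hF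
  have e : (fun t => (((atoms (μ t)).encard : ℕ∞) : ℝ≥0∞)) = fun t => ∫⁻ x,
      {z : ℝ × Q | μ z.1 {z.2} ≠ 0}.indicator (fun z => (μ z.1 {z.2})⁻¹) (t, x) ∂(μ t) := by
    ext t
    rw [encard_atoms_eq_lintegral, ← lintegral_indicator (countable_atoms _).measurableSet]
    rfl
  rwa [e]

lemma ae_mem_atoms {T : ℝ} {μ : Kernel ℝ Q} [IsMarkovKernel μ]
    (h : ∀ᵐ t ∂(volume.restrict (Ioo (-T) T)), IsPurelyAtomic (μ t)) :
    ∀ᵐ z ∂(spaceTime T μ), z.2 ∈ atoms (μ z.1) := by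
  refine Measure.ae_compProd_of_ae_ae (measurable_atomMass μ (measurableSet_singleton 0).compl) ?_
  filter_upwards [h] with t ht
  exact ht.measure_compl_atoms

/-- The essential infimum over `μ_t` of the squared distance from `y` to `θ (t, ·)`. -/
noncomputable def sliceDistSq (μ : Kernel ℝ Q) (θ : ℝ × Q → Q) (t : ℝ) (y : Q) : ℝ :=
  sInf {c : ℝ | μ t {x | ‖θ (t, x) - y‖ ^ 2 < c} ≠ 0}

section sliceDistSq

set_option linter.unusedSectionVars false

variable {μ : Kernel ℝ Q} [IsMarkovKernel μ] {θ : ℝ × Q → Q}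

lemma sliceDistSq_nonneg_mem {t : ℝ} {y : Q} {c : ℝ}
    (hc : μ t {x | ‖θ (t, x) - y‖ ^ 2 < c} ≠ 0) : 0 ≤ c := by
  by_contra hneg
  refine hc ?_
  have : {x | ‖θ (t, x) - y‖ ^ 2 < c} = ∅ := by
    ext x
    simp only [mem_ofPred_eq, mem_empty_iff_false, iff_false, not_lt]
    exact (not_le.1 hneg).le.trans (sq_nonneg _)
  rw [this, measure_empty]

lemma bddBelow_sliceDistSq (t : ℝ) (y : Q) :
    BddBelow {c : ℝ | μ t {x | ‖θ (t, x) - y‖ ^ 2 < c} ≠ 0} :=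
  ⟨0, fun _ hc => sliceDistSq_nonneg_mem hc⟩

lemma one_mem_sliceDistSq (t : ℝ) (y : Q) :
    (1 : ℝ) ∈ {c : ℝ | μ t {x | ‖θ (t, x) - y‖ ^ 2 < c} ≠ 0} := by
  have : {x | ‖θ (t, x) - y‖ ^ 2 < 1} = univ := by
    ext x
    simp only [mem_ofPred_eq, mem_univ, iff_true]
    nlinarith [circle_norm_le_half (θ (t, x) - y), norm_nonneg (θ (t, x) - y)]
  change μ t {x | ‖θ (t, x) - y‖ ^ 2 < 1} ≠ 0
  rw [this]
  simp

lemma sliceDistSq_nonneg (t : ℝ) (y : Q) : 0 ≤ sliceDistSq μ θ t y :=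
  le_csInf ⟨1, one_mem_sliceDistSq t y⟩ fun _ hc => sliceDistSq_nonneg_mem hc

lemma sliceDistSq_le_one (t : ℝ) (y : Q) : sliceDistSq μ θ t y ≤ 1 :=
  csInf_le (bddBelow_sliceDistSq t y) (one_mem_sliceDistSq t y)

lemma sliceDistSq_le {t : ℝ} {x : Q} (hx : x ∈ atoms (μ t)) (y : Q) :
    sliceDistSq μ θ t y ≤ ‖θ (t, x) - y‖ ^ 2 := by
  refine le_of_forall_gt_imp_ge_of_dense fun c hc => ?_
  refine csInf_le (bddBelow_sliceDistSq t y) fun h0 => hx ?_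
  exact measure_mono_null (singleton_subset_iff.2 hc) h0

lemma sliceDistSq_sub_le (t : ℝ) (y y' : Q) :
    sliceDistSq μ θ t y' ≤ sliceDistSq μ θ t y + ‖y - y'‖ := by
  rw [← sub_le_iff_le_add]
  refine le_csInf ⟨1, one_mem_sliceDistSq t y⟩ fun c hc => ?_
  rw [sub_le_iff_le_add]
  refine csInf_le (bddBelow_sliceDistSq t y') fun h0 => hc (measure_mono_null ?_ h0)
  intro x hx
  have h1 := (abs_le.1 (circle_abs_sq_sub_sq_le (θ (t, x) - y') (θ (t, x) - y))).2
  rw [show θ (t, x) - y' - (θ (t, x) - y) = y - y' by abel] at h1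
  have h2 : ‖θ (t, x) - y‖ ^ 2 < c := hx
  change ‖θ (t, x) - y'‖ ^ 2 < c + ‖y - y'‖
  linarith

lemma sliceDistSq_lipschitz (t : ℝ) : LipschitzWith 1 (sliceDistSq μ θ t) := by
  refine LipschitzWith.of_dist_le_mul fun y y' => ?_
  rw [Real.dist_eq, dist_eq_norm, NNReal.coe_one, one_mul, abs_le]
  have h1 := sliceDistSq_sub_le (μ := μ) (θ := θ) t y y'
  have h2 := sliceDistSq_sub_le (μ := μ) (θ := θ) t y' y
  rw [norm_sub_rev] at h2
  constructor <;> linarith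

/-- All mass sits on the atoms, so every level of positive measure is undercut by an atom; among
finitely many atoms a nearest one exists. -/
lemma exists_atom_le_sliceDistSq {t : ℝ} (hfin : (atoms (μ t)).Finite)
    (hat : μ t (atoms (μ t))ᶜ = 0) (y : Q) :
    ∃ x ∈ atoms (μ t), ‖θ (t, x) - y‖ ^ 2 ≤ sliceDistSq μ θ t y := by
  have hne : ∀ c ∈ {c : ℝ | μ t {x | ‖θ (t, x) - y‖ ^ 2 < c} ≠ 0},
      ∃ x ∈ atoms (μ t), ‖θ (t, x) - y‖ ^ 2 < c := by
    intro c hc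
    by_contra hcon
    push Not at hcon
    refine hc (measure_mono_null (fun x hx => ?_) hat)
    intro hxa
    exact absurd hx (not_lt.2 (hcon x hxa))
  obtain ⟨x0, hx0, -⟩ := hne 1 (one_mem_sliceDistSq t y)
  obtain ⟨x, hx, hmin⟩ := hfin.exists_minimalFor (fun x => ‖θ (t, x) - y‖ ^ 2) _ ⟨x0, hx0⟩
  refine ⟨x, hx, le_csInf ⟨1, one_mem_sliceDistSq t y⟩ fun c hc => ?_⟩
  obtain ⟨x', hx', hlt⟩ := hne c hc
  rcases le_total (‖θ (t, x) - y‖ ^ 2) (‖θ (t, x') - y‖ ^ 2) with h | h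
  · exact h.trans hlt.le
  · exact (hmin hx' h).trans hlt.le

/-- This is the benefit of an essential infimum: sublevel sets in `t` are described by the kernel
measure of a measurable set, hence are measurable. The reverse direction exhausts the strict
inequality by rational levels. -/
lemma sliceDistSq_lt_iff (t : ℝ) (y : Q) (c : ℝ) :
    sliceDistSq μ θ t y < c ↔ μ t {x | ‖θ (t, x) - y‖ ^ 2 < c} ≠ 0 := by
  constructor
  · intro h h0
    obtain ⟨c', hc', hlt⟩ := exists_lt_of_csInf_lt ⟨1, one_mem_sliceDistSq t y⟩ h
    exact hc' (measure_mono_null (fun x hx => lt_trans hx hlt) h0)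
  · intro h
    have hU : {x | ‖θ (t, x) - y‖ ^ 2 < c} =
        ⋃ q : {q : ℚ // (q : ℝ) < c}, {x | ‖θ (t, x) - y‖ ^ 2 < (q : ℚ)} := by
      ext x
      simp only [mem_ofPred_eq, mem_iUnion]
      constructor
      · intro hx
        obtain ⟨q, hq1, hq2⟩ := exists_rat_btwn hx
        exact ⟨⟨q, hq2⟩, hq1⟩
      · rintro ⟨q, hq⟩
        exact hq.trans q.2
    rw [hU, Ne, measure_iUnion_null_iff, not_forall] at h
    obtain ⟨q, hq⟩ := h
    exact (csInf_le (bddBelow_sliceDistSq t y) hq).trans_lt q.2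

lemma measurable_sliceDistSq (hθ : Measurable θ) (y : Q) :
    Measurable fun t => sliceDistSq μ θ t y := by
  refine measurable_of_Iio fun c => ?_
  have hs : MeasurableSet {z : ℝ × Q | ‖θ z - y‖ ^ 2 < c} :=
    measurableSet_lt ((hθ.sub_const y).norm.pow_const 2) measurable_const
  have h := Kernel.measurable_kernel_prodMk_left (κ := μ) hs
  have e : (fun t => sliceDistSq μ θ t y) ⁻¹' Iio c =
      {t | μ t (Prod.mk t ⁻¹' {z : ℝ × Q | ‖θ z - y‖ ^ 2 < c}) ≠ 0} := by
    ext t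
    exact sliceDistSq_lt_iff t y c
  rw [e]
  exact h (measurableSet_singleton 0).compl

end sliceDistSq

/-- A family of continuous functions on the circle which is pointwise measurable in the parameter
is strongly measurable for the uniform norm. -/
lemma stronglyMeasurable_continuousMap {F : ℝ → C(Q, ℝ)} (hF : ∀ y, Measurable fun t => F t y) :
    StronglyMeasurable F := by
  let _ : MeasurableSpace C(Q, ℝ) := borel _
  have : BorelSpace C(Q, ℝ) := ⟨rfl⟩
  have hball : ∀ (f : C(Q, ℝ)) (r : ℝ), MeasurableSet (F ⁻¹' Metric.closedBall f r) := by
    intro f r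
    by_cases hr : 0 ≤ r
    -- The uniform distance of continuous functions is tested on a dense sequence of points;
    -- separability of `C(Q, ℝ)` then passes from closed balls to open sets.
    · have e : F ⁻¹' Metric.closedBall f r =
          ⋂ k : ℕ, {t | |F t (TopologicalSpace.denseSeq Q k) - f (TopologicalSpace.denseSeq Q k)| ≤ r} := by
        ext t
        simp only [mem_preimage, Metric.mem_closedBall, mem_iInter, mem_ofPred_eq,
          ContinuousMap.dist_le hr]
        refine ⟨fun h k => h _, fun h y => ?_⟩
        have hcl : IsClosed {y : Q | dist (F t y) (f y) ≤ r} :=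
          isClosed_le (by fun_prop) continuous_const
        refine (isClosed_property (TopologicalSpace.denseRange_denseSeq Q) hcl fun k => ?_) y
        exact h k
      rw [e]
      refine MeasurableSet.iInter fun k => measurableSet_le ?_ measurable_const
      exact ((hF _).sub_const _).abs
    · have : Metric.closedBall f r = ∅ := Metric.closedBall_eq_empty.2 (not_le.1 hr)
      simp [this]
  have hmeas : Measurable F := by
    refine measurable_of_isOpen fun U hU => ?_
    have e : U = ⋃ p : {p : ℕ × ℚ // Metric.closedBall (TopologicalSpace.denseSeq C(Q, ℝ) p.1) (p.2 : ℝ) ⊆ U},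
        Metric.closedBall (TopologicalSpace.denseSeq C(Q, ℝ) p.1.1) (p.1.2 : ℝ) := by
      ext f
      simp only [mem_iUnion]
      constructor
      · intro hf
        obtain ⟨ε, hε, hfU⟩ := Metric.isOpen_iff.1 hU f hf
        obtain ⟨k, hk⟩ := (TopologicalSpace.denseRange_denseSeq C(Q, ℝ)).exists_dist_lt f (show 0 < ε / 3 by linarith)
        obtain ⟨q, hq1, hq2⟩ := exists_rat_btwn (show ε / 3 < ε / 2 by linarith)
        refine ⟨⟨(k, q), fun g hg => hfU ?_⟩, ?_⟩
        · rw [Metric.mem_closedBall] at hg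
          rw [Metric.mem_ball]
          have := dist_triangle g (TopologicalSpace.denseSeq C(Q, ℝ) k) f
          rw [dist_comm f] at hk
          linarith
        · rw [Metric.mem_closedBall]
          exact (hk.trans hq1).le
      · rintro ⟨p, hp⟩
        exact p.2 hp
    rw [e, preimage_iUnion]
    exact MeasurableSet.iUnion fun p => hball _ _
  exact hmeas.stronglyMeasurable

/-! ### The Hopf-Lax potential and its subsolution property. -/

/-- The remaining time `T - t`, increased by `1 / L`. -/
noncomputable def remTime (L T t : ℝ) : ℝ := max (T - t) 0 + 1 / L

lemma remTime_pos {L : ℝ} (hL : 0 < L) (T t : ℝ) : 0 < remTime L T t :=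
  add_pos_of_nonneg_of_pos (le_max_right _ _) (by positivity)

lemma remTime_of_le {L T t : ℝ} (h : t ≤ T) : remTime L T t = T - t + 1 / L := by
  rw [remTime, max_eq_left (by linarith)]

lemma one_div_remTime_le {L : ℝ} (hL : 0 < L) (T t : ℝ) : 1 / remTime L T t ≤ L := by
  rw [div_le_iff₀ (remTime_pos hL T t), remTime, mul_add, mul_one_div_cancel hL.ne']
  nlinarith [mul_nonneg hL.le (le_max_right (T - t) 0)]

lemma continuous_remTime (L T : ℝ) : Continuous (remTime L T) := by
  unfold remTime; fun_prop

lemma abs_remTime_sub_le (L T t t' : ℝ) : |remTime L T t' - remTime L T t| ≤ |t' - t| := by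
  unfold remTime
  rw [add_sub_add_right_eq_sub]
  refine (abs_max_sub_max_le_abs _ _ _).trans ?_
  rw [sub_sub_sub_cancel_left, abs_sub_comm]

/-- The Hopf-Lax type potential `inf_y ‖x - y‖² / σ_t - r_t y`. -/
noncomputable def hopfLax (σ : ℝ → ℝ) (r : ℝ → C(Q, ℝ)) (z : ℝ × Q) : ℝ :=
  sInf ((fun y => ‖z.2 - y‖ ^ 2 / σ z.1 - r z.1 y) '' univ)

section hopfLax

variable {σ : ℝ → ℝ} {r : ℝ → C(Q, ℝ)}

lemma continuous_hopfLax_uncurry (hσ : Continuous σ) (hσ0 : ∀ t, 0 < σ t) (hr : Continuous r) :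
    Continuous (fun p : (ℝ × Q) × Q => ‖p.1.2 - p.2‖ ^ 2 / σ p.1.1 - r p.1.1 p.2) := by
  have h1 : Continuous fun p : (ℝ × Q) × Q => σ p.1.1 := by fun_prop
  have h2 : Continuous fun p : (ℝ × Q) × Q => r p.1.1 p.2 := by fun_prop
  refine Continuous.sub ?_ h2
  exact Continuous.div (by fun_prop) h1 fun p => (hσ0 _).ne'

lemma continuous_hopfLax (hσ : Continuous σ) (hσ0 : ∀ t, 0 < σ t) (hr : Continuous r) :
    Continuous (hopfLax σ r) := by
  have h := continuous_hopfLax_uncurry hσ hσ0 hr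
  set A : ℝ × Q → Q → ℝ := fun z y => ‖z.2 - y‖ ^ 2 / σ z.1 - r z.1 y with hA
  have hA' : Continuous ↿A := h
  exact IsCompact.continuous_sInf (K := (univ : Set Q)) isCompact_univ hA'

lemma continuous_hopfLax_slice (z : ℝ × Q) :
    Continuous fun y => ‖z.2 - y‖ ^ 2 / σ z.1 - r z.1 y := by
  fun_prop

lemma hopfLax_le (z : ℝ × Q) (y : Q) : hopfLax σ r z ≤ ‖z.2 - y‖ ^ 2 / σ z.1 - r z.1 y :=
  csInf_le (isCompact_univ.image (continuous_hopfLax_slice z)).bddBelow ⟨y, mem_univ _, rfl⟩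

lemma exists_hopfLax_eq (z : ℝ × Q) : ∃ y, hopfLax σ r z = ‖z.2 - y‖ ^ 2 / σ z.1 - r z.1 y := by
  obtain ⟨y, -, hy⟩ := (isCompact_univ.image (continuous_hopfLax_slice (σ := σ) (r := r) z)).sInf_mem
    ⟨_, 0, mem_univ _, rfl⟩
  exact ⟨y, hy.symm⟩

/-- Finite-difference form of the derivative of `ξ ^ 2 / σ` along speed `w`, where `s` and `ξ`
belong to the later time. The exact identity has `s * (s + h)` in the denominator; enlarging it to
`(s + h) ^ 2` leaves only the earlier remaining time. -/
lemma sq_div_sub_sq_div_ge {s h w ξ : ℝ} (hs : 0 < s) (hh : 0 < h) :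
    -(h * w ^ 2) + h * ((ξ + s * w) ^ 2 / (s + h) ^ 2) ≤
      ξ ^ 2 / s - (ξ - h * w) ^ 2 / (s + h) := by
  have e : ξ ^ 2 / s - (ξ - h * w) ^ 2 / (s + h) =
      -(h * w ^ 2) + h * ((ξ + s * w) ^ 2 / (s * (s + h))) := by
    have : s + h ≠ 0 := by positivity
    field_simp
    ring
  rw [e]
  gcongr
  nlinarith

/-- A minimizer `y` at the later point is a competitor at the earlier one. The displacement is
lifted to the line by its shortest representative at the later point, where the norm must be exact;
the two other norms are only bounded by the lifted lengths, and both bounds go in the useful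
direction. -/
lemma exists_hopfLax_add_le {t h : ℝ} (hh : 0 < h) (hσ0 : 0 < σ (t + h))
    (hσ : σ t = σ (t + h) + h) (x : Q) (w : ℝ) :
    ∃ y, hopfLax σ r (t, x) - h * w ^ 2 + h * (‖x + (σ t * w : ℝ) - y‖ ^ 2 / σ t ^ 2) -
      (r (t + h) y - r t y) ≤ hopfLax σ r (t + h, x + (h * w : ℝ)) := by
  obtain ⟨y, hy⟩ := exists_hopfLax_eq (σ := σ) (r := r) (t + h, x + ((h * w : ℝ) : Q))
  refine ⟨y, ?_⟩
  have h1 := hopfLax_le (σ := σ) (r := r) (t, x) y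
  obtain ⟨ξ, hξ, hξn⟩ := circle_exists_rep (x + ((h * w : ℝ) : Q) - y)
  simp only at hy h1
  rw [hy, ← hξn, sq_abs]
  have hx : x - y = ((ξ - h * w : ℝ) : Q) := by
    rw [AddCircle.coe_sub, hξ]; abel
  have h2 : ‖x - y‖ ^ 2 ≤ (ξ - h * w) ^ 2 := by
    rw [hx, ← sq_abs (ξ - h * w)]
    gcongr
    exact circle_norm_coe_le _
  have hx' : x + ((σ t * w : ℝ) : Q) - y = ((ξ + σ (t + h) * w : ℝ) : Q) := by
    rw [AddCircle.coe_add, hξ, hσ, add_mul, AddCircle.coe_add]; abel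
  have h3 : ‖x + ((σ t * w : ℝ) : Q) - y‖ ^ 2 ≤ (ξ + σ (t + h) * w) ^ 2 := by
    rw [hx', ← sq_abs (ξ + σ (t + h) * w)]
    gcongr
    exact circle_norm_coe_le _
  have h4 := sq_div_sub_sq_div_ge (s := σ (t + h)) (h := h) (w := w) (ξ := ξ) hσ0 hh
  have hσt : 0 < σ t := by rw [hσ]; positivity
  rw [← hσ] at h4
  have h5 : ‖x - y‖ ^ 2 / σ t ≤ (ξ - h * w) ^ 2 / σ t := by gcongr
  have h6 : h * (‖x + ((σ t * w : ℝ) : Q) - y‖ ^ 2 / σ t ^ 2) ≤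
      h * ((ξ + σ (t + h) * w) ^ 2 / σ t ^ 2) := by gcongr
  linarith

end hopfLax

/-- The gain is Lipschitz in the base point up to the factor `1 + w ^ 2`, because `1 / remTime ≤ L`.
It moves the gain from nearby points to the point of the support where it is compared with `g`. -/
lemma sq_norm_div_remTime_sub_le {L T : ℝ} (hL : 0 < L) {t t' δ : ℝ} (hδ : |t' - t| ≤ δ) (x y : Q)
    {u : ℝ} (hu : |u| ≤ δ) (w : ℝ) :
    ‖x + (remTime L T t * w : ℝ) - y‖ ^ 2 / remTime L T t ^ 2 -
      ‖x + (u : Q) + (remTime L T t' * w : ℝ) - y‖ ^ 2 / remTime L T t' ^ 2 ≤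
      δ * (2 * L ^ 2 + 2 * L ^ 3) * (1 + w ^ 2) := by
  set s := remTime L T t
  set s' := remTime L T t'
  set p := x + ((s * w : ℝ) : Q) - y
  set p' := x + (u : Q) + ((s' * w : ℝ) : Q) - y
  have hs : 0 < s := remTime_pos hL T t
  have hs' : 0 < s' := remTime_pos hL T t'
  have hsL : 1 / s ≤ L := one_div_remTime_le hL T t
  have hsL' : 1 / s' ≤ L := one_div_remTime_le hL T t'
  have hδ0 : 0 ≤ δ := (abs_nonneg _).trans hδ
  have hss : |s' - s| ≤ δ := (abs_remTime_sub_le L T t t').trans hδ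
  have hpp : p - p' = ((-(u + (s' - s) * w) : ℝ) : Q) := by
    simp only [p, p', sub_mul, AddCircle.coe_neg, AddCircle.coe_add, AddCircle.coe_sub]
    abel
  have h1 : ‖p - p'‖ ≤ δ * (1 + |w|) := by
    rw [hpp]
    refine (circle_norm_coe_le _).trans ?_
    rw [abs_neg]
    refine (abs_add_le _ _).trans ?_
    rw [abs_mul]
    nlinarith [abs_nonneg w]
  have h2 := (le_abs_self _).trans ((circle_abs_sq_sub_sq_le p p').trans h1)
  have hp : ‖p‖ ^ 2 ≤ 1 := by nlinarith [circle_norm_le_half p, norm_nonneg p]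
  have e : ‖p‖ ^ 2 / s ^ 2 - ‖p'‖ ^ 2 / s' ^ 2 =
      (‖p‖ ^ 2 - ‖p'‖ ^ 2) * (1 / s') ^ 2 +
        ‖p‖ ^ 2 * ((s' - s) * ((1 / s) * (1 / s') * (1 / s + 1 / s'))) := by
    field_simp
    ring
  rw [e]
  have hw : 1 + |w| ≤ 2 * (1 + w ^ 2) := by nlinarith [sq_abs w, sq_nonneg (|w| - 1)]
  have hi : 0 < 1 / s := by positivity
  have hi' : 0 < 1 / s' := by positivity
  have h3 : (‖p‖ ^ 2 - ‖p'‖ ^ 2) * (1 / s') ^ 2 ≤ δ * (2 * (1 + w ^ 2)) * L ^ 2 := by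
    have : (0 : ℝ) ≤ δ * (2 * (1 + w ^ 2)) := by positivity
    calc (‖p‖ ^ 2 - ‖p'‖ ^ 2) * (1 / s') ^ 2 ≤ (δ * (2 * (1 + w ^ 2))) * (1 / s') ^ 2 := by
          gcongr
          exact h2.trans (by gcongr)
      _ ≤ _ := by gcongr
  have h4 : ‖p‖ ^ 2 * ((s' - s) * ((1 / s) * (1 / s') * (1 / s + 1 / s'))) ≤ 1 * (δ * (L * L * (L + L))) := by
    have h0 : (s' - s) * ((1 / s) * (1 / s') * (1 / s + 1 / s')) ≤
        δ * ((1 / s) * (1 / s') * (1 / s + 1 / s')) := by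
      gcongr
      exact (le_abs_self _).trans hss
    calc _ ≤ ‖p‖ ^ 2 * (δ * ((1 / s) * (1 / s') * (1 / s + 1 / s'))) := by gcongr
      _ ≤ 1 * (δ * (L * L * (L + L))) := by gcongr
  have h5 : δ * (2 * L ^ 3) ≤ δ * (2 * L ^ 3) * (1 + w ^ 2) := by
    have : 0 ≤ δ * (2 * L ^ 3) := by positivity
    nlinarith [sq_nonneg w]
  nlinarith

/-- Since `g` lies below the gain at almost every point of `μ`, the gain absorbs the growth of `r`
whatever the minimizer `y` is. The rate actually used is a continuous `k`, as `g` will only be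
integrable in time; the mismatch becomes the error `‖g t - k t‖`. -/
lemma isSubsolution_hopfLax {L T : ℝ} (hL : 0 < L) {μ : Kernel ℝ Q} {v : ℝ × Q → ℝ}
    {g k : ℝ → C(Q, ℝ)} (hk : Continuous k) (hkc : HasCompactSupport k) (r₀ : C(Q, ℝ)) (s : ℝ)
    (hg : ∀ᵐ z ∂(spaceTime T μ), ∀ y, g z.1 y ≤
      ‖z.2 + (remTime L T z.1 * v z : ℝ) - y‖ ^ 2 / remTime L T z.1 ^ 2) :
    IsSubsolution T μ v (fun t => ‖g t - k t‖)
      (hopfLax (remTime L T) fun t => r₀ + ∫ τ in s..t, k τ) := by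
  intro η hη
  obtain ⟨δ₁, hδ₁, hkδ⟩ := Metric.uniformContinuous_iff.1
    (hkc.uniformContinuous_of_continuous hk) (η / 2) (by linarith)
  set C := 2 * L ^ 2 + 2 * L ^ 3
  have hC : 0 < C := by positivity
  -- Times between `t` and `t + h` are within `2 δ < δ₁` of `z.1`, where `k` varies by less than `η
  -- / 2`; the second bound makes the change of base point cost at most `η / 2 * (1 + v z ^ 2)`.
  refine ⟨min (δ₁ / 3) (η / (2 * C)), by positivity, ?_⟩
  filter_upwards [hg] with z hz t u h ht hu hh hhδ hT
  set δ := min (δ₁ / 3) (η / (2 * C))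
  have hδ1 : δ ≤ δ₁ / 3 := min_le_left _ _
  have hδ2 : δ * C ≤ η / 2 := by
    have : δ ≤ η / (2 * C) := min_le_right _ _
    calc δ * C ≤ η / (2 * C) * C := by gcongr
      _ = η / 2 := by field_simp
  have hσ : remTime L T t = remTime L T (t + h) + h := by
    rw [remTime_of_le hT.le, remTime_of_le (by linarith)]; ring
  obtain ⟨y, hy⟩ := exists_hopfLax_add_le (r := fun t => r₀ + ∫ τ in s..t, k τ) hh
    (remTime_pos hL T (t + h)) hσ (z.2 + (u : Q)) (v z)
  have hi : ∀ a b : ℝ, IntervalIntegrable k volume a b := fun a b => hk.intervalIntegrable a b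
  have hr : (r₀ + ∫ τ in s..(t + h), k τ) y - (r₀ + ∫ τ in s..t, k τ) y ≤
      h * (k z.1 y + η / 2) := by
    have e : (r₀ + ∫ τ in s..(t + h), k τ) y - (r₀ + ∫ τ in s..t, k τ) y =
        (∫ τ in t..(t + h), k τ) y := by
      rw [← ContinuousMap.sub_apply, add_sub_add_left_eq_sub,
        intervalIntegral.integral_interval_sub_left (hi _ _) (hi _ _)]
    have h1 : ‖(∫ τ in t..(t + h), k τ) - h • k z.1‖ ≤ (η / 2) * |t + h - t| := by
      have e2 : (∫ τ in t..(t + h), k τ) - h • k z.1 = ∫ τ in t..(t + h), (k τ - k z.1) := by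
        rw [intervalIntegral.integral_sub (hi _ _) (by simp), intervalIntegral.integral_const]
        simp
      rw [e2]
      refine intervalIntegral.norm_integral_le_of_norm_le_const fun τ hτ => ?_
      rw [uIoc_of_le (by linarith)] at hτ
      rw [← dist_eq_norm]
      refine (hkδ ?_).le
      rw [Real.dist_eq]
      have := abs_le.1 ht
      rw [abs_lt]
      constructor <;> linarith [hτ.1, hτ.2]
    rw [add_sub_cancel_left, abs_of_pos hh] at h1
    have h2 := (le_abs_self _).trans (((∫ τ in t..(t + h), k τ) - h • k z.1).norm_coe_le_norm y)
    simp only [ContinuousMap.sub_apply, ContinuousMap.smul_apply, smul_eq_mul] at h2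
    rw [e]
    linarith
  have h1 := sq_norm_div_remTime_sub_le (T := T) hL ht z.2 y hu (v z)
  have h2 := hz y
  have h3 : k z.1 y - g z.1 y ≤ ‖g z.1 - k z.1‖ := by
    have := (neg_le_abs _).trans ((g z.1 - k z.1).norm_coe_le_norm y)
    simp only [ContinuousMap.sub_apply] at this
    linarith
  have h4 : δ * C * (1 + v z ^ 2) ≤ η / 2 * (1 + v z ^ 2) := by gcongr
  have h5 : k z.1 y + η / 2 - ‖z.2 + (u : Q) + (remTime L T t * v z : ℝ) - y‖ ^ 2 /
      remTime L T t ^ 2 ≤ ‖g z.1 - k z.1‖ + η * (1 + v z ^ 2) := by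
    nlinarith [mul_nonneg hη.le (sq_nonneg (v z))]
  have h6 := mul_le_mul_of_nonneg_left h5 hh.le
  linarith

/-! ### The lower bound by duality on one side of a time. -/

instance circle_isProbabilityMeasure : IsProbabilityMeasure (volume : Measure Q) :=
  ⟨UnitAddCircle.measure_univ⟩

/-- The mean on the circle, as a continuous linear form on continuous functions. -/
noncomputable def circleMean : C(Q, ℝ) →L[ℝ] ℝ :=
  LinearMap.mkContinuous
    { toFun := fun f => ∫ y : Q, f y
      map_add' := fun f g => integral_add (circle_continuous_integrable f.continuous)
        (circle_continuous_integrable g.continuous)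
      map_smul' := fun c f => integral_const_mul c _ } 1 (fun f => by
        have h := abs_integral_sub_le (volume : Measure Q) f 0
        simpa using h)

lemma circleMean_apply (f : C(Q, ℝ)) : circleMean f = ∫ y : Q, f y := rfl

lemma abs_circleMean_le (f : C(Q, ℝ)) : |circleMean f| ≤ ‖f‖ := by
  simpa [circleMean_apply] using abs_integral_sub_le (volume : Measure Q) f 0

/-- `sliceDistSq` as a continuous function on the circle. -/
noncomputable def sliceDistMap (μ : Kernel ℝ Q) [IsMarkovKernel μ] (θ : ℝ × Q → Q) (t : ℝ) :
    C(Q, ℝ) :=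
  ⟨sliceDistSq μ θ t, (sliceDistSq_lipschitz t).continuous⟩

lemma ncard_atoms_pos {ν : Measure Q} [IsProbabilityMeasure ν] (hfin : (atoms ν).Finite)
    (hat : ν (atoms ν)ᶜ = 0) : 0 < (atoms ν).ncard := by
  rw [Set.ncard_pos hfin]
  by_contra h
  rw [not_nonempty_iff_eq_empty] at h
  rw [h, compl_empty, measure_univ] at hat
  exact one_ne_zero hat

lemma le_circleMean_sliceDistMap {μ : Kernel ℝ Q} [IsMarkovKernel μ] (θ : ℝ × Q → Q) {t : ℝ}
    (hfin : (atoms (μ t)).Finite) (hat : μ t (atoms (μ t))ᶜ = 0) :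
    1 / (12 * ((atoms (μ t)).ncard : ℝ) ^ 2) ≤ circleMean (sliceDistMap μ θ t) := by
  classical
  refine quantization_le (hfin.toFinset.image fun x => θ (t, x)) (ncard_atoms_pos hfin hat) ?_
    (circle_continuous_integrable (sliceDistMap μ θ t).continuous) fun y => ?_
  · rw [Set.ncard_eq_toFinset_card _ hfin]
    exact Finset.card_image_le
  · obtain ⟨x, hx, hxy⟩ := exists_atom_le_sliceDistSq (θ := θ) hfin hat y
    refine ⟨θ (t, x), Finset.mem_image_of_mem _ (hfin.mem_toFinset.2 hx), ?_⟩
    rw [norm_sub_rev]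
    exact hxy

lemma norm_sliceDistMap_le (μ : Kernel ℝ Q) [IsMarkovKernel μ] (θ : ℝ × Q → Q) (t : ℝ) :
    ‖sliceDistMap μ θ t‖ ≤ 1 := by
  rw [ContinuousMap.norm_le _ zero_le_one]
  intro y
  change ‖sliceDistSq μ θ t y‖ ≤ 1
  rw [Real.norm_of_nonneg (sliceDistSq_nonneg t y)]
  exact sliceDistSq_le_one t y

/-- The position reached at speed `v` after the remaining time. -/
noncomputable def shoot (L T : ℝ) (v : ℝ × Q → ℝ) (z : ℝ × Q) : Q :=
  z.2 + ((remTime L T z.1 * v z : ℝ) : Q)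

lemma measurable_shoot (L T : ℝ) {v : ℝ × Q → ℝ} (hv : Measurable v) : Measurable (shoot L T v) := by
  unfold shoot
  have h1 : Measurable fun z : ℝ × Q => ((remTime L T z.1 * v z : ℝ) : Q) :=
    AddCircle.measurable_mk'.comp
      (((continuous_remTime L T).measurable.comp measurable_fst).mul hv)
  exact measurable_snd.add h1

/-- The rate of gain `t ↦ dist² (·, shoot (supp μ_t)) / σ_t²`. -/
noncomputable def gainRate (L T : ℝ) (μ : Kernel ℝ Q) [IsMarkovKernel μ] (v : ℝ × Q → ℝ) (t : ℝ) :
    C(Q, ℝ) :=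
  (Ioo (-T) T).indicator (fun t => 1 / remTime L T t ^ 2) t • sliceDistMap μ (shoot L T v) t

lemma integrable_gainRate {L T : ℝ} (hL : 0 < L) (μ : Kernel ℝ Q) [IsMarkovKernel μ]
    {v : ℝ × Q → ℝ} (hv : Measurable v) : Integrable (gainRate L T μ v) := by
  have h1 : StronglyMeasurable (sliceDistMap μ (shoot L T v)) :=
    stronglyMeasurable_continuousMap fun y => measurable_sliceDistSq (measurable_shoot L T hv) y
  have h2 : Continuous fun t => 1 / remTime L T t ^ 2 :=
    continuous_const.div ((continuous_remTime L T).pow 2) fun t => (pow_pos (remTime_pos hL T t) 2).ne'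
  have h3 : Integrable ((Ioo (-T) T).indicator fun t => 1 / remTime L T t ^ 2) := by
    rw [integrable_indicator_iff measurableSet_Ioo]
    exact (h2.integrableOn_Icc).mono_set Ioo_subset_Icc_self
  refine h3.norm.mono' (h3.aestronglyMeasurable.smul h1.aestronglyMeasurable)
    (ae_of_all _ fun t => ?_)
  rw [gainRate, norm_smul]
  exact mul_le_of_le_one_right (norm_nonneg _) (norm_sliceDistMap_le _ _ _)

/-- The lower bound on the energy spent between a time `s` and the boundary. -/
theorem IsVelocity.energy_lower_bound {L T : ℝ} (hL : 0 < L) {μ : Kernel ℝ Q} [IsMarkovKernel μ]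
    {v : ℝ × Q → ℝ} (hvm : Measurable v) (hv : IsVelocity T μ v)
    (hv2 : Integrable (fun z => v z ^ 2) (spaceTime T μ))
    (hat : ∀ᵐ t ∂(volume.restrict (Ioo (-T) T)), IsPurelyAtomic (μ t))
    (hfin : ∀ᵐ t ∂(volume.restrict (Ioo (-T) T)), (atoms (μ t)).Finite)
    {s : ℝ} (hs : s ∈ Ioo (-T) T) (hsat : IsPurelyAtomic (μ s)) (hsfin : (atoms (μ s)).Finite)
    (hνs : IsTrace (𝓝[>] s) μ ⟨μ s, inferInstance⟩) {νT : ProbabilityMeasure Q}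
    (hνT : IsTrace (𝓝[<] T) μ νT) {π : Measure (Q × Q)} (hπ1 : π.map Prod.fst = (νT : Measure Q))
    (hπ2 : π.map Prod.snd = volume) :
    1 / (12 * ((atoms (μ s)).ncard : ℝ) ^ 2) / remTime L T s +
      ∫ t in s..T, 1 / (12 * ((atoms (μ t)).ncard : ℝ) ^ 2) / remTime L T t ^ 2 ≤
      (∫ t in s..T, speedSq μ v t) + L * ∫ p, ‖p.1 - p.2‖ ^ 2 ∂π := by
  have hsT := hs.2.le
  have hGi := integrable_gainRate (T := T) hL μ hvm
  set G := gainRate L T μ v with hG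
  have hσ0 := remTime_pos hL T
  have hmassπ : IsProbabilityMeasure π := by
    constructor
    have : π.map Prod.fst univ = 1 := by rw [hπ1]; exact measure_univ
    rwa [Measure.map_apply measurable_fst MeasurableSet.univ, preimage_univ] at this
  refine le_of_forall_pos_le_add fun ε' hε' => ?_
  obtain ⟨ε, hε, rfl⟩ : ∃ ε > 0, ε' = ε + ε := ⟨ε' / 2, by linarith, by ring⟩
  -- The approximation costs `ε` twice: as the error of the subsolution, and when the mean of `k` is
  -- replaced by that of `G`.
  obtain ⟨k, hkc, hkε, hk, hki⟩ := hGi.exists_hasCompactSupport_integral_sub_le hε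
  have hei : Integrable fun t => ‖G t - k t‖ := (hGi.sub hki).norm
  have hesT : ∫ t in s..T, ‖G t - k t‖ ≤ ε := by
    rw [intervalIntegral.integral_of_le hsT]
    exact (setIntegral_le_integral hei (ae_of_all _ fun t => norm_nonneg _)).trans hkε
  -- With this initial value the potential is nonnegative at the atoms of `μ s`.
  set r₀ : C(Q, ℝ) := (1 / remTime L T s) • sliceDistMap μ Prod.snd s with hr₀
  set r : ℝ → C(Q, ℝ) := fun t => r₀ + ∫ τ in s..t, k τ with hr
  have hrc : Continuous r := continuous_const.add
    (intervalIntegral.continuous_primitive (fun a b => hk.intervalIntegrable a b) s)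
  set ζ := hopfLax (remTime L T) r with hζ
  have hζc : Continuous ζ := continuous_hopfLax (continuous_remTime L T) hσ0 hrc
  have hsub : IsSubsolution T μ v (fun t => ‖G t - k t‖) ζ := by
    refine isSubsolution_hopfLax hL hk hkc r₀ s ?_
    filter_upwards [ae_mem_atoms hat, ae_spaceTime_mem T μ] with z hz hzI y
    rw [hG, gainRate, indicator_of_mem hzI]
    simp only [ContinuousMap.smul_apply, smul_eq_mul]
    rw [one_div_mul_eq_div]
    have := hσ0 z.1
    gcongr
    exact sliceDistSq_le (θ := shoot L T v) hz y
  have hmain := hv.trace_sub_trace_le hv2 hei.integrableOn hζc hsub hs hνs hνT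
  have hk1 : IntervalIntegrable (speedSq μ v) volume s T := by
    have h1 : IntegrableOn (speedSq μ v) (Ioo (-T) T) := integrable_integral_slice hv2
    rw [intervalIntegrable_iff_integrableOn_Ioo_of_le hsT]
    exact h1.mono_set (Ioo_subset_Ioo_left hs.1.le)
  rw [intervalIntegral.integral_add hk1 hei.intervalIntegrable] at hmain
  have hζs : 0 ≤ ∫ x, ζ (s, x) ∂(μ s) := by
    refine integral_nonneg_of_ae ?_
    have : ∀ᵐ x ∂(μ s), x ∈ atoms (μ s) := hsat.measure_compl_atoms
    filter_upwards [this] with x hx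
    obtain ⟨y, hy⟩ := exists_hopfLax_eq (σ := remTime L T) (r := r) (s, x)
    simp only [Pi.zero_apply]
    rw [hζ, hy]
    have h1 : r s y = sliceDistSq μ Prod.snd s y / remTime L T s := by
      simp only [hr, hr₀, intervalIntegral.integral_same, add_zero, ContinuousMap.smul_apply,
        smul_eq_mul, one_div_mul_eq_div]
      rfl
    simp only [h1]
    rw [← sub_div]
    exact div_nonneg (sub_nonneg.2 (sliceDistSq_le (θ := Prod.snd) hx y)) (hσ0 s).le
  have hπint : ∀ {f : Q × Q → ℝ}, Continuous f → Integrable f π := fun hf =>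
    hf.integrable_of_hasCompactSupport (HasCompactSupport.of_compactSpace _)
  -- At time `T` the potential is the transform of `r T` for the cost `L * ‖x - y‖ ^ 2`; this is
  -- weak Kantorovich duality, valid for every coupling.
  have hζT : ∫ x, ζ (T, x) ∂(νT : Measure Q) ≤
      L * ∫ p, ‖p.1 - p.2‖ ^ 2 ∂π - circleMean (r T) := by
    have hζTc : Continuous fun x => ζ (T, x) := hζc.comp (by fun_prop)
    have e1 : ∫ x, ζ (T, x) ∂(νT : Measure Q) = ∫ p, ζ (T, p.1) ∂π := by
      rw [← hπ1, integral_map measurable_fst.aemeasurable hζTc.aestronglyMeasurable]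
    have e2 : circleMean (r T) = ∫ p, r T p.2 ∂π := by
      rw [circleMean_apply, ← hπ2, integral_map measurable_snd.aemeasurable
        (r T).continuous.aestronglyMeasurable]
    have hi1 : Integrable (fun p : Q × Q => L * ‖p.1 - p.2‖ ^ 2) π := hπint (by fun_prop)
    have hi2 : Integrable (fun p : Q × Q => r T p.2) π := hπint (by fun_prop)
    rw [e1, e2, ← integral_const_mul, ← integral_sub hi1 hi2]
    refine integral_mono (hπint (hζTc.comp continuous_fst)) (hi1.sub hi2) fun p => ?_
    have h1 := hopfLax_le (σ := remTime L T) (r := r) (T, p.1) p.2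
    have h2 : remTime L T T = 1 / L := by rw [remTime_of_le le_rfl]; ring
    simp only [h2] at h1
    rw [div_div_eq_mul_div, div_one, mul_comm] at h1
    exact h1
  have hmean : circleMean (r T) = circleMean r₀ + ∫ t in s..T, circleMean (k t) := by
    rw [hr, map_add, ContinuousLinearMap.intervalIntegral_comp_comm _ (hk.intervalIntegrable _ _)]
  have hGm : IntervalIntegrable (fun t => circleMean (G t)) volume s T :=
    (circleMean.integrable_comp hGi).intervalIntegrable
  have hkm : IntervalIntegrable (fun t => circleMean (k t)) volume s T :=
    (circleMean.integrable_comp hki).intervalIntegrable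
  have hGk : ∫ t in s..T, circleMean (G t) ≤ (∫ t in s..T, circleMean (k t)) + ε := by
    rw [← sub_le_iff_le_add', ← intervalIntegral.integral_sub hGm hkm]
    refine le_trans ?_ hesT
    refine intervalIntegral.integral_mono_on hsT (hGm.sub hkm) hei.intervalIntegrable fun t _ => ?_
    rw [← map_sub]
    exact (le_abs_self _).trans (abs_circleMean_le _)
  have hr₀m : 1 / (12 * ((atoms (μ s)).ncard : ℝ) ^ 2) / remTime L T s ≤ circleMean r₀ := by
    rw [hr₀, map_smul, smul_eq_mul, one_div_mul_eq_div]
    have := hσ0 s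
    gcongr
    exact le_circleMean_sliceDistMap _ hsfin hsat.measure_compl_atoms
  have hGlow : ∫ t in s..T, 1 / (12 * ((atoms (μ t)).ncard : ℝ) ^ 2) / remTime L T t ^ 2 ≤
      ∫ t in s..T, circleMean (G t) := by
    rw [intervalIntegral.integral_of_le hsT, intervalIntegral.integral_of_le hsT,
      integral_Ioc_eq_integral_Ioo, integral_Ioc_eq_integral_Ioo]
    have hsubset : Ioo s T ⊆ Ioo (-T) T := Ioo_subset_Ioo_left hs.1.le
    refine integral_mono_of_nonneg (ae_of_all _ fun t => ?_)
      (circleMean.integrable_comp hGi).integrableOn ?_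
    · have := hσ0 t
      simp only [Pi.zero_apply]
      positivity
    · filter_upwards [ae_restrict_of_ae_restrict_of_subset hsubset hat,
        ae_restrict_of_ae_restrict_of_subset hsubset hfin, ae_restrict_mem measurableSet_Ioo]
        with t h1 h2 h3
      rw [hG, gainRate, indicator_of_mem (hsubset h3), map_smul, smul_eq_mul, one_div_mul_eq_div]
      have := hσ0 t
      gcongr
      exact le_circleMean_sliceDistMap _ h2 h1.measure_compl_atoms
  simp only [ProbabilityMeasure.coe_mk] at hmain
  linarith

/-! ### The straight equidistant competitors and their energy. -/

lemma equidistant_univ {N : ℕ} (hN : 0 < N) (x₀ : Q) : equidistant N x₀ univ = 1 := by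
  simp only [equidistant, Measure.coe_finsetSum, Finset.sum_apply, Measure.smul_apply,
    measure_univ, smul_eq_mul, mul_one, Finset.sum_const, Finset.card_range, nsmul_eq_mul]
  exact ENNReal.mul_inv_cancel (by exact_mod_cast hN.ne') (by simp)

lemma equidistant_isPurelyAtomic (N : ℕ) (x₀ : Q) : IsPurelyAtomic (equidistant N x₀) := by
  refine ⟨fun i => if i < N then (N : ℝ≥0∞)⁻¹ else 0, fun i => x₀ + (((i : ℝ) / N : ℝ) : Q), ?_⟩
  ext A hA
  rw [Measure.sum_apply _ hA, tsum_eq_sum (s := Finset.range N)]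
  · simp only [equidistant, Measure.coe_finsetSum, Finset.sum_apply]
    refine Finset.sum_congr rfl fun i hi => ?_
    rw [if_pos (Finset.mem_range.1 hi)]
  · intro i hi
    rw [Finset.mem_range] at hi
    simp [hi]

lemma encard_atoms_equidistant_le (N : ℕ) (x₀ : Q) : (atoms (equidistant N x₀)).encard ≤ N := by
  classical
  have h : atoms (equidistant N x₀) ⊆
      ((Finset.range N).image fun i : ℕ => x₀ + (((i : ℝ) / N : ℝ) : Q) : Finset Q) := by
    intro x hx
    by_contra hne
    refine hx ?_
    simp only [equidistant, Measure.coe_finsetSum, Finset.sum_apply, Measure.smul_apply,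
      smul_eq_mul]
    refine Finset.sum_eq_zero fun i hi => ?_
    rw [Measure.dirac_apply' _ (measurableSet_singleton _), indicator_of_notMem, mul_zero]
    rintro rfl
    exact hne (Finset.mem_coe.2 (Finset.mem_image_of_mem _ hi))
  refine (encard_le_encard h).trans ?_
  rw [encard_coe_eq_coe_finsetCard]
  exact_mod_cast Finset.card_image_le.trans (Finset.card_range N).le

lemma sum_restrict_Ioc (N : ℕ) (hN : 0 < N) (a : ℝ) (n : ℕ) :
    ∑ i ∈ Finset.range n, (volume : Measure ℝ).restrict (Ioc ((i : ℝ) / N - a) (((i : ℝ) + 1) / N - a)) =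
      volume.restrict (Ioc (-a) ((n : ℝ) / N - a)) := by
  have hN' : (0 : ℝ) < N := by exact_mod_cast hN
  induction n with
  | zero => simp
  | succ n ih =>
    rw [Finset.sum_range_succ, ih, ← Measure.restrict_union _ measurableSet_Ioc, Ioc_union_Ioc_eq_Ioc]
    · push_cast; rfl
    · have : (0 : ℝ) ≤ (n : ℝ) / N := by positivity
      linarith
    · have : (n : ℝ) / N ≤ ((n : ℝ) + 1) / N := by gcongr; linarith
      linarith
    · rw [Set.disjoint_left]
      intro x hx hx'
      exact absurd hx.2 (not_le.2 hx'.1)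

lemma lintegral_circle_sq {a : ℝ} (ha0 : 0 ≤ a) :
    ∫⁻ u in Ioc (-a) a, ‖(u : Q)‖ₑ ^ 2 ≤ ENNReal.ofReal (2 * a ^ 3 / 3) := by
  have h1 : ∫⁻ u in Ioc (-a) a, ‖(u : Q)‖ₑ ^ 2 ≤ ∫⁻ u in Ioc (-a) a, ENNReal.ofReal (u ^ 2) := by
    refine lintegral_mono fun u => ?_
    have h2 : ‖(u : Q)‖ₑ ≤ ENNReal.ofReal |u| := by
      rw [← ofReal_norm]
      exact ENNReal.ofReal_le_ofReal (circle_norm_coe_le u)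
    calc ‖(u : Q)‖ₑ ^ 2 ≤ ENNReal.ofReal |u| ^ 2 := by gcongr
      _ = ENNReal.ofReal (u ^ 2) := by rw [← ENNReal.ofReal_pow (abs_nonneg u), sq_abs]
  refine h1.trans ?_
  have hi : IntegrableOn (fun u : ℝ => u ^ 2) (Ioc (-a) a) :=
    ((continuous_id.pow 2).integrableOn_Icc).mono_set Ioc_subset_Icc_self
  rw [← ofReal_integral_eq_lintegral_ofReal hi (ae_of_all _ fun u => sq_nonneg u),
    ← intervalIntegral.integral_of_le (by linarith), integral_pow]
  refine ENNReal.ofReal_le_ofReal (le_of_eq ?_)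
  norm_num
  ring

/-- Each atom is spread uniformly over its own Voronoi cell, of half-width `a = 1 / (2 N)`; the
half-open cells tile an interval of length one. -/
lemma WperSq_equidistant_le {N : ℕ} (hN : 0 < N) :
    WperSq (equidistant N 0) volume ≤ ENNReal.ofReal (1 / (12 * (N : ℝ) ^ 2)) := by
  have hN' : (0 : ℝ) < N := by exact_mod_cast hN
  set a : ℝ := 1 / (2 * N) with ha
  have ha0 : 0 < a := by positivity
  have h2a : (2 : ℝ) * a = 1 / N := by rw [ha]; field_simp
  set x : ℕ → ℝ := fun i => (i : ℝ) / N with hx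
  have hmk : Measurable fun u : ℝ => (u : Q) := AddCircle.measurable_mk'
  have hmeas : ∀ i, Measurable fun u : ℝ => (((x i : ℝ) : Q), ((x i + u : ℝ) : Q)) := fun i =>
    measurable_const.prodMk (hmk.comp (measurable_const_add _))
  set π : Measure (Q × Q) := ∑ i ∈ Finset.range N,
    (volume.restrict (Ioc (-a) a)).map fun u : ℝ => (((x i : ℝ) : Q), ((x i + u : ℝ) : Q)) with hπ
  have hmap : ∀ {f : Q × Q → Q}, Measurable f → π.map f = ∑ i ∈ Finset.range N,
      (volume.restrict (Ioc (-a) a)).map fun u : ℝ => f (((x i : ℝ) : Q), ((x i + u : ℝ) : Q)) := by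
    intro f hf
    rw [hπ, ← Measure.mapₗ_apply_of_measurable hf, map_sum]
    refine Finset.sum_congr rfl fun i _ => ?_
    rw [Measure.mapₗ_apply_of_measurable hf, Measure.map_map hf (hmeas i)]
    rfl
  have h1 : π.map Prod.fst = equidistant N 0 := by
    rw [hmap measurable_fst, equidistant]
    refine Finset.sum_congr rfl fun i _ => ?_
    simp only [Measure.map_const, zero_add]
    congr 1
    rw [Measure.restrict_apply_univ, Real.volume_Ioc, sub_neg_eq_add, ← two_mul, h2a, one_div,
      ENNReal.ofReal_inv_of_pos hN', ENNReal.ofReal_natCast]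
  have h2 : π.map Prod.snd = volume := by
    rw [hmap measurable_snd]
    have h3 : ∀ i ∈ Finset.range N, ((volume.restrict (Ioc (-a) a)).map fun u : ℝ =>
        ((x i + u : ℝ) : Q)) = Measure.mapₗ (fun u : ℝ => (u : Q))
          (volume.restrict (Ioc ((i : ℝ) / N - a) (((i : ℝ) + 1) / N - a))) := by
      intro i _
      have h4 : (volume : Measure ℝ).restrict (Ioc ((i : ℝ) / N - a) (((i : ℝ) + 1) / N - a)) =
          (volume.restrict (Ioc (-a) a)).map fun u => x i + u := by
        have hp := (measurePreserving_add_left volume (x i)).restrict_preimage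
          (measurableSet_Ioc (a := (i : ℝ) / N - a) (b := ((i : ℝ) + 1) / N - a))
        rw [← hp.map_eq]
        congr 2
        ext u
        have : ((i : ℝ) + 1) / N = x i + 2 * a := by rw [h2a, hx]; ring
        simp only [mem_preimage, mem_Ioc, hx, this]
        constructor <;> intro h <;> constructor <;> linarith [h.1, h.2]
      rw [Measure.mapₗ_apply_of_measurable hmk, h4, Measure.map_map hmk (measurable_const_add _)]
      rfl
    rw [Finset.sum_congr rfl h3, ← map_sum, sum_restrict_Ioc N hN a N,
      Measure.mapₗ_apply_of_measurable hmk, div_self hN'.ne']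
    have := (UnitAddCircle.measurePreserving_mk (-a)).map_eq
    rwa [neg_add_eq_sub] at this
  refine (iInf_le_of_le π (iInf_le_of_le h1 (iInf_le _ h2))).trans ?_
  have hcm : Measurable fun p : Q × Q => ‖p.1 - p.2‖ₑ ^ 2 := by fun_prop
  rw [hπ, lintegral_finsetSum_measure]
  calc ∑ i ∈ Finset.range N, ∫⁻ p, ‖p.1 - p.2‖ₑ ^ 2
        ∂((volume.restrict (Ioc (-a) a)).map fun u : ℝ => (((x i : ℝ) : Q), ((x i + u : ℝ) : Q)))
      ≤ ∑ _i ∈ Finset.range N, ENNReal.ofReal (2 * a ^ 3 / 3) := by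
        refine Finset.sum_le_sum fun i _ => ?_
        rw [lintegral_map hcm (hmeas i)]
        refine le_trans (le_of_eq ?_) (lintegral_circle_sq ha0.le)
        refine lintegral_congr fun u => ?_
        simp only
        rw [AddCircle.coe_add, sub_add_cancel_left, enorm_neg]
    _ = ENNReal.ofReal (1 / (12 * (N : ℝ) ^ 2)) := by
        rw [Finset.sum_const, Finset.card_range, nsmul_eq_mul, ← ENNReal.ofReal_natCast,
          ← ENNReal.ofReal_mul hN'.le]
        congr 1
        rw [ha]
        field_simp
        norm_num

lemma isVelocity_const_zero (T : ℝ) (ν : Measure Q) [IsProbabilityMeasure ν] :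
    IsVelocity T (Kernel.const ℝ ν) fun _ => 0 where
  integrable := integrable_zero _ _ _
  continuity_eq := by
    intro φ hφ
    simp only [zero_mul, add_zero]
    have hc := continuous_timeDeriv hφ.smooth
    have hi := integrable_spaceTime_of_continuous (T := T) (μ := Kernel.const ℝ ν) hc
    have e : spaceTime T (Kernel.const ℝ ν) = (volume.restrict (Ioo (-T) T)).prod ν :=
      Measure.compProd_const
    rw [e] at hi ⊢
    rw [integral_prod_symm _ hi]
    refine integral_eq_zero_of_ae (ae_of_all _ fun x => ?_)
    simp only [Pi.zero_apply]
    rcases le_or_gt T (-T) with hT | hT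
    · rw [Ioo_eq_empty (not_lt.2 hT)]
      simp
    rw [← integral_Ioc_eq_integral_Ioo, ← intervalIntegral.integral_of_le hT.le]
    have hd : ∀ t ∈ uIcc (-T) T, HasDerivAt (fun s : ℝ => φ (s, x)) (timeDeriv φ (t, x)) t := by
      intro t _
      have : DifferentiableAt ℝ (fun s : ℝ => φ (s, x)) t := by
        induction x using QuotientAddGroup.induction_on with
        | H x =>
        have h1 : Differentiable ℝ fun s : ℝ => (s, x) := by fun_prop
        exact ((hφ.smooth.differentiable (by simp)).comp h1) t
      exact this.hasDerivAt
    rw [intervalIntegral.integral_eq_sub_of_hasDerivAt hd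
      ((hc.comp (by fun_prop : Continuous fun t : ℝ => (t, x))).intervalIntegrable _ _)]
    have hz : ∀ t, t ∉ Ioo (-T) T → φ (t, x) = 0 := fun t ht => by
      by_contra hne
      exact ht (hφ.support_subset (subset_tsupport φ hne)).1
    rw [hz T (by simp), hz (-T) (by simp), sub_zero]

lemma equidistant_isProbabilityMeasure {N : ℕ} (hN : 0 < N) (x₀ : Q) :
    IsProbabilityMeasure (equidistant N x₀) := ⟨equidistant_univ hN x₀⟩

lemma admissible_const_equidistant (T : ℝ) {N : ℕ} (hN : 0 < N) (x₀ : Q) :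
    Admissible T (Kernel.const ℝ (equidistant N x₀)) := by
  have := equidistant_isProbabilityMeasure hN x₀
  exact ⟨inferInstance, ae_of_all _ fun t => equidistant_isPurelyAtomic N x₀, _,
    isVelocity_const_zero T _⟩

/-- The energy of the straight competitor with `N` equidistant atoms. -/
lemma energy_const_equidistant_le {lam T : ℝ} (hlam : 0 < lam) (hT : 0 < T) {N : ℕ} (hN : 0 < N) :
    energy lam T (Kernel.const ℝ (equidistant N 0)) ≤
      ENNReal.ofReal (2 * T * N + lam / (6 * (N : ℝ) ^ 2)) := by
  have := equidistant_isProbabilityMeasure hN 0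
  have hN' : (0 : ℝ) < N := by exact_mod_cast hN
  have htrace : ∀ l : Filter ℝ, traceCost l (Kernel.const ℝ (equidistant N 0)) ≤
      ENNReal.ofReal (1 / (12 * (N : ℝ) ^ 2)) := by
    intro l
    have ht : IsTrace l (Kernel.const ℝ (equidistant N 0)) ⟨equidistant N 0, this⟩ := by
      intro f
      simp only [Kernel.const_apply]
      exact tendsto_const_nhds
    exact (iInf₂_le (⟨equidistant N 0, this⟩ : ProbabilityMeasure Q) ht).trans
      (WperSq_equidistant_le hN)
  have hint : internalEnergy T (Kernel.const ℝ (equidistant N 0)) ≤ ENNReal.ofReal (2 * T * N) := by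
    refine (iInf₂_le (fun _ => 0) (isVelocity_const_zero T _)).trans ?_
    have hk : kinetic T (Kernel.const ℝ (equidistant N 0)) (fun _ => 0) = 0 := by simp [kinetic]
    rw [hk, add_zero]
    have hle : ∀ t : ℝ, (({x : Q | Kernel.const ℝ (equidistant N 0) t {x} ≠ 0}.encard : ℕ∞) : ℝ≥0∞) ≤
        (N : ℝ≥0∞) := by
      intro t
      have := encard_atoms_equidistant_le N 0
      rw [Kernel.const_apply]
      exact_mod_cast ENat.toENNReal_le.2 this
    refine (lintegral_mono hle).trans ?_
    rw [lintegral_const, Measure.restrict_apply_univ, Real.volume_Ioo, sub_neg_eq_add, ← two_mul,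
      ← ENNReal.ofReal_natCast, ← ENNReal.ofReal_mul hN'.le, mul_comm]
  refine (add_le_add hint (mul_le_mul_right (add_le_add (htrace _) (htrace _)) _)).trans ?_
  rw [← ENNReal.ofReal_add (by positivity) (by positivity), ← ENNReal.ofReal_mul hlam.le,
    ← ENNReal.ofReal_add (by positivity) (by positivity)]
  refine ENNReal.ofReal_le_ofReal (le_of_eq ?_)
  field_simp
  ring

/-! ### One-sided bounds in terms of the minimal number of atoms. -/

/-- A curve of finitely supported measures, driven by a measurable square integrable velocity. -/
structure IsFiniteCurve (T : ℝ) (μ : Kernel ℝ Q) (v : ℝ × Q → ℝ) : Prop where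
  measurable : Measurable v
  velocity : IsVelocity T μ v
  sq_integrable : Integrable (fun z => v z ^ 2) (spaceTime T μ)
  atomic : ∀ᵐ t ∂(volume.restrict (Ioo (-T) T)), IsPurelyAtomic (μ t)
  finite : ∀ᵐ t ∂(volume.restrict (Ioo (-T) T)), (atoms (μ t)).Finite

/-- The number of atoms at time `t`, as a real number. -/
noncomputable def numAtoms (μ : Kernel ℝ Q) (t : ℝ) : ℝ := (atoms (μ t)).ncard

/-- A coupling of `ν₁` and `ν₂`. -/
structure IsCoupling (π : Measure (Q × Q)) (ν₁ ν₂ : Measure Q) : Prop where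
  map_fst : π.map Prod.fst = ν₁
  map_snd : π.map Prod.snd = ν₂

/-- The quadratic cost of a coupling. -/
noncomputable def transportCost (π : Measure (Q × Q)) : ℝ := ∫ p, ‖p.1 - p.2‖ ^ 2 ∂π

lemma integral_inv_remTime_sq {L T s : ℝ} (hL : 0 < L) (hs : s ≤ T) :
    ∫ t in s..T, 1 / remTime L T t ^ 2 = L - 1 / remTime L T s := by
  have e : ∫ t in s..T, 1 / remTime L T t ^ 2 = ∫ t in s..T, 1 / (T - t + 1 / L) ^ 2 := by
    refine intervalIntegral.integral_congr fun t ht => ?_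
    rw [uIcc_of_le hs] at ht
    simp only [remTime_of_le ht.2]
  have hpos : ∀ t ∈ uIcc s T, 0 < T - t + 1 / L := fun t ht => by
    rw [uIcc_of_le hs] at ht
    have : 0 < 1 / L := by positivity
    linarith [ht.2]
  rw [e, intervalIntegral.integral_eq_sub_of_hasDerivAt (f := fun t => 1 / (T - t + 1 / L)),
    remTime_of_le hs]
  · simp
  · intro t ht
    have h1 : HasDerivAt (fun t : ℝ => T - t + 1 / L) (-1) t := by
      simpa using ((hasDerivAt_id t).const_sub T).add_const (1 / L)
    have h2 := h1.inv (hpos t ht).ne'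
    simp only [one_div, neg_neg] at h2 ⊢
    exact h2
  · refine ContinuousOn.intervalIntegrable fun t ht => ?_
    have := (hpos t ht).ne'
    have hc : ContinuousAt (fun t : ℝ => (T - t + 1 / L) ^ 2) t := by fun_prop
    exact (continuousAt_const.div hc (pow_ne_zero 2 this)).continuousWithinAt

/-- Convexity of `n ↦ n⁻²` gives `1 / N ^ 2 - 1 / n ^ 2 ≤ 2 (n - N) / N ^ 3`. With `1 / σ ^ 2 ≤ L ^
2` the loss is at most `L ^ 2 (n - N) / (6 N ^ 3)`, hence the condition on `θ`. -/
lemma atom_count_trade {σ L θ N n : ℝ} (hN : 1 ≤ N) (hn : N ≤ n) (hσ : 0 < σ) (hσL : 1 / σ ≤ L)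
    (hθ : L ^ 2 ≤ 6 * θ * N ^ 3) :
    1 / (12 * N ^ 2) * (1 / σ ^ 2) - θ * (n - N) ≤ 1 / (12 * n ^ 2) / σ ^ 2 := by
  have hN0 : 0 < N := by linarith
  have hn0 : 0 < n := by linarith
  have h1 : 1 / N ^ 2 - 1 / n ^ 2 ≤ (n - N) * (2 / N ^ 3) := by
    rw [div_sub_div _ _ (by positivity) (by positivity), ← mul_div_assoc, div_le_div_iff₀
      (by positivity) (by positivity)]
    have : (n + N) * N ≤ 2 * n ^ 2 := by nlinarith
    have h0 : 0 ≤ (n - N) * N ^ 2 := mul_nonneg (by linarith) (by positivity)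
    nlinarith [mul_le_mul_of_nonneg_left this h0]
  have h2 : (1 / σ) ^ 2 ≤ 6 * θ * N ^ 3 := le_trans (by gcongr) hθ
  have h3 : (1 / σ) ^ 2 * ((n - N) * (2 / N ^ 3)) ≤ 6 * θ * N ^ 3 * ((n - N) * (2 / N ^ 3)) :=
    mul_le_mul_of_nonneg_right h2 (mul_nonneg (by linarith) (by positivity))
  have h4 : 6 * θ * N ^ 3 * ((n - N) * (2 / N ^ 3)) = 12 * (θ * (n - N)) := by
    field_simp; ring
  have h5 : (1 / σ) ^ 2 * (1 / N ^ 2 - 1 / n ^ 2) ≤ (1 / σ) ^ 2 * ((n - N) * (2 / N ^ 3)) := by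
    gcongr
  have e1 : 1 / (12 * N ^ 2) * (1 / σ ^ 2) - 1 / (12 * n ^ 2) / σ ^ 2 =
      (1 / σ) ^ 2 * (1 / N ^ 2 - 1 / n ^ 2) / 12 := by
    field_simp
  linarith

lemma IsTrace.mono {l l' : Filter ℝ} {μ : Kernel ℝ Q} {ν : ProbabilityMeasure Q} (h : IsTrace l μ ν)
    (hl : l' ≤ l) : IsTrace l' μ ν := fun f => (h f).mono_left (inf_le_inf_right _ hl)

section half

variable {L T : ℝ} {μ : Kernel ℝ Q} [IsMarkovKernel μ] {v : ℝ × Q → ℝ} {s : ℝ}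
  {νT : ProbabilityMeasure Q} {π : Measure (Q × Q)} {N : ℕ}

/-- Only the contribution of time `s` is kept, with remaining time at most `2 T + 1 / L`; no control
of the atom count at other times is needed. -/
lemma IsFiniteCurve.coarse_lower_bound_above (h : IsFiniteCurve T μ v) (hL : 0 < L)
    (hs : s ∈ Ioo (-T) T) (hsat : IsPurelyAtomic (μ s)) (hsfin : (atoms (μ s)).Finite)
    (hsN : (atoms (μ s)).ncard = N) (hνs : IsTrace (𝓝[>] s) μ ⟨μ s, inferInstance⟩)
    (hνT : IsTrace (𝓝[<] T) μ νT) (hπ : IsCoupling π νT volume) :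
    1 / (12 * (N : ℝ) ^ 2) / (2 * T + 1 / L) ≤
      (∫ t in s..T, speedSq μ v t) + L * transportCost π := by
  have hmain := h.velocity.energy_lower_bound hL h.measurable h.sq_integrable h.atomic h.finite hs
    hsat hsfin hνs hνT hπ.map_fst hπ.map_snd
  rw [hsN] at hmain
  have h1 : 0 ≤ ∫ t in s..T, 1 / (12 * ((atoms (μ t)).ncard : ℝ) ^ 2) / remTime L T t ^ 2 :=
    intervalIntegral.integral_nonneg hs.2.le fun t _ => by positivity
  have h2 : 1 / (12 * (N : ℝ) ^ 2) / (2 * T + 1 / L) ≤ 1 / (12 * (N : ℝ) ^ 2) / remTime L T s := by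
    have := remTime_pos hL T s
    gcongr
    rw [remTime_of_le hs.2.le]
    linarith [hs.1]
  unfold transportCost
  linarith

/-- With `N` in place of the true count, the term at time `s` and the integral of `1 / σ ^ 2` add up
to exactly `L / (12 N ^ 2)`, and the dependence on `s` disappears. The extra atoms are charged at
rate `θ`. -/
lemma IsFiniteCurve.lower_bound_above (h : IsFiniteCurve T μ v) (hL : 0 < L)
    (hs : s ∈ Ioo (-T) T) (hsat : IsPurelyAtomic (μ s)) (hsfin : (atoms (μ s)).Finite)
    (hsN : (atoms (μ s)).ncard = N) (hνs : IsTrace (𝓝[>] s) μ ⟨μ s, inferInstance⟩)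
    (hνT : IsTrace (𝓝[<] T) μ νT) (hπ : IsCoupling π νT volume) (hN : 0 < N)
    (hge : ∀ᵐ t ∂(volume.restrict (Ioo (-T) T)), (N : ℝ) ≤ numAtoms μ t)
    (hni : IntegrableOn (numAtoms μ) (Ioo (-T) T)) {θ : ℝ} (hθ : L ^ 2 ≤ 6 * θ * (N : ℝ) ^ 3) :
    L / (12 * (N : ℝ) ^ 2) - θ * (∫ t in s..T, (numAtoms μ t - N)) ≤
      (∫ t in s..T, speedSq μ v t) + L * transportCost π := by
  have hmain := h.velocity.energy_lower_bound hL h.measurable h.sq_integrable h.atomic h.finite hs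
    hsat hsfin hνs hνT hπ.map_fst hπ.map_snd
  rw [hsN] at hmain
  have hN1 : (1 : ℝ) ≤ N := by exact_mod_cast hN
  have hsub : Ioo s T ⊆ Ioo (-T) T := Ioo_subset_Ioo_left hs.1.le
  have hσc : Continuous fun t => 1 / remTime L T t ^ 2 := continuous_const.div
    ((continuous_remTime L T).pow 2) fun t => (pow_pos (remTime_pos hL T t) 2).ne'
  have hn1 : IntervalIntegrable (numAtoms μ) volume s T := by
    rw [intervalIntegrable_iff_integrableOn_Ioo_of_le hs.2.le]
    exact hni.mono_set hsub
  have hn2 : IntervalIntegrable (fun t => numAtoms μ t - N) volume s T := hn1.sub (by simp)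
  have hge' : ∀ᵐ t ∂(volume.restrict (Ioc s T)), (N : ℝ) ≤ numAtoms μ t := by
    rw [← restrict_Ioo_eq_restrict_Ioc]
    exact ae_restrict_of_ae_restrict_of_subset hsub hge
  have hi : IntervalIntegrable
      (fun t => 1 / (12 * ((atoms (μ t)).ncard : ℝ) ^ 2) / remTime L T t ^ 2) volume s T := by
    rw [intervalIntegrable_iff_integrableOn_Ioc_of_le hs.2.le]
    have hm : AEMeasurable (numAtoms μ) (volume.restrict (Ioc s T)) := by
      have := hn1.aestronglyMeasurable.aemeasurable
      exact this
    have hm2 : AEMeasurable (fun t => 1 / (12 * numAtoms μ t ^ 2) / remTime L T t ^ 2)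
        (volume.restrict (Ioc s T)) :=
      (((hm.pow_const 2).const_mul 12).const_div 1).div
        ((continuous_remTime L T).pow 2).measurable.aemeasurable
    refine Integrable.mono' (hσc.integrableOn_Ioc) hm2.aestronglyMeasurable ?_
    filter_upwards [hge'] with t ht
    have hσ := remTime_pos hL T t
    rw [numAtoms] at ht
    rw [Real.norm_of_nonneg (by positivity)]
    gcongr
    have hn0 : (1 : ℝ) ≤ (atoms (μ t)).ncard := hN1.trans ht
    rw [div_le_one (by positivity)]
    nlinarith
  have h1 : ∫ t in s..T, (1 / (12 * (N : ℝ) ^ 2) * (1 / remTime L T t ^ 2) - θ * (numAtoms μ t - N)) ≤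
      ∫ t in s..T, 1 / (12 * ((atoms (μ t)).ncard : ℝ) ^ 2) / remTime L T t ^ 2 := by
    refine intervalIntegral.integral_mono_ae_restrict hs.2.le
      (((hσc.intervalIntegrable _ _).const_mul _).sub (hn2.const_mul _)) hi ?_
    rw [← Measure.restrict_congr_set Ioc_ae_eq_Icc]
    filter_upwards [hge'] with t ht
    exact atom_count_trade hN1 ht (remTime_pos hL T t) (one_div_remTime_le hL T t) hθ
  rw [intervalIntegral.integral_sub ((hσc.intervalIntegrable _ _).const_mul _) (hn2.const_mul _),
    intervalIntegral.integral_const_mul, intervalIntegral.integral_const_mul,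
    integral_inv_remTime_sq hL hs.2.le] at h1
  have e : 1 / (12 * (N : ℝ) ^ 2) / remTime L T s + 1 / (12 * (N : ℝ) ^ 2) * (L - 1 / remTime L T s) =
      L / (12 * (N : ℝ) ^ 2) := by
    ring
  unfold transportCost
  linarith

end half

/-! ### Time reversal. -/

/-- Time reversal of a curve of measures. -/
noncomputable def timeReverse (μ : Kernel ℝ Q) : Kernel ℝ Q := μ.comap (fun t => -t) measurable_neg

instance timeReverse_isMarkovKernel (μ : Kernel ℝ Q) [IsMarkovKernel μ] :
    IsMarkovKernel (timeReverse μ) := by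
  unfold timeReverse; infer_instance

lemma timeReverse_apply (μ : Kernel ℝ Q) (t : ℝ) : timeReverse μ t = μ (-t) := rfl

lemma measurePreserving_neg_Ioo (T : ℝ) : MeasurePreserving (fun t : ℝ => -t)
    (volume.restrict (Ioo (-T) T)) (volume.restrict (Ioo (-T) T)) := by
  have h := (Measure.measurePreserving_neg (volume : Measure ℝ)).restrict_preimage
    (measurableSet_Ioo (a := -T) (b := T))
  have e : (Neg.neg : ℝ → ℝ) ⁻¹' Ioo (-T) T = Ioo (-T) T := by
    ext t
    simp only [mem_preimage, mem_Ioo]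
    constructor <;> intro h <;> constructor <;> linarith [h.1, h.2]
  rwa [e] at h

/-- Time reversal of space-time. -/
def reverseEquiv : ℝ × Q ≃ᵐ ℝ × Q := (MeasurableEquiv.neg ℝ).prodCongr (MeasurableEquiv.refl Q)

lemma reverseEquiv_apply (z : ℝ × Q) : reverseEquiv z = (-z.1, z.2) := rfl

lemma spaceTime_timeReverse (T : ℝ) (μ : Kernel ℝ Q) [IsMarkovKernel μ] :
    spaceTime T (timeReverse μ) = (spaceTime T μ).map reverseEquiv := by
  ext A hA
  rw [reverseEquiv.map_apply, spaceTime, spaceTime, Measure.compProd_apply hA,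
    Measure.compProd_apply (reverseEquiv.measurable hA)]
  have hm : Measurable fun t => μ t (Prod.mk t ⁻¹' (reverseEquiv ⁻¹' A)) :=
    Kernel.measurable_kernel_prodMk_left (reverseEquiv.measurable hA)
  rw [← (measurePreserving_neg_Ioo T).lintegral_comp hm]
  refine lintegral_congr fun t => ?_
  rw [timeReverse_apply]
  congr 1
  ext x
  simp [reverseEquiv_apply]

lemma IsTrace.timeReverse {l l' : Filter ℝ} {μ : Kernel ℝ Q} {ν : ProbabilityMeasure Q}
    (h : IsTrace l μ ν) (hl : Tendsto (fun t : ℝ => -t) l' l) : IsTrace l' (timeReverse μ) ν := by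
  intro f
  have h1 : Tendsto (fun t : ℝ => -t) (l' ⊓ ae volume) (l ⊓ ae volume) :=
    (hl.mono_left inf_le_left).inf
      ((Measure.measurePreserving_neg (volume : Measure ℝ)).quasiMeasurePreserving.tendsto_ae) |>.mono_left
      (le_inf le_rfl inf_le_right)
  exact (h f).comp h1

lemma IsVelocity.timeReverse {T : ℝ} {μ : Kernel ℝ Q} [IsMarkovKernel μ] {v : ℝ × Q → ℝ}
    (h : IsVelocity T μ v) : IsVelocity T (timeReverse μ) fun z => -v (reverseEquiv z) where
  integrable := by
    rw [spaceTime_timeReverse, reverseEquiv.measurableEmbedding.integrable_map_iff]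
    refine h.integrable.neg.congr (ae_of_all _ fun z => ?_)
    simp [reverseEquiv_apply]
  continuity_eq := by
    intro φ hφ
    have hψ : IsTestFunction T fun z => φ (reverseEquiv z) := by
      refine ⟨hφ.smooth.comp (contDiff_fst.neg.prodMk contDiff_snd), ?_⟩
      have hc : Continuous fun z : ℝ × Q => (-z.1, z.2) := by fun_prop
      have h1 : tsupport (fun z => φ (reverseEquiv z)) ⊆ (fun z : ℝ × Q => (-z.1, z.2)) ⁻¹' tsupport φ :=
        tsupport_comp_subset_preimage φ hc
      intro z hz
      have h2 := hφ.support_subset (h1 hz)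
      exact ⟨⟨by linarith [h2.1.2], by linarith [h2.1.1]⟩, mem_univ _⟩
    have ht : ∀ z, timeDeriv (fun z => φ (reverseEquiv z)) z = -timeDeriv φ (reverseEquiv z) := by
      intro z
      exact deriv_comp_neg (fun s => φ (s, z.2)) z.1
    have hx : ∀ z, spaceDeriv (fun z => φ (reverseEquiv z)) z = spaceDeriv φ (reverseEquiv z) :=
      fun z => rfl
    have h1 := h.continuity_eq _ hψ
    simp only [ht, hx] at h1
    rw [spaceTime_timeReverse, reverseEquiv.measurableEmbedding.integral_map, ← neg_eq_zero,
      ← integral_neg, ← h1]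
    refine integral_congr_ae (ae_of_all _ fun z => ?_)
    have : reverseEquiv (reverseEquiv z) = z := by simp [reverseEquiv_apply]
    simp only [this]
    ring

lemma IsFiniteCurve.timeReverse {T : ℝ} {μ : Kernel ℝ Q} [IsMarkovKernel μ] {v : ℝ × Q → ℝ}
    (h : IsFiniteCurve T μ v) :
    IsFiniteCurve T (timeReverse μ) fun z => -v (reverseEquiv z) where
  measurable := (h.measurable.comp reverseEquiv.measurable).neg
  velocity := h.velocity.timeReverse
  sq_integrable := by
    rw [spaceTime_timeReverse, reverseEquiv.measurableEmbedding.integrable_map_iff]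
    refine h.sq_integrable.congr (ae_of_all _ fun z => ?_)
    simp [reverseEquiv_apply]
  atomic := (measurePreserving_neg_Ioo T).quasiMeasurePreserving.ae h.atomic
  finite := (measurePreserving_neg_Ioo T).quasiMeasurePreserving.ae h.finite

lemma speedSq_timeReverse (μ : Kernel ℝ Q) (v : ℝ × Q → ℝ) (t : ℝ) :
    speedSq (timeReverse μ) (fun z => -v (reverseEquiv z)) t = speedSq μ v (-t) := by
  simp [speedSq, timeReverse_apply, reverseEquiv_apply]

/-! ### Two-sided bounds. -/

section full

set_option linter.unusedSectionVars false

variable {L T : ℝ} {μ : Kernel ℝ Q} [IsMarkovKernel μ] {v : ℝ × Q → ℝ} {s : ℝ}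
  {ν₁ ν₂ : ProbabilityMeasure Q} {π₁ π₂ : Measure (Q × Q)} {N : ℕ}

lemma IsFiniteCurve.speedSq_integral_split (h : IsFiniteCurve T μ v) (hs : s ∈ Ioo (-T) T) :
    (∫ t in s..T, speedSq μ v t) + ∫ t in (-s)..T, speedSq μ v (-t) =
      ∫ t in Ioo (-T) T, speedSq μ v t := by
  have hi : IntegrableOn (speedSq μ v) (Ioo (-T) T) := integrable_integral_slice h.sq_integrable
  have hi' : IntervalIntegrable (speedSq μ v) volume (-T) T := by
    rwa [intervalIntegrable_iff_integrableOn_Ioo_of_le (by linarith [hs.1, hs.2])]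
  rw [intervalIntegral.integral_comp_neg (speedSq μ v), neg_neg, add_comm,
    intervalIntegral.integral_add_adjacent_intervals,
    intervalIntegral.integral_of_le (by linarith [hs.1, hs.2]), integral_Ioc_eq_integral_Ioo]
  · refine hi'.mono_set ?_
    rw [uIcc_of_le hs.1.le, uIcc_of_le (by linarith [hs.1, hs.2])]
    exact Icc_subset_Icc_right hs.2.le
  · refine hi'.mono_set ?_
    rw [uIcc_of_le hs.2.le, uIcc_of_le (by linarith [hs.1, hs.2])]
    exact Icc_subset_Icc_left hs.1.le

lemma numAtoms_integral_split (hni : IntegrableOn (numAtoms μ) (Ioo (-T) T)) (hs : s ∈ Ioo (-T) T) :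
    (∫ t in s..T, (numAtoms μ t - N)) + ∫ t in (-s)..T, (numAtoms (timeReverse μ) t - N) =
      ∫ t in Ioo (-T) T, (numAtoms μ t - N) := by
  have hi' : IntervalIntegrable (fun t => numAtoms μ t - N) volume (-T) T := by
    rw [intervalIntegrable_iff_integrableOn_Ioo_of_le (by linarith [hs.1, hs.2])]
    exact hni.sub (integrable_const _)
  have e : ∫ t in (-s)..T, (numAtoms (timeReverse μ) t - N) =
      ∫ t in (-s)..T, (fun t => numAtoms μ t - (N : ℝ)) (-t) := rfl
  rw [e, intervalIntegral.integral_comp_neg (fun t => numAtoms μ t - (N : ℝ)), neg_neg, add_comm,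
    intervalIntegral.integral_add_adjacent_intervals,
    intervalIntegral.integral_of_le (by linarith [hs.1, hs.2]), integral_Ioc_eq_integral_Ioo]
  · refine hi'.mono_set ?_
    rw [uIcc_of_le hs.1.le, uIcc_of_le (by linarith [hs.1, hs.2])]
    exact Icc_subset_Icc_right hs.2.le
  · refine hi'.mono_set ?_
    rw [uIcc_of_le hs.2.le, uIcc_of_le (by linarith [hs.1, hs.2])]
    exact Icc_subset_Icc_left hs.1.le

lemma isTrace_reverse_left (hνs : IsTrace (𝓝 s) μ ⟨μ s, inferInstance⟩) :
    IsTrace (𝓝[>] (-s)) (timeReverse μ) ⟨timeReverse μ (-s), inferInstance⟩ := by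
  have h1 : Tendsto (fun t : ℝ => -t) (𝓝[>] (-s)) (𝓝 s) := by
    have := (continuous_neg.tendsto (-s)).mono_left (nhdsWithin_le_nhds (s := Ioi (-s)))
    rwa [neg_neg] at this
  have h2 := hνs.timeReverse h1
  have e : (⟨timeReverse μ (-s), inferInstance⟩ : ProbabilityMeasure Q) = ⟨μ s, inferInstance⟩ := by
    apply Subtype.ext
    simp [timeReverse_apply]
  rwa [e]

/-- The two-sided energy bound from the smallest number of atoms, ignoring all other times. -/
lemma IsFiniteCurve.coarse_lower_bound (h : IsFiniteCurve T μ v) (hL : 0 < L)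
    (hs : s ∈ Ioo (-T) T) (hsat : IsPurelyAtomic (μ s)) (hsfin : (atoms (μ s)).Finite)
    (hsN : (atoms (μ s)).ncard = N) (hνs : IsTrace (𝓝 s) μ ⟨μ s, inferInstance⟩)
    (h1 : IsTrace (𝓝[<] T) μ ν₁) (hπ₁ : IsCoupling π₁ ν₁ volume)
    (h2 : IsTrace (𝓝[>] (-T)) μ ν₂) (hπ₂ : IsCoupling π₂ ν₂ volume) :
    1 / (6 * (N : ℝ) ^ 2) / (2 * T + 1 / L) ≤ (∫ t in Ioo (-T) T, speedSq μ v t) +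
      L * (transportCost π₁ + transportCost π₂) := by
  have hs' : -s ∈ Ioo (-T) T := ⟨by linarith [hs.2], by linarith [hs.1]⟩
  have b1 := h.coarse_lower_bound_above hL hs hsat hsfin hsN (hνs.mono nhdsWithin_le_nhds) h1 hπ₁
  -- The evolution before `s` is that of the reversed curve after `-s`.
  have b2 := h.timeReverse.coarse_lower_bound_above (N := N) hL hs'
    (by rwa [timeReverse_apply, neg_neg]) (by rwa [timeReverse_apply, neg_neg])
    (by rwa [timeReverse_apply, neg_neg]) (isTrace_reverse_left hνs)
    (h2.timeReverse (tendsto_neg_nhdsLT)) hπ₂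
  simp only [speedSq_timeReverse] at b2
  have e := h.speedSq_integral_split hs
  have e2 : 1 / (6 * (N : ℝ) ^ 2) / (2 * T + 1 / L) =
      1 / (12 * (N : ℝ) ^ 2) / (2 * T + 1 / L) + 1 / (12 * (N : ℝ) ^ 2) / (2 * T + 1 / L) := by
    ring
  linarith

/-- The two-sided energy bound, with an excess of atoms traded at rate `θ`. -/
lemma IsFiniteCurve.lower_bound (h : IsFiniteCurve T μ v) (hL : 0 < L)
    (hs : s ∈ Ioo (-T) T) (hsat : IsPurelyAtomic (μ s)) (hsfin : (atoms (μ s)).Finite)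
    (hsN : (atoms (μ s)).ncard = N) (hνs : IsTrace (𝓝 s) μ ⟨μ s, inferInstance⟩)
    (h1 : IsTrace (𝓝[<] T) μ ν₁) (hπ₁ : IsCoupling π₁ ν₁ volume)
    (h2 : IsTrace (𝓝[>] (-T)) μ ν₂) (hπ₂ : IsCoupling π₂ ν₂ volume) (hN : 0 < N)
    (hge : ∀ᵐ t ∂(volume.restrict (Ioo (-T) T)), (N : ℝ) ≤ numAtoms μ t)
    (hni : IntegrableOn (numAtoms μ) (Ioo (-T) T)) {θ : ℝ} (hθ : L ^ 2 ≤ 6 * θ * (N : ℝ) ^ 3) :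
    L / (6 * (N : ℝ) ^ 2) - θ * (∫ t in Ioo (-T) T, (numAtoms μ t - N)) ≤
      (∫ t in Ioo (-T) T, speedSq μ v t) + L * (transportCost π₁ + transportCost π₂) := by
  have hs' : -s ∈ Ioo (-T) T := ⟨by linarith [hs.2], by linarith [hs.1]⟩
  have b1 := h.lower_bound_above hL hs hsat hsfin hsN (hνs.mono nhdsWithin_le_nhds) h1 hπ₁ hN hge
    hni hθ
  have hni' : IntegrableOn (numAtoms (ProbabilityTheory.Kernel.comap μ (fun t => -t) measurable_neg))
      (Ioo (-T) T) :=
    (measurePreserving_neg_Ioo T).integrable_comp_of_integrable hni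
  have b2 := h.timeReverse.lower_bound_above (N := N) hL hs'
    (by rwa [timeReverse_apply, neg_neg]) (by rwa [timeReverse_apply, neg_neg])
    (by rwa [timeReverse_apply, neg_neg]) (isTrace_reverse_left hνs)
    (h2.timeReverse (tendsto_neg_nhdsLT)) hπ₂ hN
    ((measurePreserving_neg_Ioo T).quasiMeasurePreserving.ae hge) hni' hθ
  simp only [speedSq_timeReverse] at b2
  have e := h.speedSq_integral_split hs
  have e' := numAtoms_integral_split (N := N) hni hs
  have e2 : L / (6 * (N : ℝ) ^ 2) = L / (12 * (N : ℝ) ^ 2) + L / (12 * (N : ℝ) ^ 2) := by ring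
  rw [← e', mul_add]
  linarith

end full

/-! ### Equality in the quantization bound. -/

lemma IsCoupling.isProbabilityMeasure {π : Measure (Q × Q)} {ν₁ ν₂ : Measure Q}
    [IsProbabilityMeasure ν₁] (h : IsCoupling π ν₁ ν₂) : IsProbabilityMeasure π := by
  constructor
  have : π.map Prod.fst univ = 1 := by rw [h.map_fst]; exact measure_univ
  rwa [Measure.map_apply measurable_fst MeasurableSet.univ, preimage_univ] at this

lemma integrable_of_continuous_prod {π : Measure (Q × Q)} [IsProbabilityMeasure π] {f : Q × Q → ℝ}
    (hf : Continuous f) : Integrable f π :=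
  hf.integrable_of_hasCompactSupport (HasCompactSupport.of_compactSpace _)

/-- The squared distance to the atoms of `ν`. -/
noncomputable def atomDistSq (ν : Measure Q) (y : Q) : ℝ :=
  sliceDistSq (Kernel.const ℝ ν) Prod.snd 0 y

section equality

set_option linter.unusedSectionVars false

variable {ν : Measure Q} [IsProbabilityMeasure ν]

lemma continuous_atomDistSq (ν : Measure Q) [IsProbabilityMeasure ν] :
    Continuous (atomDistSq ν) :=
  (sliceDistSq_lipschitz (μ := Kernel.const ℝ ν) (θ := Prod.snd) 0).continuous

lemma atomDistSq_le {x : Q} (hx : x ∈ atoms ν) (y : Q) : atomDistSq ν y ≤ ‖x - y‖ ^ 2 :=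
  sliceDistSq_le (μ := Kernel.const ℝ ν) (θ := Prod.snd) (t := 0) hx y

lemma exists_atom_le_atomDistSq (hfin : (atoms ν).Finite) (hat : ν (atoms ν)ᶜ = 0) (y : Q) :
    ∃ x ∈ atoms ν, ‖x - y‖ ^ 2 ≤ atomDistSq ν y :=
  exists_atom_le_sliceDistSq (μ := Kernel.const ℝ ν) (θ := Prod.snd) (t := 0) hfin hat y

lemma IsCoupling.ae_fst_mem_atoms {π : Measure (Q × Q)} {ν' : Measure Q} (h : IsCoupling π ν ν')
    (hat : ν (atoms ν)ᶜ = 0) : ∀ᵐ p ∂π, p.1 ∈ atoms ν := by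
  have : ∀ᵐ x ∂(π.map Prod.fst), x ∈ atoms ν := by rw [h.map_fst]; exact hat
  exact ae_of_ae_map measurable_fst.aemeasurable this

lemma IsCoupling.integral_snd {π : Measure (Q × Q)} (h : IsCoupling π ν volume) {f : Q → ℝ}
    (hf : Continuous f) : ∫ p, f p.2 ∂π = ∫ y, f y := by
  rw [← h.map_snd, integral_map measurable_snd.aemeasurable hf.aestronglyMeasurable]

lemma IsCoupling.integral_atomDistSq_le {π : Measure (Q × Q)} (h : IsCoupling π ν volume)
    (hat : ν (atoms ν)ᶜ = 0) : ∫ y, atomDistSq ν y ≤ transportCost π := by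
  have := h.isProbabilityMeasure
  rw [← h.integral_snd (continuous_atomDistSq ν)]
  refine integral_mono_ae
    (integrable_of_continuous_prod ((continuous_atomDistSq ν).comp continuous_snd))
    (integrable_of_continuous_prod (by fun_prop)) ?_
  filter_upwards [h.ae_fst_mem_atoms hat] with p hp
  exact atomDistSq_le hp p.2

/-- If the quantization bound is attained, the squared distance is the sum of paraboloids. -/
lemma atomDistSq_eq_of_integral_le (hfin : (atoms ν).Finite) (hat : ν (atoms ν)ᶜ = 0) {N : ℕ}
    (hN : (atoms ν).ncard = N) (hN0 : 0 < N)
    (hle : ∫ y, atomDistSq ν y ≤ 1 / (12 * (N : ℝ) ^ 2)) {a : ℝ} (ha : a = 1 / (2 * N)) (y : Q) :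
    atomDistSq ν y = a ^ 2 - ∑ q ∈ hfin.toFinset, max (a ^ 2 - ‖y - q‖ ^ 2) 0 := by
  have hN' : (0 : ℝ) < N := by exact_mod_cast hN0
  have hN1 : (1 : ℝ) ≤ N := by exact_mod_cast hN0
  have ha0 : 0 < a := by rw [ha]; positivity
  have ha1 : a ≤ 1 / 2 := by
    rw [ha, div_le_div_iff₀ (by positivity) (by norm_num)]; linarith
  -- The defect of the Voronoi bound is continuous and nonnegative, and its integral is at most
  -- zero, so it vanishes identically.
  set δ : Q → ℝ := fun y =>
    atomDistSq ν y - (a ^ 2 - ∑ q ∈ hfin.toFinset, max (a ^ 2 - ‖y - q‖ ^ 2) 0) with hδ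
  have hDc := continuous_atomDistSq ν
  have hδc : Continuous δ := by fun_prop
  have hδ0 : ∀ y, 0 ≤ δ y := by
    intro y
    obtain ⟨x, hx, hxy⟩ := exists_atom_le_atomDistSq hfin hat y
    have := sub_sum_hat_le hfin.toFinset a (hfin.mem_toFinset.2 hx) y
    rw [norm_sub_rev] at hxy
    simp only [hδ]
    linarith
  have hint : ∫ y, δ y ≤ 0 := by
    simp only [hδ]
    rw [integral_sub (circle_continuous_integrable hDc)
      (circle_continuous_integrable (by fun_prop)), integral_sub_sum_hat _ ha0.le ha1,
      ← Set.ncard_eq_toFinset_card _ hfin, hN]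
    have : a ^ 2 - N * (4 * a ^ 3 / 3) = 1 / (12 * (N : ℝ) ^ 2) := by
      rw [ha]; field_simp; norm_num
    linarith
  have hzero : ∫ y, δ y = 0 := le_antisymm hint (integral_nonneg hδ0)
  have hae := (integral_eq_zero_iff_of_nonneg hδ0 (circle_continuous_integrable hδc)).1 hzero
  have hfun : δ = 0 := (hδc.ae_eq_iff_eq volume continuous_const).1 hae
  have := congrFun hfun y
  simp only [hδ, Pi.zero_apply] at this
  linarith

variable {N : ℕ} {a : ℝ}

/-- The paraboloids are nonnegative, so the squared distance never exceeds `a ^ 2`: the closed balls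
of radius `a` cover the circle. -/
lemma exists_atom_norm_le (hfin : (atoms ν).Finite) (hat : ν (atoms ν)ᶜ = 0) (ha0 : 0 < a)
    (hD : ∀ y, atomDistSq ν y = a ^ 2 - ∑ q ∈ hfin.toFinset, max (a ^ 2 - ‖y - q‖ ^ 2) 0) (y : Q) :
    ∃ q ∈ atoms ν, ‖y - q‖ ≤ a := by
  obtain ⟨q, hq, hqy⟩ := exists_atom_le_atomDistSq hfin hat y
  refine ⟨q, hq, ?_⟩
  rw [hD y, norm_sub_rev] at hqy
  have : 0 ≤ ∑ q ∈ hfin.toFinset, max (a ^ 2 - ‖y - q‖ ^ 2) 0 :=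
    Finset.sum_nonneg fun _ _ => le_max_right _ _
  exact abs_le_of_sq_le_sq' (by linarith) ha0.le |>.2

/-- If two paraboloids were positive at `y`, the formula would fall strictly below the squared
distance to the nearest atom: the open balls of radius `a` are disjoint. -/
lemma not_two_atoms_near (hfin : (atoms ν).Finite) (hat : ν (atoms ν)ᶜ = 0)
    (hD : ∀ y, atomDistSq ν y = a ^ 2 - ∑ q ∈ hfin.toFinset, max (a ^ 2 - ‖y - q‖ ^ 2) 0)
    {p p' : Q} (hp : p ∈ atoms ν) (hp' : p' ∈ atoms ν) (hne : p ≠ p') (y : Q)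
    (hy : ‖y - p‖ < a) (hy' : ‖y - p'‖ < a) : False := by
  classical
  obtain ⟨q, hq, hqy⟩ := exists_atom_le_atomDistSq hfin hat y
  have hqD : ∀ r ∈ atoms ν, ‖y - q‖ ^ 2 ≤ ‖y - r‖ ^ 2 := fun r hr => by
    have := atomDistSq_le hr y
    rw [norm_sub_rev r y] at this
    rw [norm_sub_rev q y] at hqy
    linarith
  have key : ∀ r ∈ atoms ν, r ≠ q → ‖y - r‖ < a → False := by
    intro r hr hrq hra
    have h1 : ∑ x ∈ ({q, r} : Finset Q), max (a ^ 2 - ‖y - x‖ ^ 2) 0 ≤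
        ∑ x ∈ hfin.toFinset, max (a ^ 2 - ‖y - x‖ ^ 2) 0 := by
      refine Finset.sum_le_sum_of_subset_of_nonneg ?_ fun _ _ _ => le_max_right _ _
      intro x hx
      simp only [Finset.mem_insert, Finset.mem_singleton] at hx
      rcases hx with rfl | rfl
      · exact hfin.mem_toFinset.2 hq
      · exact hfin.mem_toFinset.2 hr
    rw [Finset.sum_pair hrq.symm] at h1
    have h2 := le_max_left (a ^ 2 - ‖y - q‖ ^ 2) 0
    have h3 := le_max_left (a ^ 2 - ‖y - r‖ ^ 2) 0
    rw [hD y, norm_sub_rev] at hqy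
    have h4 : ‖y - r‖ ^ 2 < a ^ 2 := by gcongr
    linarith
  by_cases h : p = q
  · exact key p' hp' (fun h' => hne (h.trans h'.symm)) hy'
  · exact key p hp h hy

lemma two_mul_le_norm_sub_atoms (hfin : (atoms ν).Finite) (hat : ν (atoms ν)ᶜ = 0)
    (hD : ∀ y, atomDistSq ν y = a ^ 2 - ∑ q ∈ hfin.toFinset, max (a ^ 2 - ‖y - q‖ ^ 2) 0)
    {p p' : Q} (hp : p ∈ atoms ν) (hp' : p' ∈ atoms ν) (hne : p ≠ p') : 2 * a ≤ ‖p' - p‖ := by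
  by_contra hlt
  rw [not_le] at hlt
  obtain ⟨ξ, hξ, hξn⟩ := circle_exists_rep (p' - p)
  have hhalf : |ξ / 2| < a := by rw [abs_div, abs_two]; linarith
  refine not_two_atoms_near hfin hat hD hp hp' hne (p + ((ξ / 2 : ℝ) : Q)) ?_ ?_
  · rw [add_sub_cancel_left]
    exact (circle_norm_coe_le _).trans_lt hhalf
  · have : p + ((ξ / 2 : ℝ) : Q) - p' = ((-(ξ / 2) : ℝ) : Q) := by
      have h1 : p' = p + (ξ : Q) := by rw [hξ]; abel
      rw [h1, add_sub_add_left_eq_sub, ← AddCircle.coe_sub]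
      congr 1
      ring
    rw [this]
    refine (circle_norm_coe_le _).trans_lt ?_
    rwa [abs_neg]

/-- Points just beyond `p + a` are out of reach of `p`, so by covering and finiteness another atom
lies within `a` of `p + a`; separation by `2 a` pushes it to `p + 2 a`. With `a ≤ 1 / 4` all arcs
involved have length at most `1 / 2`, where the circle norm is the length. -/
lemma atom_add_mem (hfin : (atoms ν).Finite) (hat : ν (atoms ν)ᶜ = 0) (ha0 : 0 < a)
    (ha : a ≤ 1 / 4)
    (hD : ∀ y, atomDistSq ν y = a ^ 2 - ∑ q ∈ hfin.toFinset, max (a ^ 2 - ‖y - q‖ ^ 2) 0)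
    {p : Q} (hp : p ∈ atoms ν) : p + ((2 * a : ℝ) : Q) ∈ atoms ν := by
  obtain ⟨p', hp', hne, hle⟩ : ∃ p' ∈ atoms ν, p' ≠ p ∧ ‖p + (a : Q) - p'‖ ≤ a := by
    by_contra hcon
    push Not at hcon
    have h1 : ∀ᶠ η in 𝓝[>] (0 : ℝ), ∀ p' ∈ atoms ν, p' ≠ p → a + η < ‖p + (a : Q) - p'‖ := by
      refine (Filter.eventually_all_finite hfin).2 fun p' hp' => ?_
      by_cases hne : p' = p
      · exact Eventually.of_forall fun η h => absurd hne h
      · have h2 := hcon p' hp' hne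
        have h3 : ∀ᶠ η in 𝓝[>] (0 : ℝ), η < ‖p + (a : Q) - p'‖ - a :=
          nhdsWithin_le_nhds (Iio_mem_nhds (by linarith))
        filter_upwards [h3] with η hη _
        linarith
    have h4 : ∀ᶠ η in 𝓝[>] (0 : ℝ), η < a := nhdsWithin_le_nhds (Iio_mem_nhds ha0)
    obtain ⟨η, ⟨h5, h6⟩, hη⟩ := ((h1.and h4).and self_mem_nhdsWithin).exists
    have hη : 0 < η := hη
    obtain ⟨q, hq, hqy⟩ := exists_atom_norm_le hfin hat ha0 hD (p + (a : Q) + (η : Q))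
    by_cases hqp : q = p
    · rw [hqp, add_assoc, add_sub_cancel_left, ← AddCircle.coe_add, circle_norm_coe_eq, abs_of_pos]
        at hqy
      · linarith
      · linarith
      · rw [abs_of_pos] <;> linarith
    · have h7 := h5 q hq hqp
      have h8 : p + (a : Q) - q = p + (a : Q) + (η : Q) - q - (η : Q) := by abel
      have h9 := norm_sub_le (p + (a : Q) + (η : Q) - q) (η : Q)
      have h10 := circle_norm_coe_le η
      rw [abs_of_pos hη] at h10
      rw [h8] at h7
      linarith
  obtain ⟨u, hu, hun⟩ := circle_exists_rep (p' - (p + (a : Q)))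
  rw [norm_sub_rev, ← hun] at hle
  have hu' := abs_le.1 hle
  have hpp : p' - p = ((a + u : ℝ) : Q) := by rw [AddCircle.coe_add, hu]; abel
  have h2 := two_mul_le_norm_sub_atoms hfin hat hD hp hp' hne.symm
  rw [hpp, circle_norm_coe_eq, abs_of_nonneg] at h2
  · have hua : u = a := by linarith
    have : p + ((2 * a : ℝ) : Q) = p' := by
      rw [two_mul]
      nth_rewrite 2 [← hua]
      rw [← hpp]; abel
    rwa [this]
  · linarith
  · rw [abs_of_nonneg] <;> linarith

/-- In the equality case, each atom has at least the mass of its Voronoi cell. -/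
lemma le_measureReal_atom (hfin : (atoms ν).Finite) (hat : ν (atoms ν)ᶜ = 0) (hN0 : 0 < N)
    (h : ∀ η > 0, ∃ π, IsCoupling π ν volume ∧ transportCost π ≤ 1 / (12 * (N : ℝ) ^ 2) + η)
    (ha : a = 1 / (2 * N)) (hint : 1 / (12 * (N : ℝ) ^ 2) ≤ ∫ y, atomDistSq ν y)
    (hD : ∀ y, atomDistSq ν y = a ^ 2 - ∑ q ∈ hfin.toFinset, max (a ^ 2 - ‖y - q‖ ^ 2) 0)
    {p : Q} (hp : p ∈ atoms ν) : 2 * a ≤ ν.real {p} := by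
  have hN' : (0 : ℝ) < N := by exact_mod_cast hN0
  have hN1 : (1 : ℝ) ≤ N := by exact_mod_cast hN0
  have ha0 : 0 < a := by rw [ha]; positivity
  have ha1 : a ≤ 1 / 2 := by
    rw [ha, div_le_div_iff₀ (by positivity) (by norm_num)]; linarith
  have key : ∀ η, 0 < η → η < a → 2 * a - 3 * η ≤ ν.real {p} := by
    intro η hη hηa
    -- Mass sent into the ball of radius `a - η` around `p` from another atom costs at least `(a +
    -- η) ^ 2 - (a - η) ^ 2 = 4 a η` more than the squared distance. A total excess of `4 a η * η`
    -- allows at most mass `η` of this kind.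
    obtain ⟨π, hπ, hcost⟩ := h (4 * a * η * η) (by positivity)
    have := hπ.isProbabilityMeasure
    set B := Metric.closedBall p (a - η) with hB
    set E : Set (Q × Q) := {z | z.1 ≠ p ∧ z.2 ∈ B} with hE
    have hEm : MeasurableSet E :=
      (measurable_fst (measurableSet_singleton p).compl).inter
        (measurable_snd Metric.isClosed_closedBall.measurableSet)
    have hi1 : Integrable (fun z : Q × Q => ‖z.1 - z.2‖ ^ 2) π :=
      integrable_of_continuous_prod (by fun_prop)
    have hi2 : Integrable (fun z : Q × Q => atomDistSq ν z.2) π :=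
      integrable_of_continuous_prod ((continuous_atomDistSq ν).comp continuous_snd)
    have hex : 4 * a * η * π.real E ≤ ∫ z, (‖z.1 - z.2‖ ^ 2 - atomDistSq ν z.2) ∂π := by
      have e : 4 * a * η * π.real E = ∫ z, E.indicator (fun _ => 4 * a * η) z ∂π := by
        rw [integral_indicator_const _ hEm, smul_eq_mul, mul_comm]
      rw [e]
      refine integral_mono_ae ((integrable_const _).indicator hEm) (hi1.sub hi2) ?_
      filter_upwards [hπ.ae_fst_mem_atoms hat] with z hz
      by_cases hzE : z ∈ E
      · rw [indicator_of_mem hzE]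
        have h1 := two_mul_le_norm_sub_atoms hfin hat hD hp hz (Ne.symm hzE.1)
        have h2 : ‖z.2 - p‖ ≤ a - η := by
          have := hzE.2
          rwa [hB, Metric.mem_closedBall, dist_eq_norm] at this
        have h3 := atomDistSq_le hp z.2
        rw [norm_sub_rev] at h3
        have h4 : ‖z.1 - p‖ ≤ ‖z.1 - z.2‖ + ‖z.2 - p‖ := norm_sub_le_norm_sub_add_norm_sub _ _ _
        have h5 : (a + η) ^ 2 ≤ ‖z.1 - z.2‖ ^ 2 := by
          have : a + η ≤ ‖z.1 - z.2‖ := by linarith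
          gcongr
        have h6 : ‖z.2 - p‖ ^ 2 ≤ (a - η) ^ 2 := by gcongr
        nlinarith
      · rw [indicator_of_notMem hzE]
        exact sub_nonneg.2 (atomDistSq_le hz z.2)
    rw [integral_sub hi1 hi2, hπ.integral_snd (continuous_atomDistSq ν)] at hex
    have hcost' : ∫ z, ‖z.1 - z.2‖ ^ 2 ∂π ≤ 1 / (12 * (N : ℝ) ^ 2) + 4 * a * η * η := hcost
    have hEη : π.real E ≤ η := by
      have : 4 * a * η * π.real E ≤ 4 * a * η * η := by linarith
      exact le_of_mul_le_mul_left this (by positivity)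
    have hvol : π.real (Prod.snd ⁻¹' B) = 2 * (a - η) := by
      rw [measureReal_def, ← Measure.map_apply measurable_snd Metric.isClosed_closedBall.measurableSet,
        hπ.map_snd, AddCircle.volume_closedBall, ENNReal.toReal_ofReal, min_eq_right]
      · linarith
      · exact le_min zero_le_one (by linarith)
    have hfst : π.real (Prod.fst ⁻¹' {p}) = ν.real {p} := by
      rw [measureReal_def, ← Measure.map_apply measurable_fst (measurableSet_singleton p), hπ.map_fst,
        measureReal_def]
    have hsub : Prod.snd ⁻¹' B ⊆ E ∪ Prod.fst ⁻¹' {p} := by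
      intro z hz
      by_cases hzp : z.1 = p
      · exact Or.inr hzp
      · exact Or.inl ⟨hzp, hz⟩
    have hle := (measureReal_mono hsub (μ := π)).trans (measureReal_union_le E (Prod.fst ⁻¹' {p}))
    rw [hvol, hfst] at hle
    linarith
  by_contra hlt
  rw [not_le] at hlt
  have h1 := key (min (a / 2) ((2 * a - ν.real {p}) / 6)) (lt_min (by linarith) (by linarith))
    ((min_le_left _ _).trans_lt (by linarith))
  have h2 := min_le_right (a / 2) ((2 * a - ν.real {p}) / 6)
  linarith

lemma injOn_equidistant (hN0 : 0 < N) (x₀ : Q) :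
    InjOn (fun i : ℕ => x₀ + (((i : ℝ) / N : ℝ) : Q)) (Finset.range N : Set ℕ) := by
  intro i hi j hj hij
  have hN' : (0 : ℝ) < N := by exact_mod_cast hN0
  have hmem : ∀ k ∈ (Finset.range N : Set ℕ), (k : ℝ) / N ∈ Ico (0 : ℝ) (0 + 1) := by
    intro k hk
    have : (k : ℝ) < N := by exact_mod_cast Finset.mem_range.1 (Finset.mem_coe.1 hk)
    exact ⟨by positivity, by rw [zero_add, div_lt_one hN']; exact this⟩
  have h1 := add_left_cancel hij
  have h2 := (AddCircle.coe_eq_coe_iff_of_mem_Ico (hmem i hi) (hmem j hj)).1 h1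
  have h3 : (i : ℝ) = j := by
    field_simp at h2
    exact h2
  exact_mod_cast h3

/-- The only measures with `N` atoms which attain the quantization bound are the equidistant ones. -/
theorem eq_equidistant_of_transportCost_le (hfin : (atoms ν).Finite) (hat : ν (atoms ν)ᶜ = 0)
    (hN : (atoms ν).ncard = N)
    (h : ∀ η > 0, ∃ π, IsCoupling π ν volume ∧ transportCost π ≤ 1 / (12 * (N : ℝ) ^ 2) + η) :
    ∃ x₀, ν = equidistant N x₀ := by
  classical
  have hN0 : 0 < N := hN ▸ ncard_atoms_pos hfin hat
  have hN' : (0 : ℝ) < N := by exact_mod_cast hN0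
  obtain ⟨a, ha⟩ : ∃ a : ℝ, a = 1 / (2 * N) := ⟨_, rfl⟩
  have ha0 : 0 < a := by rw [ha]; positivity
  have h2a : 2 * a = 1 / N := by rw [ha]; field_simp
  have hle : ∫ y, atomDistSq ν y ≤ 1 / (12 * (N : ℝ) ^ 2) := by
    refine le_of_forall_pos_le_add fun η hη => ?_
    obtain ⟨π, hπ, hcost⟩ := h η hη
    exact (hπ.integral_atomDistSq_le hat).trans hcost
  have hge : 1 / (12 * (N : ℝ) ^ 2) ≤ ∫ y, atomDistSq ν y := by
    have := le_circleMean_sliceDistMap (μ := Kernel.const ℝ ν) Prod.snd (t := 0) hfin hat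
    rw [Kernel.const_apply, hN] at this
    exact this
  have hD := atomDistSq_eq_of_integral_le hfin hat hN hN0 hle ha
  have hcard : hfin.toFinset.card = N := by rw [← Set.ncard_eq_toFinset_card _ hfin, hN]
  obtain ⟨x₀, hx₀⟩ : (atoms ν).Nonempty := (Set.ncard_pos hfin).1 (hN ▸ hN0)
  have hstep : ∀ p ∈ atoms ν, p + ((1 / N : ℝ) : Q) ∈ atoms ν := by
    intro p hp
    rcases Nat.lt_or_ge 1 N with h1 | h1
    · rw [← h2a]
      refine atom_add_mem hfin hat ha0 ?_ hD hp
      have : (2 : ℝ) ≤ N := by exact_mod_cast h1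
      rw [ha, div_le_div_iff₀ (by positivity) (by norm_num)]
      linarith
    -- For one atom `a = 1 / 2` is too large for `atom_add_mem`, but the step is a full period.
    · have : N = 1 := by omega
      rw [this, Nat.cast_one, div_one, AddCircle.coe_period, add_zero]
      exact hp
  have hall : ∀ i : ℕ, x₀ + (((i : ℝ) / N : ℝ) : Q) ∈ atoms ν := by
    intro i
    induction i with
    | zero => simpa using hx₀
    | succ i ih =>
      have := hstep _ ih
      rwa [add_assoc, ← AddCircle.coe_add, ← add_div, ← Nat.cast_succ] at this
  have himage : (Finset.range N).image (fun i : ℕ => x₀ + (((i : ℝ) / N : ℝ) : Q)) =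
      hfin.toFinset := by
    refine Finset.eq_of_subset_of_card_le (fun x hx => ?_) ?_
    · obtain ⟨i, -, rfl⟩ := Finset.mem_image.1 hx
      exact hfin.mem_toFinset.2 (hall i)
    · rw [Finset.card_image_of_injOn (injOn_equidistant hN0 x₀), hcard, Finset.card_range]
  -- `N` masses, each at least `1 / N` and of total one, are all equal to `1 / N`.
  have hmass : ∀ p ∈ hfin.toFinset, ν.real {p} = 1 / N := by
    have hsum : ∑ p ∈ hfin.toFinset, (1 / N : ℝ) = ∑ p ∈ hfin.toFinset, ν.real {p} := by
      rw [Finset.sum_const, hcard, nsmul_eq_mul, mul_one_div_cancel hN'.ne',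
        sum_measureReal_singleton, measureReal_def, hfin.coe_toFinset,
        (prob_compl_eq_zero_iff hfin.measurableSet).1 hat, ENNReal.toReal_one]
    have hles : ∀ p ∈ hfin.toFinset, (1 / N : ℝ) ≤ ν.real {p} := fun p hp => by
      rw [← h2a]
      exact le_measureReal_atom hfin hat hN0 h ha hge hD (hfin.mem_toFinset.1 hp)
    intro p hp
    exact ((Finset.sum_eq_sum_iff_of_le hles).1 hsum p hp).symm
  refine ⟨x₀, ?_⟩
  ext A hA
  have h1 : ν A = ∑ p ∈ hfin.toFinset with p ∈ A, ν {p} := by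
    rw [sum_measure_singleton]
    refine measure_congr ?_
    have : ∀ᵐ x ∂ν, x ∈ atoms ν := hat
    filter_upwards [this] with x hx
    refine propext ⟨fun hxA => ?_, fun hxA => ?_⟩
    · exact Finset.mem_coe.2 (Finset.mem_filter.2 ⟨hfin.mem_toFinset.2 hx, hxA⟩)
    · exact (Finset.mem_filter.1 (Finset.mem_coe.1 hxA)).2
  have h2 : ∀ p ∈ hfin.toFinset, ν {p} = (N : ℝ≥0∞)⁻¹ := by
    intro p hp
    rw [← ENNReal.ofReal_toReal (measure_ne_top ν {p}), ← measureReal_def, hmass p hp, one_div,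
      ENNReal.ofReal_inv_of_pos hN', ENNReal.ofReal_natCast]
  rw [h1, Finset.sum_filter, ← himage, Finset.sum_image (injOn_equidistant hN0 x₀)]
  simp only [equidistant, Measure.coe_finsetSum, Finset.sum_apply, Measure.smul_apply, smul_eq_mul]
  refine Finset.sum_congr rfl fun i hi => ?_
  have hi' := himage ▸ Finset.mem_image_of_mem (fun i : ℕ => x₀ + (((i : ℝ) / N : ℝ) : Q)) hi
  rw [Measure.dirac_apply' _ hA, h2 _ hi', indicator_apply]
  simp

end equality

/-! ### Curves of vanishing kinetic energy. -/

/-- A curve of arbitrarily small kinetic energy is constant. -/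
lemma ae_slice_eq_of_small_velocity {T : ℝ} {μ : Kernel ℝ Q} [IsMarkovKernel μ]
    (h : ∀ η : ℝ, 0 < η → ∃ v, IsVelocity T μ v ∧ Integrable (fun z => v z ^ 2) (spaceTime T μ) ∧
      ∫ t in Ioo (-T) T, speedSq μ v t ≤ η) :
    ∃ S : Set ℝ, (∀ᵐ t ∂(volume.restrict (Ioo (-T) T)), t ∈ S) ∧
      ∀ a ∈ S, ∀ b ∈ S, μ a = μ b := by
  obtain ⟨f, hfL, hfd⟩ := exists_dense_lipschitz
  choose K hK using hfL
  -- Testing with `f / (m + 1)` makes the Lipschitz error as small as this kinetic energy, of order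
  -- `(m + 1)⁻²`. Dividing out one factor `1 / (m + 1)` leaves a bound tending to zero.
  choose v hv hv2 hsmall using fun m : ℕ => h ((1 / ((m : ℝ) + 1)) ^ 2) (by positivity)
  have hLip : ∀ k m : ℕ, LipschitzWith (Real.toNNReal (1 / ((m : ℝ) + 1)) * K k)
      (fun x => (1 / ((m : ℝ) + 1)) * f k x) := fun k m => by
    refine LipschitzWith.of_dist_le_mul fun x y => ?_
    have hp : (0 : ℝ) ≤ 1 / ((m : ℝ) + 1) := by positivity
    rw [Real.dist_eq, ← mul_sub, abs_mul, abs_of_nonneg hp, NNReal.coe_mul, Real.coe_toNNReal _ hp,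
      mul_assoc]
    exact mul_le_mul_of_nonneg_left ((hK k).dist_le_mul x y) hp
  choose S hS hSae hSle using fun k m => (hv m).exists_ae_abs_sub_le (hv2 m) (hLip k m)
  refine ⟨⋂ k, ⋂ m, S k m, ?_, ?_⟩
  · filter_upwards [ae_all_iff.2 fun k => ae_all_iff.2 (hSae k)] with t ht
    simpa using ht
  have key : ∀ a ∈ ⋂ k, ⋂ m, S k m, ∀ b ∈ ⋂ k, ⋂ m, S k m, a < b →
      ∀ k, ∫ x, f k x ∂(μ a) = ∫ x, f k x ∂(μ b) := by
    intro a ha b hb hab k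
    simp only [mem_iInter] at ha hb
    have haI := hS k 0 (ha k 0)
    have hbI := hS k 0 (hb k 0)
    have hbound : ∀ m : ℕ, |∫ x, f k x ∂(μ a) - ∫ x, f k x ∂(μ b)| ≤
        (1 + (b - a) * (K k : ℝ) ^ 2 / 4) * (1 / ((m : ℝ) + 1)) := by
      intro m
      have h1 := hSle k m a (ha k m) b (hb k m) hab
      have hp : (0 : ℝ) < 1 / ((m : ℝ) + 1) := by positivity
      have hint : IntegrableOn (speedSq μ (v m)) (Ioo (-T) T) := integrable_integral_slice (hv2 m)
      have hsub : Ioc a b ⊆ Ioo (-T) T := fun t ht => ⟨haI.1.trans ht.1, ht.2.trans_lt hbI.2⟩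
      have h2 : ∫ t in a..b, speedSq μ (v m) t ≤ (1 / ((m : ℝ) + 1)) ^ 2 := by
        rw [intervalIntegral.integral_of_le hab.le]
        exact (setIntegral_mono_set hint (ae_of_all _ fun t => speedSq_nonneg μ (v m) t)
          (ae_of_all _ hsub)).trans (hsmall m)
      rw [intervalIntegral.integral_add ((intervalIntegrable_iff_integrableOn_Ioc_of_le hab.le).2 (hint.mono_set hsub))
        intervalIntegrable_const, intervalIntegral.integral_const] at h1
      simp only [integral_const_mul, ← mul_sub, abs_mul, abs_of_pos hp, NNReal.coe_mul,
        Real.coe_toNNReal _ hp.le, smul_eq_mul] at h1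
      have h3 : 1 / ((m : ℝ) + 1) * |∫ x, f k x ∂(μ a) - ∫ x, f k x ∂(μ b)| ≤
          1 / ((m : ℝ) + 1) * ((1 + (b - a) * (K k : ℝ) ^ 2 / 4) * (1 / ((m : ℝ) + 1))) := by
        calc _ ≤ _ := h1
          _ ≤ (1 / ((m : ℝ) + 1)) ^ 2 + (b - a) * ((1 / ((m : ℝ) + 1) * (K k : ℝ)) ^ 2 / 4) := by
            gcongr
          _ = _ := by ring
      exact le_of_mul_le_mul_left h3 hp
    have hlim := (tendsto_one_div_add_atTop_nhds_zero_nat (𝕜 := ℝ)).const_mul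
      (1 + (b - a) * (K k : ℝ) ^ 2 / 4)
    rw [mul_zero] at hlim
    have h0 := ge_of_tendsto' hlim hbound
    exact sub_eq_zero.1 (abs_nonpos_iff.1 h0)
  have key' : ∀ a ∈ ⋂ k, ⋂ m, S k m, ∀ b ∈ ⋂ k, ⋂ m, S k m,
      ∀ k, ∫ x, f k x ∂(μ a) = ∫ x, f k x ∂(μ b) := by
    intro a ha b hb k
    rcases lt_trichotomy a b with hab | rfl | hab
    · exact key a ha b hb hab k
    · rfl
    · exact (key b hb a ha hab k).symm
  intro a ha b hb
  have hcont : ∀ c, Continuous fun g : C(Q, ℝ) => ∫ x, g x ∂(μ c) := fun c => by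
    refine (LipschitzWith.of_dist_le_mul (K := 1) fun g g' => ?_).continuous
    rw [Real.dist_eq, dist_eq_norm, NNReal.coe_one, one_mul]
    exact abs_integral_sub_le (μ c) g g'
  have heq : (fun g : C(Q, ℝ) => ∫ x, g x ∂(μ a)) = fun g : C(Q, ℝ) => ∫ x, g x ∂(μ b) :=
    hfd.equalizer (hcont a) (hcont b) (funext fun k => key' a ha b hb k)
  refine ext_of_forall_integral_eq_of_IsFiniteMeasure fun g => ?_
  exact congrFun heq g.toContinuousMap

/-- If almost all slices agree, every one-sided trace is the common slice. -/
lemma IsTrace.eq_of_ae_eq {T : ℝ} {μ : Kernel ℝ Q} {ν : ProbabilityMeasure Q} {ν₀ : Measure Q}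
    [IsProbabilityMeasure ν₀] {l : Filter ℝ} (h : IsTrace l μ ν) (hl : (l ⊓ ae volume).NeBot)
    (hlT : Ioo (-T) T ∈ l) (hμ : ∀ᵐ t ∂(volume.restrict (Ioo (-T) T)), μ t = ν₀) :
    (ν : Measure Q) = ν₀ := by
  have hev : ∀ᶠ t in l ⊓ ae volume, μ t = ν₀ := by
    have h1 : ∀ᶠ t in l ⊓ ae volume, t ∈ Ioo (-T) T := mem_inf_of_left hlT
    have h2 : ∀ᶠ t in l ⊓ ae volume, t ∈ Ioo (-T) T → μ t = ν₀ :=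
      mem_inf_of_right ((ae_restrict_iff' measurableSet_Ioo).1 hμ)
    filter_upwards [h1, h2] with t a b using b a
  refine ext_of_forall_integral_eq_of_IsFiniteMeasure fun g => ?_
  refine tendsto_nhds_unique (h g.toContinuousMap) ?_
  refine tendsto_const_nhds.congr' ?_
  filter_upwards [hev] with t ht
  rw [ht]; rfl

/-! ### Near-optimal velocities, traces and couplings. -/

lemma lintegral_cost_eq {π : Measure (Q × Q)} [IsFiniteMeasure π] :
    ∫⁻ p, ‖p.1 - p.2‖ₑ ^ 2 ∂π = ENNReal.ofReal (transportCost π) := by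
  have hc : Continuous fun p : Q × Q => ‖p.1 - p.2‖ ^ 2 := by fun_prop
  rw [transportCost, ofReal_integral_eq_lintegral_ofReal
    (hc.integrable_of_hasCompactSupport (HasCompactSupport.of_compactSpace _))
    (ae_of_all _ fun p => sq_nonneg _)]
  refine lintegral_congr fun p => ?_
  rw [ENNReal.ofReal_pow (norm_nonneg _), ofReal_norm]

/-- Near-optimal traces and couplings for the boundary term. -/
lemma exists_coupling_of_traceCost_ne_top {l : Filter ℝ} {μ : Kernel ℝ Q} (h : traceCost l μ ≠ ⊤)
    {δ : ℝ} (hδ : 0 < δ) : ∃ (ν : ProbabilityMeasure Q) (π : Measure (Q × Q)), IsTrace l μ ν ∧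
      IsCoupling π ν volume ∧ transportCost π ≤ (traceCost l μ).toReal + δ := by
  have hlt : traceCost l μ < traceCost l μ + ENNReal.ofReal δ :=
    ENNReal.lt_add_right h (by simpa using hδ)
  conv_lhs at hlt => rw [traceCost]
  simp only [WperSq, iInf_lt_iff] at hlt
  obtain ⟨ν, hν, π, h1, h2, hlt⟩ := hlt
  have hπ : IsCoupling π ν volume := ⟨h1, h2⟩
  have := hπ.isProbabilityMeasure
  refine ⟨ν, π, hν, hπ, ?_⟩
  rw [lintegral_cost_eq, ← ENNReal.ofReal_toReal h, ← ENNReal.ofReal_add ENNReal.toReal_nonneg hδ.le]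
    at hlt
  exact (ENNReal.ofReal_le_ofReal_iff (by positivity)).1 hlt.le

lemma IsVelocity.congr {T : ℝ} {μ : Kernel ℝ Q} {v w : ℝ × Q → ℝ} (hv : IsVelocity T μ v)
    (h : v =ᵐ[spaceTime T μ] w) : IsVelocity T μ w := by
  refine ⟨hv.integrable.congr h, fun φ hφ => ?_⟩
  rw [← hv.continuity_eq φ hφ]
  refine integral_congr_ae ?_
  filter_upwards [h] with z hz
  rw [hz]

/-- A near-optimal measurable velocity. -/
lemma exists_velocity_of_internalEnergy_ne_top {T : ℝ} {μ : Kernel ℝ Q} [IsMarkovKernel μ]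
    (h : internalEnergy T μ ≠ ⊤) {δ : ℝ} (hδ : 0 < δ) : ∃ v, Measurable v ∧ IsVelocity T μ v ∧
      Integrable (fun z => v z ^ 2) (spaceTime T μ) ∧ perimeter T μ ≠ ⊤ ∧
      (perimeter T μ).toReal + ∫ t in Ioo (-T) T, speedSq μ v t ≤ (internalEnergy T μ).toReal + δ := by
  have hlt : internalEnergy T μ < internalEnergy T μ + ENNReal.ofReal δ :=
    ENNReal.lt_add_right h (by simpa using hδ)
  conv_lhs at hlt => rw [internalEnergy]
  simp only [iInf_lt_iff] at hlt
  obtain ⟨w, hw, hlt⟩ := hlt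
  have hwv := hw.integrable.aestronglyMeasurable.ae_eq_mk
  set v := hw.integrable.aestronglyMeasurable.mk w with hvdef
  have hvm : Measurable v := hw.integrable.aestronglyMeasurable.stronglyMeasurable_mk.measurable
  have hkin : kinetic T μ w = ∫⁻ z, ‖v z ^ 2‖ₑ ∂(spaceTime T μ) := by
    refine lintegral_congr_ae ?_
    filter_upwards [hwv] with z hz
    rw [hz, enorm_pow]
  have htop : perimeter T μ + kinetic T μ w ≠ ⊤ :=
    (hlt.trans_le le_top).ne
  have hP := (ENNReal.add_ne_top.1 htop).1
  have hK := (ENNReal.add_ne_top.1 htop).2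
  have hint : Integrable (fun z => v z ^ 2) (spaceTime T μ) :=
    ⟨(hvm.pow_const 2).aestronglyMeasurable, by
      rw [hasFiniteIntegral_iff_enorm, ← hkin]; exact hK.lt_top⟩
  have hkin' : kinetic T μ w = ENNReal.ofReal (∫ t in Ioo (-T) T, speedSq μ v t) := by
    have e : ∫ t in Ioo (-T) T, speedSq μ v t = ∫ z, v z ^ 2 ∂(spaceTime T μ) :=
      (integral_spaceTime hint).symm
    rw [e, hkin, ofReal_integral_eq_lintegral_ofReal hint (ae_of_all _ fun z => sq_nonneg _)]
    refine lintegral_congr fun z => ?_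
    rw [Real.enorm_of_nonneg (sq_nonneg _)]
  refine ⟨v, hvm, hw.congr hwv, hint, hP, ?_⟩
  have hnn : 0 ≤ ∫ t in Ioo (-T) T, speedSq μ v t := integral_nonneg fun t => speedSq_nonneg μ v t
  rw [hkin', ← ENNReal.ofReal_toReal hP, ← ENNReal.ofReal_toReal h,
    ← ENNReal.ofReal_add ENNReal.toReal_nonneg hδ.le,
    ← ENNReal.ofReal_add ENNReal.toReal_nonneg hnn] at hlt
  exact (ENNReal.ofReal_le_ofReal_iff (by positivity)).1 hlt.le

/-- A near-optimal velocity, traces and couplings for the energy. -/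
lemma exists_near_optimal {lam T : ℝ} (hlam : 0 < lam) {μ : Kernel ℝ Q} [IsMarkovKernel μ]
    (h : energy lam T μ ≠ ⊤) {η : ℝ} (hη : 0 < η) :
    ∃ (v : ℝ × Q → ℝ) (ν₁ ν₂ : ProbabilityMeasure Q) (π₁ π₂ : Measure (Q × Q)),
      Measurable v ∧ IsVelocity T μ v ∧ Integrable (fun z => v z ^ 2) (spaceTime T μ) ∧
      perimeter T μ ≠ ⊤ ∧
      IsTrace (𝓝[<] T) μ ν₁ ∧ IsCoupling π₁ ν₁ volume ∧
      IsTrace (𝓝[>] (-T)) μ ν₂ ∧ IsCoupling π₂ ν₂ volume ∧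
      (perimeter T μ).toReal + (∫ t in Ioo (-T) T, speedSq μ v t) +
        lam * (transportCost π₁ + transportCost π₂) ≤ (energy lam T μ).toReal + η := by
  -- This slack is spent once on the internal energy and, with weight `lam`, once on each boundary
  -- cost.
  have hδ : 0 < η / (1 + 2 * lam) := by positivity
  have hI := (ENNReal.add_ne_top.1 h).1
  have hB := (ENNReal.add_ne_top.1 h).2
  have hB' : traceCost (𝓝[<] T) μ + traceCost (𝓝[>] (-T)) μ ≠ ⊤ := fun hc => hB (by
    rw [hc, ENNReal.mul_top (by simpa using hlam)])
  have ht1 := (ENNReal.add_ne_top.1 hB').1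
  have ht2 := (ENNReal.add_ne_top.1 hB').2
  obtain ⟨v, hvm, hv, hv2, hP, hle⟩ := exists_velocity_of_internalEnergy_ne_top hI hδ
  obtain ⟨ν₁, π₁, hν₁, hπ₁, hc₁⟩ := exists_coupling_of_traceCost_ne_top ht1 hδ
  obtain ⟨ν₂, π₂, hν₂, hπ₂, hc₂⟩ := exists_coupling_of_traceCost_ne_top ht2 hδ
  refine ⟨v, ν₁, ν₂, π₁, π₂, hvm, hv, hv2, hP, hν₁, hπ₁, hν₂, hπ₂, ?_⟩
  rw [energy, ENNReal.toReal_add hI hB, ENNReal.toReal_mul, ENNReal.toReal_add ht1 ht2,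
    ENNReal.toReal_ofReal hlam.le]
  have e : η / (1 + 2 * lam) + lam * (η / (1 + 2 * lam) + η / (1 + 2 * lam)) = η := by
    field_simp; ring
  have h3 := mul_le_mul_of_nonneg_left (add_le_add hc₁ hc₂) hlam.le
  linarith

/-! ### Perimeter and the essential minimum of the number of atoms. -/

/-- For infinitely many atoms both sides take the default value `0`, so no finiteness is needed. -/
lemma numAtoms_eq_toReal (μ : Kernel ℝ Q) (t : ℝ) :
    numAtoms μ t = (((atoms (μ t)).encard : ℕ∞) : ℝ≥0∞).toReal := by
  by_cases h : (atoms (μ t)).Finite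
  · rw [numAtoms, ← h.cast_ncard_eq]; simp
  · rw [numAtoms, Set.Infinite.ncard h, Set.Infinite.encard_eq h]; simp

lemma ae_finite_atoms {T : ℝ} {μ : Kernel ℝ Q} [IsMarkovKernel μ] (h : perimeter T μ ≠ ⊤) :
    ∀ᵐ t ∂(volume.restrict (Ioo (-T) T)), (atoms (μ t)).Finite := by
  filter_upwards [ae_lt_top (measurable_encard_atoms μ) h] with t ht
  by_contra hinf
  rw [Set.Infinite.encard_eq hinf] at ht
  simp at ht

lemma integrableOn_numAtoms {T : ℝ} {μ : Kernel ℝ Q} [IsMarkovKernel μ] (h : perimeter T μ ≠ ⊤) :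
    IntegrableOn (numAtoms μ) (Ioo (-T) T) := by
  rw [show numAtoms μ = _ from funext (numAtoms_eq_toReal μ)]
  exact integrable_toReal_of_lintegral_ne_top (measurable_encard_atoms μ).aemeasurable h

lemma integral_numAtoms {T : ℝ} {μ : Kernel ℝ Q} [IsMarkovKernel μ] (h : perimeter T μ ≠ ⊤) :
    ∫ t in Ioo (-T) T, numAtoms μ t = (perimeter T μ).toReal := by
  rw [show numAtoms μ = _ from funext (numAtoms_eq_toReal μ)]
  exact integral_toReal (measurable_encard_atoms μ).aemeasurable
    (ae_lt_top (measurable_encard_atoms μ) h)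

/-- The essential minimum of the number of atoms is attained at generic times. -/
lemma exists_essential_min_atoms {T : ℝ} (hT : 0 < T) {μ : Kernel ℝ Q} [IsMarkovKernel μ]
    (hat : ∀ᵐ t ∂(volume.restrict (Ioo (-T) T)), IsPurelyAtomic (μ t))
    (hfin : ∀ᵐ t ∂(volume.restrict (Ioo (-T) T)), (atoms (μ t)).Finite) :
    ∃ N : ℕ, 0 < N ∧ (∀ᵐ t ∂(volume.restrict (Ioo (-T) T)), (N : ℝ) ≤ numAtoms μ t) ∧
      ∀ p : ℝ → Prop, (∀ᵐ t ∂(volume.restrict (Ioo (-T) T)), p t) →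
        ∃ s ∈ Ioo (-T) T, p s ∧ (atoms (μ s)).ncard = N := by
  classical
  have hne : (ae (volume.restrict (Ioo (-T) T))).NeBot := by
    rw [ae_neBot, Ne, Measure.restrict_eq_zero, Real.volume_Ioo]
    simp; linarith
  -- Some count occurs on a non-null set of times, since there are countably many. The least such
  -- count meets every almost sure property.
  have hex : ∃ n : ℕ, ∃ᶠ t in ae (volume.restrict (Ioo (-T) T)), (atoms (μ t)).ncard = n := by
    by_contra hcon
    simp only [not_exists, not_frequently] at hcon
    obtain ⟨t, ht⟩ := (ae_all_iff.2 hcon).exists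
    exact ht _ rfl
  have hattain : ∀ p : ℝ → Prop, (∀ᵐ t ∂(volume.restrict (Ioo (-T) T)), p t) →
      ∃ s ∈ Ioo (-T) T, p s ∧ (atoms (μ s)).ncard = Nat.find hex := by
    intro p hp
    obtain ⟨s, hs, hps, hsI⟩ := ((Nat.find_spec hex).and_eventually
      (hp.and (ae_restrict_mem measurableSet_Ioo))).exists
    exact ⟨s, hsI, hps, hs⟩
  refine ⟨Nat.find hex, ?_, ?_, hattain⟩
  · obtain ⟨s, -, ⟨h1, h2⟩, hs⟩ := hattain _ (hat.and hfin)
    rw [← hs]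
    exact ncard_atoms_pos h2 h1.measure_compl_atoms
  · have hlt : ∀ m, m < Nat.find hex →
        ∀ᵐ t ∂(volume.restrict (Ioo (-T) T)), (atoms (μ t)).ncard ≠ m := fun m hm =>
      not_frequently.1 (Nat.find_min hex hm)
    have hall := ae_all_iff.2 fun m => ae_all_iff.2 (hlt m)
    filter_upwards [hall] with t ht
    rw [numAtoms, Nat.cast_le]
    by_contra hcon
    exact ht _ (not_le.1 hcon) rfl

/-! ### Elementary comparisons of segment energies. -/

/-- The energy of `n` equidistant straight segments. -/
noncomputable def segmentEnergy (lam T n : ℝ) : ℝ := 2 * T * n + lam / (6 * n ^ 2)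

/-- If `T > 1`, then `lam ≤ 1 / 32`, against `hcase`; so `lam * T ≤ 1 / 32`, and the left side is at
least `2 T N + lam / (7 N ^ 2)`. Doubling the segments adds `2 T N` but leaves, with the slack, only
`lam / (12 N ^ 2)`. This requires `(1 / 7 - 1 / 12) lam ≤ 2 T N ^ 3`, while `3 T N ^ 3 ≤ lam * (lam
* T) ≤ lam / 32`. -/
lemma coarse_count_contradiction {lam T N : ℝ} (hlam : 0 < lam) (hT : 0 < T)
    (hsmall : lam * min 1 T ≤ 1 / 32) (hN : 1 ≤ N) (hcase : 3 * N ^ 3 < lam ^ 2)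
    (h : 2 * T * N + 1 / (6 * N ^ 2) / (2 * T + 1 / lam) ≤
      segmentEnergy lam T (2 * N) + lam / (24 * N ^ 2)) : False := by
  have hN0 : 0 < N := by linarith
  have hN3 : 1 ≤ N ^ 3 := one_le_pow₀ hN
  have hT1 : T ≤ 1 := by
    by_contra hc
    rw [min_eq_left (not_le.1 hc).le] at hsmall
    nlinarith
  rw [min_eq_right hT1] at hsmall
  have h1 : 1 / (6 * N ^ 2) / (2 * T + 1 / lam) = lam / N ^ 2 * (1 / (6 * (2 * (lam * T) + 1))) := by
    field_simp
  have h2 : (1 : ℝ) / 7 ≤ 1 / (6 * (2 * (lam * T) + 1)) := by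
    have : 0 < lam * T := by positivity
    rw [div_le_div_iff₀ (by norm_num) (by positivity)]
    linarith
  have h3 : lam / N ^ 2 * (1 / 7) ≤ lam / N ^ 2 * (1 / (6 * (2 * (lam * T) + 1))) := by gcongr
  have h4 : segmentEnergy lam T (2 * N) = 4 * T * N + lam / N ^ 2 * (1 / 24) := by
    rw [segmentEnergy]; field_simp; ring
  have h5 : lam / (24 * N ^ 2) = lam / N ^ 2 * (1 / 24) := by field_simp
  rw [h1, h4, h5] at h
  have h6 : lam / N ^ 2 * (1 / 7 - 1 / 12) ≤ 2 * T * N := by linarith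
  have h7 : lam * (1 / 7 - 1 / 12) ≤ 2 * T * N ^ 3 := by
    have := mul_le_mul_of_nonneg_right h6 (sq_nonneg N)
    have e : lam / N ^ 2 * (1 / 7 - 1 / 12) * N ^ 2 = lam * (1 / 7 - 1 / 12) := by field_simp
    rw [e] at this
    linarith [show 2 * T * N * N ^ 2 = 2 * T * N ^ 3 by ring]
  have h8 : T * (3 * N ^ 3) ≤ lam * (1 / 32) := by
    calc T * (3 * N ^ 3) ≤ T * lam ^ 2 := by gcongr
      _ = lam * (lam * T) := by ring
      _ ≤ _ := by gcongr
  linarith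

lemma rpow_third_le {x y : ℝ} (hx : 0 ≤ x) (hy : 0 ≤ y) (h : x ≤ y ^ 3) : x ^ (1 / 3 : ℝ) ≤ y := by
  have := Real.rpow_le_rpow hx h (show (0 : ℝ) ≤ 1 / 3 by norm_num)
  rw [show (1 / 3 : ℝ) = ((3 : ℕ) : ℝ)⁻¹ by norm_num] at this ⊢
  rwa [Real.pow_rpow_inv_natCast hy (by norm_num)] at this

lemma le_rpow_third {x y : ℝ} (hy : 0 ≤ y) (h : y ^ 3 ≤ x) : y ≤ x ^ (1 / 3 : ℝ) := by
  have := Real.rpow_le_rpow (pow_nonneg hy 3) h (show (0 : ℝ) ≤ 1 / 3 by norm_num)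
  rw [show (1 / 3 : ℝ) = ((3 : ℕ) : ℝ)⁻¹ by norm_num] at this ⊢
  rwa [Real.pow_rpow_inv_natCast hy (by norm_num)] at this

/-- The optimal number of segments scales like `max(1, λ/T)^{1/3}`. -/
lemma optimal_count_bounds {lam T : ℝ} (hlam : 0 < lam) (hT : 0 < T) {N : ℕ} (hN : 0 < N)
    (h : ∀ M : ℕ, 0 < M → segmentEnergy lam T N ≤ segmentEnergy lam T M) :
    1 / 3 * (max 1 (lam / T)) ^ (1 / 3 : ℝ) ≤ (N : ℝ) ∧
      (N : ℝ) ≤ 1 * (max 1 (lam / T)) ^ (1 / 3 : ℝ) := by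
  have hN1 : (1 : ℝ) ≤ N := by exact_mod_cast hN
  have hN0 : (0 : ℝ) < N := by linarith
  have hN3 : (1 : ℝ) ≤ (N : ℝ) ^ 3 := one_le_pow₀ hN1
  constructor
  -- Doubling gives `lam ≤ 16 T N ^ 3`; the cube `27 N ^ 3` leaves room and also dominates `1`.
  · have h1 := h (2 * N) (by omega)
    simp only [segmentEnergy] at h1
    push_cast at h1
    have e : lam / (6 * (2 * (N : ℝ)) ^ 2) = lam / (6 * (N : ℝ) ^ 2) / 4 := by field_simp; norm_num
    rw [e] at h1
    have h2 : lam / (6 * (N : ℝ) ^ 2) * (3 / 4) ≤ 2 * T * N := by linarith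
    have h3 := mul_le_mul_of_nonneg_right h2 (show 0 ≤ 8 * (N : ℝ) ^ 2 by positivity)
    have e2 : lam / (6 * (N : ℝ) ^ 2) * (3 / 4) * (8 * (N : ℝ) ^ 2) = lam := by field_simp; norm_num
    rw [e2] at h3
    have h4 : lam / T ≤ (3 * (N : ℝ)) ^ 3 := by
      rw [div_le_iff₀ hT]
      nlinarith [mul_pos hT (pow_pos hN0 3)]
    have := rpow_third_le (x := max 1 (lam / T)) (y := 3 * N) (by positivity) (by positivity)
      (max_le (by nlinarith) h4)
    linarith
  · rw [one_mul]
    refine le_rpow_third hN0.le ?_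
    rcases Nat.lt_or_ge N 2 with hN2 | hN2
    · have : N = 1 := by omega
      subst this
      simp
    refine le_max_of_le_right ?_
    -- Half of `N`, rounded up, saves at least a quarter of the perimeter once `N ≥ 2`, and at most
    -- quadruples the boundary term.
    obtain ⟨M, hM1, hM2⟩ : ∃ M : ℕ, N ≤ 2 * M ∧ 4 * M ≤ 3 * N := ⟨(N + 1) / 2, by omega, by omega⟩
    have h1 := h M (by omega)
    have hM1' : (N : ℝ) ≤ 2 * M := by exact_mod_cast hM1
    have hM2' : 4 * (M : ℝ) ≤ 3 * N := by exact_mod_cast hM2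
    have hM0 : (0 : ℝ) < M := by linarith
    simp only [segmentEnergy] at h1
    have h2 : lam / (6 * (M : ℝ) ^ 2) ≤ 4 * (lam / (6 * (N : ℝ) ^ 2)) := by
      rw [← mul_div_assoc, div_le_div_iff₀ (by positivity) (by positivity)]
      have : (N : ℝ) ^ 2 ≤ (2 * M) ^ 2 := by gcongr
      nlinarith
    have h3 : 2 * T * M ≤ 2 * T * (3 / 4 * N) := mul_le_mul_of_nonneg_left (by linarith) (by linarith)
    have h4 : T * N / 2 ≤ 3 * (lam / (6 * (N : ℝ) ^ 2)) := by linarith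
    have h5 := mul_le_mul_of_nonneg_right h4 (show 0 ≤ 2 * (N : ℝ) ^ 2 by positivity)
    have e : 3 * (lam / (6 * (N : ℝ) ^ 2)) * (2 * (N : ℝ) ^ 2) = lam := by field_simp; norm_num
    rw [e] at h5
    rw [le_div_iff₀ hT]
    linarith [show T * N / 2 * (2 * (N : ℝ) ^ 2) = (N : ℝ) ^ 3 * T by ring]

/-! ### The theorem. -/

theorem theorem1p6 :
    ∃ ε c C : ℝ, 0 < ε ∧ 0 < c ∧ 0 < C ∧
      ∀ lam T : ℝ, 0 < lam → 0 < T → lam * min 1 T ≤ ε →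
        ∀ μ : Kernel ℝ Q, IsMinimizer lam T μ →
          ∃ (N : ℕ) (x₀ : Q), 0 < N ∧
            (∀ᵐ t ∂(volume.restrict (Ioo (-T) T)), μ t = equidistant N x₀) ∧
            c * (max 1 (lam / T)) ^ (1 / 3 : ℝ) ≤ (N : ℝ) ∧
            (N : ℝ) ≤ C * (max 1 (lam / T)) ^ (1 / 3 : ℝ) := by
  refine ⟨1 / 32, 1 / 3, 1, by norm_num, by norm_num, by norm_num, ?_⟩
  intro lam T hlam hT hsmall μ hmin
  have : IsMarkovKernel μ := hmin.1.markov
  have hat := hmin.1.atomic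
  have hseg0 : ∀ M : ℕ, 0 ≤ segmentEnergy lam T M := fun M => by rw [segmentEnergy]; positivity
  have hcomp : ∀ M : ℕ, 0 < M → energy lam T μ ≤ ENNReal.ofReal (segmentEnergy lam T M) :=
    fun M hM => (hmin.2 _ (admissible_const_equidistant T hM 0)).trans
      (energy_const_equidistant_le hlam hT hM)
  have htop : energy lam T μ ≠ ⊤ := ((hcomp 1 one_pos).trans_lt ENNReal.ofReal_lt_top).ne
  have hE : ∀ M : ℕ, 0 < M → (energy lam T μ).toReal ≤ segmentEnergy lam T M := fun M hM =>
    ENNReal.toReal_le_of_le_ofReal (hseg0 M) (hcomp M hM)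
  have hnear := fun η (hη : (0 : ℝ) < η) => exists_near_optimal hlam htop hη
  obtain ⟨v₀, -, -, -, -, -, hv₀, hv₀2, hP, -⟩ := hnear 1 one_pos
  have hfin := ae_finite_atoms hP
  have hni := integrableOn_numAtoms hP
  obtain ⟨N, hN, hge, hgen⟩ := exists_essential_min_atoms hT hat hfin
  have hN1 : (1 : ℝ) ≤ N := by exact_mod_cast hN
  have hN0 : (0 : ℝ) < N := by linarith
  have hX : ∫ t in Ioo (-T) T, (numAtoms μ t - N) = (perimeter T μ).toReal - 2 * T * N := by
    rw [integral_sub hni (integrable_const _), integral_numAtoms hP]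
    simp only [integral_const, measureReal_restrict_apply_univ, smul_eq_mul]
    rw [Real.volume_real_Ioo_of_le (by linarith)]
    ring
  have hX0 : 0 ≤ ∫ t in Ioo (-T) T, (numAtoms μ t - N) := by
    refine integral_nonneg_of_ae ?_
    filter_upwards [hge] with t ht
    exact sub_nonneg.2 ht
  rw [hX] at hX0
  -- At this time the count is minimal and the curve is weakly continuous, so `μ s` is the trace
  -- from both sides.
  obtain ⟨s, hs, ⟨⟨hsat, hsfin⟩, hνs⟩, hsN⟩ := hgen _ ((hat.and hfin).and (hv₀.ae_isTrace hv₀2))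
  have hcase : lam ^ 2 ≤ 3 * (N : ℝ) ^ 3 := by
    by_contra hc
    obtain ⟨v, ν₁, ν₂, π₁, π₂, hvm, hv, hv2, -, hν₁, hπ₁, hν₂, hπ₂, hle⟩ :=
      hnear (lam / (24 * (N : ℝ) ^ 2)) (by positivity)
    have hb := (IsFiniteCurve.mk hvm hv hv2 hat hfin).coarse_lower_bound hlam hs hsat hsfin hsN hνs
      hν₁ hπ₁ hν₂ hπ₂
    have h2N := hE (2 * N) (by omega)
    push_cast at h2N
    exact coarse_count_contradiction hlam hT hsmall hN1 (not_le.1 hc) (by linarith)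
  -- With `L = lam` and `θ = 1 / 2` the condition on `θ` is `hcase`. Half of the excess perimeter
  -- compensates the extra atoms; the other half is bounded by `η` through comparison with `N`
  -- segments.
  have hstep : ∀ η : ℝ, 0 < η →
      (perimeter T μ).toReal - 2 * T * N ≤ 2 * η ∧
        segmentEnergy lam T N ≤ (energy lam T μ).toReal + η := by
    intro η hη
    obtain ⟨v, ν₁, ν₂, π₁, π₂, hvm, hv, hv2, -, hν₁, hπ₁, hν₂, hπ₂, hle⟩ := hnear η hη
    have hb := (IsFiniteCurve.mk hvm hv hv2 hat hfin).lower_bound hlam hs hsat hsfin hsN hνs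
      hν₁ hπ₁ hν₂ hπ₂ hN hge hni (θ := 1 / 2) (by linarith)
    rw [hX] at hb
    have hEN := hE N hN
    simp only [segmentEnergy] at hEN ⊢
    constructor <;> linarith
  have hPN : (perimeter T μ).toReal - 2 * T * N = 0 := by
    refine le_antisymm (le_of_forall_pos_le_add fun η hη => ?_) hX0
    linarith [(hstep (η / 2) (by linarith)).1]
  have hEN : segmentEnergy lam T N ≤ (energy lam T μ).toReal :=
    le_of_forall_pos_le_add fun η hη => (hstep η hη).2
  -- With `L = 2 * lam` the lower bound doubles, while the kinetic energy still counts once;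
  -- subtracting it from twice the upper bound leaves kinetic energy at most `η`. Here `θ = 2`
  -- multiplies a zero excess and only has to satisfy `(2 lam) ^ 2 ≤ 6 θ N ^ 3`.
  have hopt : ∀ η : ℝ, 0 < η → ∃ (v : ℝ × Q → ℝ) (ν₁ ν₂ : ProbabilityMeasure Q)
      (π₁ π₂ : Measure (Q × Q)), IsVelocity T μ v ∧ Integrable (fun z => v z ^ 2) (spaceTime T μ) ∧
      IsTrace (𝓝[<] T) μ ν₁ ∧ IsCoupling π₁ ν₁ volume ∧
      IsTrace (𝓝[>] (-T)) μ ν₂ ∧ IsCoupling π₂ ν₂ volume ∧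
      (∫ t in Ioo (-T) T, speedSq μ v t) ≤ η ∧
      lam * (transportCost π₁ + transportCost π₂) ≤ lam / (6 * (N : ℝ) ^ 2) + η := by
    intro η hη
    obtain ⟨v, ν₁, ν₂, π₁, π₂, hvm, hv, hv2, -, hν₁, hπ₁, hν₂, hπ₂, hle⟩ :=
      hnear (η / 2) (by linarith)
    refine ⟨v, ν₁, ν₂, π₁, π₂, hv, hv2, hν₁, hπ₁, hν₂, hπ₂, ?_⟩
    have hb := (IsFiniteCurve.mk hvm hv hv2 hat hfin).lower_bound (L := 2 * lam) (by linarith)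
      hs hsat hsfin hsN hνs hν₁ hπ₁ hν₂ hπ₂ hN hge hni (θ := 2) (by nlinarith)
    rw [hX, hPN, mul_zero, sub_zero] at hb
    have hEN' := hE N hN
    simp only [segmentEnergy] at hEN'
    have e : 2 * lam / (6 * (N : ℝ) ^ 2) = 2 * (lam / (6 * (N : ℝ) ^ 2)) := by ring
    have hk : 0 ≤ ∫ t in Ioo (-T) T, speedSq μ v t := integral_nonneg fun t => speedSq_nonneg μ v t
    constructor <;> linarith
  obtain ⟨S, hSae, hS⟩ := ae_slice_eq_of_small_velocity (μ := μ) (T := T) fun η hη => by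
    obtain ⟨v, -, -, -, -, hv, hv2, -, -, -, -, hk, -⟩ := hopt η hη
    exact ⟨v, hv, hv2, hk⟩
  obtain ⟨r, hr, ⟨⟨hrat, hrfin⟩, hrS⟩, hrN⟩ := hgen _ ((hat.and hfin).and hSae)
  have hconst : ∀ᵐ t ∂(volume.restrict (Ioo (-T) T)), μ t = μ r := by
    filter_upwards [hSae] with t ht using hS t ht r hrS
  have hTT : -T < T := by linarith
  obtain ⟨x₀, hx₀⟩ : ∃ x₀, μ r = equidistant N x₀ := by
    refine eq_equidistant_of_transportCost_le hrfin hrat.measure_compl_atoms hrN fun η hη => ?_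
    obtain ⟨v, ν₁, ν₂, π₁, π₂, -, -, hν₁, hπ₁, hν₂, hπ₂, -, hc⟩ := hopt (lam * η) (by positivity)
    have hc' : transportCost π₁ + transportCost π₂ ≤ 1 / (6 * (N : ℝ) ^ 2) + η := by
      refine le_of_mul_le_mul_left ?_ hlam
      rwa [mul_add lam (1 / _), mul_one_div]
    have e1 := hν₁.eq_of_ae_eq (neBot_nhdsWithin_Iio_inf_ae T) (Ioo_mem_nhdsLT hTT) hconst
    have e2 := hν₂.eq_of_ae_eq (neBot_nhdsWithin_Ioi_inf_ae (-T)) (Ioo_mem_nhdsGT hTT) hconst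
    rw [e1] at hπ₁
    rw [e2] at hπ₂
    have e3 : 1 / (6 * (N : ℝ) ^ 2) = 2 * (1 / (12 * (N : ℝ) ^ 2)) := by field_simp; norm_num
    -- Both couplings have first marginal `μ r`, and their costs sum to at most twice the optimum
    -- plus `η`, so one of them is near-optimal.
    by_cases h1 : transportCost π₁ ≤ 1 / (12 * (N : ℝ) ^ 2) + η
    · exact ⟨π₁, hπ₁, h1⟩
    · exact ⟨π₂, hπ₂, by linarith⟩
  have hbounds := optimal_count_bounds hlam hT hN fun M hM => hEN.trans (hE M hM)
  refine ⟨N, x₀, hN, ?_, hbounds.1, hbounds.2⟩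
  filter_upwards [hconst] with t ht
  rw [ht, hx₀]
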